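/- Let $k$ be a field, $A$ a $k$-algebra and $E$ an $(A,A)$-bimodule (on which the two $k$-actions agree), with bimodule endomorphisms $x\in\mathrm{End}(E)$ and $\tau\in\mathrm{End}(E^2)$, where $E^n=E\otimes_A\cdots\otimes_A E$ ($n$ factors, $E^0=A$) and juxtaposition denotes tensor product, so that $Ex=\mathrm{id}_E\otimes x$ and $xE=x\otimes\mathrm{id}_E$. Assume the nil affine Hecke relations $$\tau^2=0,\qquad \tau E\circ E\tau\circ\tau E=E\tau\circ\tau E\circ E\tau,\qquad \tau\circ Ex=xE\circ\tau+1,\qquad Ex\circ\tau=\tau\circ xE+1 .$$ Assume that ${}_AE$ is finitely generated and projective and that, for every $n\ge 0$, $E^n$ is free as a module over $P_n=k[x_1,\dots,x_n]$, where $x_i$ acts by $E^{n-i}xE^{i-1}$. Let $E_y=E[y]/(x-y)E[y]$, i.e. $E$ regarded as an $(A[y],A[y])$-bimodule with $y$ acting on both sides by $x$; let $\pi:E[y]\to E_y$, $ey^n\mapsto x^n(e)$, be the projection, and let $s=\tau\circ(Ex-xE)-1\in\mathrm{End}(E^2)$, which induces $s:E_y\otimes_{A[y]}E[y]\to E[y]\otimes_{A[y]}E_y$.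 Let $B=\begin{pmatrix}A[y]&E_y\\0&A[y]\end{pmatrix}$, $e_1=\begin{pmatrix}1&0\\0&0\end{pmatrix}\in B$, and let $E'$ be the complex of $(B,B)$-bimodules $$\begin{pmatrix}E[y]&E[y]\otimes_{A[y]} E_y\\0&E[y]\end{pmatrix}\longrightarrow\begin{pmatrix}E_y&E_y\otimes_{A[y]} E_y\\A[y]&E_y\end{pmatrix}$$ in degrees $0$ and $1$, with differential $\begin{pmatrix}\pi&\pi\otimes\mathrm{id}\\0&\pi\end{pmatrix}$; both terms carry the matrix actions of $B$, except that in degree $0$ the part $E_y$ of $B$ acts on the left through $s:E_y\otimes_{A[y]} E[y]\to E[y]\otimes_{A[y]} E_y$. Put $X_1=Be_1$ (in degree $0$), $X_2=E'\otimes_BX_1$, $X=X_1\oplus X_2$, and let $$C=\mathrm{End}_{K^b(B)}(X)^{\mathrm{op}},\qquad \tilde E=\mathrm{Hom}_{K^b(B)}(X,E'\otimes_BX),$$ where $K^b(B)$ is the homotopy category of bounded complexes of left $B$-modules, and where $\varphi\in C$ acts on $\tilde E$ on the left by $f\mapsto f\circ\varphi$ and on the right by $f\mapsto E'(\varphi)\circ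 f$; thus $\tilde E$ is a $(C,C)$-bimodule. Call a bimodule $M$ over a ring $R$ locally nilpotent if for every left $R$-module $N$ there is an $n$ with $M^n\otimes_RN=0$. Then $E$ is locally nilpotent if and only if $E^n=0$ for some $n$; and if $E$ is locally nilpotent, then $\tilde E$ is locally nilpotent, and $\tilde E^{n}=0$ for some $n$. -/

import Mathlib

open CategoryTheory MulOpposite Polynomial
set_option linter.unusedSectionVars false
set_option linter.unusedVariables false

/-! Given additive functors `F`, `G` and a natural transformation `α : F ⟶ G`, the functor sending a
complex `K` to the total complex of the double complex `F K ⟶ G K`, with `F K` in column `0` and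
`G K` in column `1`: in degree `n` it is `F Kⁿ ⊕ G Kⁿ⁻¹`, with differential
`(k, l) ↦ (d k, α k - d l)`. -/
namespace CoconeFunctor
open CategoryTheory.Limits CochainComplex CochainComplex.HomComplex HomologicalComplex
universe v u
variable {𝒜 : Type u} [Category.{v} 𝒜] [Preadditive 𝒜] [HasBinaryBiproducts 𝒜]

theorem cochain_ext {K L M : CochainComplex 𝒜 ℤ} (φ : K ⟶ L) {n m : ℤ} (h : m + 1 = n)
    (z w : Cochain M (mappingCocone φ) n)
    (h1 : z.comp (Cochain.ofHom (mappingCocone.fst φ)) (add_zero n) =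
      w.comp (Cochain.ofHom (mappingCocone.fst φ)) (add_zero n))
    (h2 : z.comp (mappingCocone.snd φ) (show n + -1 = m by lia) =
      w.comp (mappingCocone.snd φ) (show n + -1 = m by lia)) : z = w := by
  ext p q hpq
  have e1 := Cochain.congr_v h1 p q hpq
  have e2 := Cochain.congr_v h2 p (q + -1) (by lia)
  rw [Cochain.comp_v _ _ _ p q (q + -1) hpq rfl, Cochain.comp_v _ _ _ p q (q + -1) hpq rfl] at e2
  simp only [Cochain.comp_zero_cochain_v, Cochain.ofHom_v] at e1
  rw [← Category.comp_id (z.v p q hpq), ← Category.comp_id (w.v p q hpq),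
    ← mappingCocone.id_X φ q (q + -1) rfl, Preadditive.comp_add, Preadditive.comp_add,
    reassoc_of% e1, reassoc_of% e2]

theorem inl_fst {K L : CochainComplex 𝒜 ℤ} (φ : K ⟶ L) :
    (mappingCocone.inl φ).comp (Cochain.ofHom (mappingCocone.fst φ)) (add_zero 0) =
      Cochain.ofHom (𝟙 _) := by
  ext p
  simp

theorem inr_fst {K L : CochainComplex 𝒜 ℤ} (φ : K ⟶ L) :
    (mappingCocone.inr φ).1.comp (Cochain.ofHom (mappingCocone.fst φ)) (add_zero 1) = 0 := by
  ext p q hpq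
  simp

theorem inl_snd {K L : CochainComplex 𝒜 ℤ} (φ : K ⟶ L) :
    (mappingCocone.inl φ).comp (mappingCocone.snd φ) (zero_add (-1)) = 0 := by
  ext p q hpq
  simp

theorem inr_snd {K L : CochainComplex 𝒜 ℤ} (φ : K ⟶ L) :
    (mappingCocone.inr φ).1.comp (mappingCocone.snd φ) (show (1 : ℤ) + -1 = 0 by lia) =
      Cochain.ofHom (𝟙 _) := by
  ext p
  rw [Cochain.comp_v _ _ _ p (p + 1) p rfl (by lia)]
  simp

theorem δ_snd {K L : CochainComplex 𝒜 ℤ} (φ : K ⟶ L) :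
    δ (-1) 0 (mappingCocone.snd φ) = -Cochain.ofHom (mappingCocone.fst φ ≫ φ) := by
  have h : mappingCocone.liftCochain φ (Cochain.ofHom (mappingCocone.fst φ))
      (mappingCocone.snd φ) (by lia) = Cochain.ofHom (𝟙 _) := by
    apply cochain_ext φ (m := -1) (by lia) <;> simp
  have h' := congrArg (δ 0 1) h
  rw [mappingCocone.δ_liftCochain _ _ _ _ _ (by lia)] at h'
  simp only [δ_ofHom, Cochain.zero_comp, zero_sub, neg_eq_zero] at h'
  have h'' := congrArg (fun z => z.comp (mappingCocone.snd φ) (show (1 : ℤ) + -1 = 0 by lia)) h'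
  simp only [Cochain.zero_comp] at h''
  rw [Cochain.comp_assoc (n₁₂ := 1) (n₂₃ := 0) (n₁₂₃ := 0)  _ _ _ (by lia) (by lia) (by lia)] at h''
  rw [inr_snd] at h''
  simp only [Cochain.comp_id, ← Cochain.ofHom_comp] at h''
  exact eq_neg_of_add_eq_zero_left h''

variable {F G : 𝒜 ⥤ 𝒜} [F.Additive] [G.Additive] (α : F ⟶ G)

/-- `α` applied termwise, `F K ⟶ G K`. -/
noncomputable def transf (K : CochainComplex 𝒜 ℤ) :
    (F.mapHomologicalComplex (ComplexShape.up ℤ)).obj K ⟶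
      (G.mapHomologicalComplex (ComplexShape.up ℤ)).obj K :=
  (NatTrans.mapHomologicalComplex α (ComplexShape.up ℤ)).app K

/-- The total complex of `F K ⟶ G K`. -/
noncomputable abbrev obj (K : CochainComplex 𝒜 ℤ) : CochainComplex 𝒜 ℤ :=
  mappingCocone (-(transf α K))

theorem transf_nat {K L : CochainComplex 𝒜 ℤ} (f : K ⟶ L) :
    (F.mapHomologicalComplex (ComplexShape.up ℤ)).map f ≫ transf α L =
      transf α K ≫ (G.mapHomologicalComplex (ComplexShape.up ℤ)).map f :=
  (NatTrans.mapHomologicalComplex α (ComplexShape.up ℤ)).naturality f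

/-- The map of total complexes induced by `f`: it is `F f` on `F K` and `G f` on `G K`. -/
noncomputable def map {K L : CochainComplex 𝒜 ℤ} (f : K ⟶ L) : obj α K ⟶ obj α L :=
  mappingCocone.lift (-(transf α L))
    (mappingCocone.fst (-(transf α K)) ≫ (F.mapHomologicalComplex (ComplexShape.up ℤ)).map f)
    ((mappingCocone.snd (-(transf α K))).comp
      (Cochain.ofHom ((G.mapHomologicalComplex (ComplexShape.up ℤ)).map f)) (add_zero (-1)))
    (by
      rw [δ_comp_ofHom, δ_snd, ← Cochain.ofHom_neg, ← Cochain.ofHom_comp, ← Cochain.ofHom_add]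
      simp [transf_nat])

theorem map_fst {K L : CochainComplex 𝒜 ℤ} (f : K ⟶ L) :
    (Cochain.ofHom (map α f)).comp (Cochain.ofHom (mappingCocone.fst (-(transf α L))))
      (add_zero 0) = (Cochain.ofHom (mappingCocone.fst (-(transf α K)))).comp
        (Cochain.ofHom ((F.mapHomologicalComplex (ComplexShape.up ℤ)).map f)) (add_zero 0) := by
  rw [map, mappingCocone.ofHom_lift, mappingCocone.liftCochain_comp_fst, Cochain.ofHom_comp]

theorem map_snd {K L : CochainComplex 𝒜 ℤ} (f : K ⟶ L) :
    (Cochain.ofHom (map α f)).comp (mappingCocone.snd (-(transf α L))) (zero_add (-1)) =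
      (mappingCocone.snd (-(transf α K))).comp
        (Cochain.ofHom ((G.mapHomologicalComplex (ComplexShape.up ℤ)).map f)) (add_zero (-1)) := by
  rw [map, mappingCocone.ofHom_lift, mappingCocone.liftCochain_comp_snd]

theorem hom_ext {K L M : CochainComplex 𝒜 ℤ} (φ : K ⟶ L) (f g : M ⟶ mappingCocone φ)
    (h1 : (Cochain.ofHom f).comp (Cochain.ofHom (mappingCocone.fst φ)) (add_zero 0) =
      (Cochain.ofHom g).comp (Cochain.ofHom (mappingCocone.fst φ)) (add_zero 0))
    (h2 : (Cochain.ofHom f).comp (mappingCocone.snd φ) (zero_add (-1)) =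
      (Cochain.ofHom g).comp (mappingCocone.snd φ) (zero_add (-1))) : f = g :=
  Cochain.ofHom_injective (cochain_ext φ (m := -1) (by lia) _ _ h1 h2)

/-- The total complex as a functor. -/
noncomputable def functor : CochainComplex 𝒜 ℤ ⥤ CochainComplex 𝒜 ℤ where
  obj := obj α
  map := map α
  map_id K := by
    apply hom_ext
    · rw [map_fst]; simp
    · rw [map_snd]; simp
  map_comp f g := by
    apply hom_ext
    · rw [map_fst, Cochain.ofHom_comp, Cochain.comp_assoc_of_first_is_zero_cochain, map_fst,
        ← Cochain.comp_assoc_of_first_is_zero_cochain, map_fst,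
        Cochain.comp_assoc_of_first_is_zero_cochain, Functor.map_comp, Cochain.ofHom_comp]
    · rw [map_snd, Cochain.ofHom_comp, Cochain.comp_assoc_of_first_is_zero_cochain, map_snd,
        ← Cochain.comp_assoc_of_third_is_zero_cochain, map_snd,
        Cochain.comp_assoc_of_third_is_zero_cochain, Functor.map_comp, Cochain.ofHom_comp]

instance : (functor α).Additive where
  map_add {K L f g} := by
    change map α (f + g) = map α f + map α g
    apply hom_ext
    · rw [map_fst, Cochain.ofHom_add, Cochain.add_comp, map_fst, map_fst]
      simp
    · rw [map_snd, Cochain.ofHom_add, Cochain.add_comp, map_snd, map_snd]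
      simp

theorem map_homotopic {K L : CochainComplex 𝒜 ℤ} (f g : K ⟶ L) (h : Homotopy f g) :
    Nonempty (Homotopy ((functor α).map f) ((functor α).map g)) := by
  obtain ⟨z, hz⟩ := (Cochain.equivHomotopy f g) h
  have hF := congrArg (fun w => w.map F) hz
  have hG := congrArg (fun w => w.map G) hz
  simp only [Cochain.map_ofHom, Cochain.map_add, ← δ_map] at hF hG
  have hnat : (z.map F).comp (Cochain.ofHom (transf α L)) (add_zero (-1)) =
      (Cochain.ofHom (transf α K)).comp (z.map G) (zero_add (-1)) := by
    ext p q hpq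
    simp only [Cochain.comp_zero_cochain_v, Cochain.zero_cochain_comp_v, Cochain.ofHom_v]
    exact α.naturality _
  change Nonempty (Homotopy (map α f) (map α g))
  refine ⟨(Cochain.equivHomotopy (map α f) (map α g)).symm
    ⟨mappingCocone.liftCochain (n := -1) (m := -2) (-(transf α L))
    ((Cochain.ofHom (mappingCocone.fst (-(transf α K)))).comp (z.map F) (zero_add (-1)))
    (-(mappingCocone.snd (-(transf α K))).comp (z.map G) (show -1 + -1 = -2 by lia)) (by lia), ?_⟩⟩
  rw [mappingCocone.δ_liftCochain _ _ _ _ 0 (by lia)]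
  apply cochain_ext _ (m := -1) (by lia)
  · rw [map_fst, hF, Cochain.add_comp, Cochain.sub_comp, map_fst,
      Cochain.comp_assoc_of_third_is_zero_cochain, inl_fst,
      Cochain.comp_assoc_of_third_is_zero_cochain, inr_fst]
    simp
  · rw [map_snd, hG, Cochain.add_comp, Cochain.sub_comp, map_snd,
      Cochain.comp_assoc_of_second_is_zero_cochain, inl_snd,
      Cochain.comp_assoc (n₁₂ := 0) (n₂₃ := 0) (n₁₂₃ := -1) _ _ _ (by lia) (by lia) (by lia),
      inr_snd]
    rw [δ_neg, δ_comp (mappingCocone.snd (-(transf α K))) (z.map G) (show -1 + -1 = -2 by lia) 0 0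
      (-1) (by lia) (by lia) (by lia), δ_snd]
    simp [hnat]

/-- The functor induced on homotopy categories. -/
noncomputable def homotopyFunctor :
    HomotopyCategory 𝒜 (ComplexShape.up ℤ) ⥤ HomotopyCategory 𝒜 (ComplexShape.up ℤ) :=
  CategoryTheory.Quotient.lift _ (functor α ⋙ HomotopyCategory.quotient 𝒜 (ComplexShape.up ℤ))
    (fun _ _ _ _ ⟨h⟩ => HomotopyCategory.eq_of_homotopy _ _ (map_homotopic α _ _ h).some)

instance : (homotopyFunctor α).Additive where
  map_add {K L f g} := by
    obtain ⟨f, rfl⟩ := (HomotopyCategory.quotient 𝒜 (ComplexShape.up ℤ)).map_surjective f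
    obtain ⟨g, rfl⟩ := (HomotopyCategory.quotient 𝒜 (ComplexShape.up ℤ)).map_surjective g
    change (HomotopyCategory.quotient 𝒜 (ComplexShape.up ℤ)).map ((functor α).map (f + g)) =
     (HomotopyCategory.quotient 𝒜 (ComplexShape.up ℤ)).map ((functor α).map f) +
     (HomotopyCategory.quotient 𝒜 (ComplexShape.up ℤ)).map ((functor α).map g)
    rw [Functor.map_add, Functor.map_add]
end CoconeFunctor

universe u
set_option linter.unusedSectionVars false

noncomputable section

/-- The tensor product `M ⊗_S N` of a right `S`-module and a left `S`-module. -/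
def BTensor (S M N : Type*) [Ring S] [AddCommGroup M] [Module Sᵐᵒᵖ M] [AddCommGroup N]
    [Module S N] : Type _ :=
  TensorProduct ℤ M N ⧸ AddSubgroup.closure
    {t : TensorProduct ℤ M N | ∃ (m : M) (s : S) (n : N),
      t = TensorProduct.tmul ℤ (op s • m) n - TensorProduct.tmul ℤ m (s • n)}

namespace BTensor

section basic
variable {S M N : Type*} [Ring S] [AddCommGroup M] [Module Sᵐᵒᵖ M] [AddCommGroup N] [Module S N]

instance : AddCommGroup (BTensor S M N) :=
  inferInstanceAs (AddCommGroup (TensorProduct ℤ M N ⧸ AddSubgroup.closure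
    {t : TensorProduct ℤ M N | ∃ (m : M) (s : S) (n : N),
      t = TensorProduct.tmul ℤ (op s • m) n - TensorProduct.tmul ℤ m (s • n)}))

variable (S) in
/-- The pure tensor `m ⊗ n`. -/
def tmul (m : M) (n : N) : BTensor S M N := QuotientAddGroup.mk (TensorProduct.tmul ℤ m n)

theorem tmul_add (m : M) (n n' : N) : tmul S m (n + n') = tmul S m n + tmul S m n' :=
  congrArg QuotientAddGroup.mk (TensorProduct.tmul_add m n n')

theorem add_tmul (m m' : M) (n : N) : tmul S (m + m') n = tmul S m n + tmul S m' n :=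
  congrArg QuotientAddGroup.mk (TensorProduct.add_tmul m m' n)

theorem op_smul_tmul (s : S) (m : M) (n : N) : tmul S (op s • m) n = tmul S m (s • n) := by
  refine (QuotientAddGroup.eq_iff_sub_mem).2 (AddSubgroup.subset_closure ⟨m, s, n, rfl⟩)

@[simp]
theorem tmul_zero (m : M) : tmul S m (0 : N) = 0 :=
  congrArg QuotientAddGroup.mk (TensorProduct.tmul_zero N m)

@[simp]
theorem zero_tmul (n : N) : tmul S (0 : M) n = 0 :=
  congrArg QuotientAddGroup.mk (TensorProduct.zero_tmul M n)

theorem induction {p : BTensor S M N → Prop} (h0 : p 0) (ht : ∀ m n, p (tmul S m n))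
    (ha : ∀ t t', p t → p t' → p (t + t')) (t : BTensor S M N) : p t := by
  obtain ⟨t, rfl⟩ := QuotientAddGroup.mk_surjective t
  induction t using TensorProduct.induction_on with
  | zero => exact h0
  | tmul m n => exact ht m n
  | add a b ha' hb' => exact ha _ _ ha' hb'

theorem hom_eq {P : Type*} [AddCommGroup P] (f g : BTensor S M N →+ P)
    (h : ∀ m n, f (tmul S m n) = g (tmul S m n)) (t : BTensor S M N) : f t = g t := by
  induction t using induction with
  | h0 => simp
  | ht m n => exact h m n
  | ha a b ha hb => simp [ha, hb]

/-- The additive map on `M ⊗_S N` induced by a balanced biadditive map. -/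
def lift {P : Type*} [AddCommGroup P] (f : M →+ N →+ P)
    (hf : ∀ (s : S) m n, f (op s • m) n = f m (s • n)) : BTensor S M N →+ P :=
  QuotientAddGroup.lift _
    (TensorProduct.liftAddHom f (fun r m n => by rw [map_zsmul, map_zsmul]; rfl))
    (by
      rw [AddSubgroup.closure_le]
      rintro _ ⟨m, s, n, rfl⟩
      simp [hf])

@[simp]
theorem lift_tmul {P : Type*} [AddCommGroup P] (f : M →+ N →+ P)
    (hf : ∀ (s : S) m n, f (op s • m) n = f m (s • n)) (m : M) (n : N) :
    lift f hf (tmul S m n) = f m n := rfl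

/-- The pure tensor as a biadditive map. -/
def tmulHom (S M N : Type*) [Ring S] [AddCommGroup M] [Module Sᵐᵒᵖ M] [AddCommGroup N]
    [Module S N] : M →+ N →+ BTensor S M N :=
  AddMonoidHom.mk' (fun m => AddMonoidHom.mk' (tmul S m) (tmul_add m))
    (fun m m' => by ext n; exact add_tmul m m' n)

@[simp]
theorem tmulHom_apply (m : M) (n : N) : tmulHom S M N m n = tmul S m n := rfl

variable {M' N' : Type*} [AddCommGroup M'] [Module Sᵐᵒᵖ M'] [AddCommGroup N'] [Module S N']

/-- `f ⊗ g` for a right `S`-linear map `f` and a left `S`-linear map `g`. -/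
def map (f : M →ₗ[Sᵐᵒᵖ] M') (g : N →ₗ[S] N') : BTensor S M N →+ BTensor S M' N' :=
  lift (((AddMonoidHom.compHom (P := BTensor S M' N')).flip g.toAddMonoidHom).comp
    ((tmulHom S M' N').comp f.toAddMonoidHom))
    (fun s m n => by
      change tmul S (f (op s • m)) (g n) = tmul S (f m) (g (s • n))
      rw [map_smul, map_smul, op_smul_tmul])

@[simp]
theorem map_tmul (f : M →ₗ[Sᵐᵒᵖ] M') (g : N →ₗ[S] N') (m : M) (n : N) :
    map f g (tmul S m n) = tmul S (f m) (g n) := rfl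

end basic

section left
variable {R S M N : Type*} [Ring R] [Ring S] [AddCommGroup M] [Module R M] [Module Sᵐᵒᵖ M]
  [SMulCommClass R Sᵐᵒᵖ M] [AddCommGroup N] [Module S N]

variable (S M) in
/-- Left multiplication by `r` on an `(R, S)`-bimodule. -/
def leftMul (r : R) : M →ₗ[Sᵐᵒᵖ] M where
  toFun m := r • m
  map_add' := smul_add r
  map_smul' s m := smul_comm r s m

@[simp]
theorem leftMul_apply (r : R) (m : M) : leftMul S M r m = r • m := rfl

/-- `M ⊗_S N` is a left `R`-module when `M` is an `(R, S)`-bimodule. -/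
instance : Module R (BTensor S M N) where
  smul r t := map (leftMul S M r) LinearMap.id t
  one_smul t := hom_eq (map (leftMul S M (1 : R)) LinearMap.id) (AddMonoidHom.id _)
    (fun m n => by simp) t
  mul_smul r r' t := hom_eq (map (leftMul S M (r * r')) LinearMap.id)
    ((map (leftMul S M r) LinearMap.id).comp
      (map (leftMul S M r') LinearMap.id)) (fun m n => by simp [mul_smul]) t
  smul_zero r := map_zero _
  smul_add r := map_add _
  add_smul r r' t := hom_eq (map (leftMul S M (r + r')) LinearMap.id)
    (map (leftMul S M r) LinearMap.id +
      map (leftMul S M r') LinearMap.id) (fun m n => by simp [add_smul, add_tmul]) t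
  zero_smul t := hom_eq (map (leftMul S M (0 : R)) LinearMap.id) 0
    (fun m n => by simp) t

theorem smul_tmul' (r : R) (m : M) (n : N) : r • tmul S m n = tmul S (r • m) n := rfl

end left

section right
variable {S T M N : Type*} [Ring S] [Ring T] [AddCommGroup M] [Module Sᵐᵒᵖ M]
  [AddCommGroup N] [Module S N] [Module Tᵐᵒᵖ N] [SMulCommClass S Tᵐᵒᵖ N]

variable (S N) in
/-- Right multiplication by `r` on an `(S, T)`-bimodule. -/
def rightMul (r : Tᵐᵒᵖ) : N →ₗ[S] N where
  toFun n := r • n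
  map_add' := smul_add r
  map_smul' s n := (smul_comm s r n).symm

@[simp]
theorem rightMul_apply (r : Tᵐᵒᵖ) (n : N) : rightMul S N r n = r • n := rfl

/-- `M ⊗_S N` is a right `T`-module when `N` is an `(S, T)`-bimodule. -/
instance : Module Tᵐᵒᵖ (BTensor S M N) where
  smul r t := map (LinearMap.id : M →ₗ[Sᵐᵒᵖ] M) (rightMul S N r) t
  one_smul t := hom_eq (map LinearMap.id (rightMul S N (1 : Tᵐᵒᵖ))) (AddMonoidHom.id _)
    (fun m n => by simp) t
  mul_smul r r' t := hom_eq (map LinearMap.id (rightMul S N (r * r')))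
    ((map LinearMap.id (rightMul S N r)).comp
      (map LinearMap.id (rightMul S N r'))) (fun m n => by simp [mul_smul]) t
  smul_zero r := map_zero _
  smul_add r := map_add _
  add_smul r r' t := hom_eq (map LinearMap.id (rightMul S N (r + r')))
    (map LinearMap.id (rightMul S N r) +
      map LinearMap.id (rightMul S N r')) (fun m n => by simp [add_smul, tmul_add]) t
  zero_smul t := hom_eq (map LinearMap.id (rightMul S N (0 : Tᵐᵒᵖ))) 0
    (fun m n => by simp) t

theorem smul_tmul_right (r : Tᵐᵒᵖ) (m : M) (n : N) : r • tmul S m n = tmul S m (r • n) := rfl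

variable {R : Type*} [Ring R] [Module R M] [SMulCommClass R Sᵐᵒᵖ M]

instance : SMulCommClass R Tᵐᵒᵖ (BTensor S M N) where
  smul_comm r t z := by
    induction z using induction with
    | h0 => simp
    | ht m n => simp only [smul_tmul', smul_tmul_right]
    | ha a b ha hb => simp only [smul_add, ha, hb]
end right

section linear
variable {R S M N N' : Type*} [Ring R] [Ring S] [AddCommGroup M] [Module R M] [Module Sᵐᵒᵖ M]
  [SMulCommClass R Sᵐᵒᵖ M] [AddCommGroup N] [Module S N] [AddCommGroup N'] [Module S N']

variable (R M) in
/-- `M ⊗ g` as a left `R`-linear map. -/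
def lTensor (g : N →ₗ[S] N') : BTensor S M N →ₗ[R] BTensor S M N' :=
  { map LinearMap.id g with
    map_smul' := fun r t => by
      induction t using induction with
      | h0 => simp
      | ht m n => rfl
      | ha a b ha hb => simpa using congrArg₂ (· + ·) ha hb }

@[simp]
theorem lTensor_tmul (g : N →ₗ[S] N') (m : M) (n : N) :
    lTensor R M g (tmul S m n) = tmul S m (g n) := rfl

end linear

section assoc
variable {S T M N P : Type*} [Ring S] [Ring T] [AddCommGroup M] [Module Sᵐᵒᵖ M]
  [AddCommGroup N] [Module S N] [Module Tᵐᵒᵖ N] [SMulCommClass S Tᵐᵒᵖ N] [AddCommGroup P]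
  [Module T P]

/-- The canonical map `(M ⊗ N) ⊗ P → M ⊗ (N ⊗ P)`. -/
def assocHom : BTensor T (BTensor S M N) P →+ BTensor S M (BTensor T N P) :=
  lift (AddMonoidHom.flip (AddMonoidHom.mk' (fun p : P =>
      lift ((AddMonoidHom.compHom (P := BTensor S M (BTensor T N P))).flip
        ((tmulHom T N P).flip p) |>.comp (tmulHom S M (BTensor T N P)))
      (fun s m n => by
        change tmul S (op s • m) (tmul T n p) = tmul S m (tmul T (s • n) p)
        rw [op_smul_tmul, smul_tmul']))
      (fun p p' => by
        ext t
        refine hom_eq _ _ (fun m n => ?_) t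
        change tmul S m (tmul T n (p + p')) = tmul S m (tmul T n p) + tmul S m (tmul T n p')
        rw [tmul_add, tmul_add])))
    (fun s t p => by
      induction t using induction with
      | h0 => simp
      | ht m n =>
        change tmul S m (tmul T (op s • n) p) = tmul S m (tmul T n (s • p))
        rw [op_smul_tmul]
      | ha a b ha hb =>
        rw [smul_add, map_add, map_add, AddMonoidHom.add_apply, AddMonoidHom.add_apply, ha, hb])

@[simp]
theorem assocHom_tmul (m : M) (n : N) (p : P) :
    assocHom (tmul T (tmul S m n) p) = tmul S m (tmul T n p) := rfl

/-- The canonical map `M ⊗ (N ⊗ P) → (M ⊗ N) ⊗ P`. -/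
def assocInv : BTensor S M (BTensor T N P) →+ BTensor T (BTensor S M N) P :=
  lift (AddMonoidHom.mk' (fun m : M =>
      lift ((tmulHom T (BTensor S M N) P).comp (tmulHom S M N m))
      (fun s n p => by
        change tmul T (tmul S m (op s • n)) p = tmul T (tmul S m n) (s • p)
        rw [← op_smul_tmul, smul_tmul_right]))
      (fun m m' => by
        ext t
        refine hom_eq _ _ (fun n p => ?_) t
        change tmul T (tmul S (m + m') n) p = tmul T (tmul S m n) p + tmul T (tmul S m' n) p
        rw [add_tmul, add_tmul]))
    (fun s m t => by
      induction t using induction with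
      | h0 => simp
      | ht n p =>
        change tmul T (tmul S (op s • m) n) p = tmul T (tmul S m (s • n)) p
        rw [op_smul_tmul]
      | ha a b ha hb => rw [smul_add, map_add, map_add, ha, hb])

@[simp]
theorem assocInv_tmul (m : M) (n : N) (p : P) :
    assocInv (tmul S m (tmul T n p)) = tmul T (tmul S m n) p := rfl

end assoc

/-- The functor `M ⊗_S -` from left `S`-modules to left `R`-modules, for an `(R, S)`-bimodule. -/
def functor (R S : Type*) (M : Type u) [Ring R] [Ring S] [AddCommGroup M] [Module R M]
    [Module Sᵐᵒᵖ M] [SMulCommClass R Sᵐᵒᵖ M] : ModuleCat.{u} S ⥤ ModuleCat.{u} R where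
  obj N := ModuleCat.of R (BTensor S M N)
  map f := ModuleCat.ofHom (lTensor R M f.hom)
  map_id N := by
    ext t
    exact hom_eq (lTensor R M (LinearMap.id : N →ₗ[S] N)).toAddMonoidHom (AddMonoidHom.id _)
      (fun m n => rfl) t
  map_comp {N N' N''} f g := by
    ext t
    exact hom_eq (lTensor R M (g.hom ∘ₗ f.hom)).toAddMonoidHom
      ((lTensor R M g.hom).toAddMonoidHom.comp (lTensor R M f.hom).toAddMonoidHom)
      (fun m n => rfl) t

instance (R S : Type*) (M : Type u) [Ring R] [Ring S] [AddCommGroup M] [Module R M]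
    [Module Sᵐᵒᵖ M] [SMulCommClass R Sᵐᵒᵖ M] : (functor R S M).Additive where
  map_add {N N' f g} := by
    ext t
    exact hom_eq (lTensor R M (f.hom + g.hom)).toAddMonoidHom
      ((lTensor R M f.hom).toAddMonoidHom + (lTensor R M g.hom).toAddMonoidHom)
      (fun m n => tmul_add m _ _) t

end BTensor

end

noncomputable section

/-- Homomorphisms of `(R, S)`-bimodules. -/
structure BiHom (R S M N : Type*) [Ring R] [Ring S] [AddCommGroup M] [Module R M] [Module Sᵐᵒᵖ M]
    [AddCommGroup N] [Module R N] [Module Sᵐᵒᵖ N] extends M →ₗ[R] N where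
  map_op_smul' : ∀ (s : Sᵐᵒᵖ) (m : M), toFun (s • m) = s • toFun m

namespace BiHom
variable {R S M N : Type*} [Ring R] [Ring S] [AddCommGroup M] [Module R M] [Module Sᵐᵒᵖ M]
    [AddCommGroup N] [Module R N] [Module Sᵐᵒᵖ N]

/-- The underlying left-linear map. -/
abbrev left (f : BiHom R S M N) : M →ₗ[R] N := f.toLinearMap

/-- The underlying right-linear map. -/
def right (f : BiHom R S M N) : M →ₗ[Sᵐᵒᵖ] N where
  toFun := f.left
  map_add' := f.left.map_add
  map_smul' := f.map_op_smul'

@[simp]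
theorem right_apply (f : BiHom R S M N) (m : M) : f.right m = f.left m := rfl

theorem map_op (f : BiHom R S M N) (s : Sᵐᵒᵖ) (m : M) : f.left (s • m) = s • f.left m :=
  f.map_op_smul' s m

end BiHom

section YMod
variable {A M : Type*} [Ring A] [AddCommGroup M] [Module A M] [Module Aᵐᵒᵖ M]

/-- The `(A, A)`-bimodule `M` regarded as an `(A[y], A[y])`-bimodule on which the central
variable `y` acts, on both sides, by the given bimodule endomorphism. -/
def YMod (_ : BiHom A A M M) : Type _ := M

namespace YMod
variable (y : BiHom A A M M)

instance : AddCommGroup (YMod y) := inferInstanceAs (AddCommGroup M)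

/-- The left action of `A[y]`. -/
def leftAction : A[X] →+* AddMonoid.End M :=
  Polynomial.eval₂RingHom' (Module.toAddMonoidEnd A M) y.left.toAddMonoidHom
    (fun a => by ext m; exact (y.left.map_smul a m).symm)

/-- The right action of `A[y]`. -/
def rightAction : (A[X])ᵐᵒᵖ →+* AddMonoid.End M :=
  (Polynomial.eval₂RingHom' (Module.toAddMonoidEnd Aᵐᵒᵖ M) y.left.toAddMonoidHom
    (fun a => by ext m; exact (y.map_op a m).symm)).comp
    (Polynomial.opRingEquiv A).toRingHom

instance : Module A[X] (YMod y) := Module.compHom M (leftAction y)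
instance : Module (A[X])ᵐᵒᵖ (YMod y) := Module.compHom M (rightAction y)

/-- The identity map, from `M` to `M` with its `A[y]`-actions. -/
def of : M ≃+ YMod y := AddEquiv.refl M

theorem C_smul (a : A) (m : M) : (C a : A[X]) • of y m = of y (a • m) :=
  DFunLike.congr_fun (eval₂_C (Module.toAddMonoidEnd A M) y.left.toAddMonoidHom) m

theorem X_smul (m : M) : (X : A[X]) • of y m = of y (y.left m) :=
  DFunLike.congr_fun (eval₂_X (Module.toAddMonoidEnd A M) y.left.toAddMonoidHom) m

theorem op_C_smul (a : A) (m : M) : op (C a : A[X]) • of y m = of y (op a • m) := by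
  change rightAction y (op (C a)) m = op a • m
  simp only [rightAction, RingHom.comp_apply, RingEquiv.toRingHom_eq_coe, RingHom.coe_coe,
    opRingEquiv_op_C]
  exact DFunLike.congr_fun (eval₂_C (Module.toAddMonoidEnd Aᵐᵒᵖ M) y.left.toAddMonoidHom) m

theorem op_X_smul (m : M) : op (X : A[X]) • of y m = of y (y.left m) := by
  change rightAction y (op X) m = y.left m
  simp only [rightAction, RingHom.comp_apply, RingEquiv.toRingHom_eq_coe, RingHom.coe_coe,
    opRingEquiv_op_X]
  exact DFunLike.congr_fun (eval₂_X (Module.toAddMonoidEnd Aᵐᵒᵖ M) y.left.toAddMonoidHom) m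

end YMod

/-- An additive map compatible with `C a` and `X` is `A[X]`-linear. -/
theorem polySMul {M N : Type*} [AddCommGroup M] [AddCommGroup N] [Module A[X] M] [Module A[X] N]
    (f : M →+ N) (hC : ∀ (a : A) m, f ((C a : A[X]) • m) = (C a : A[X]) • f m)
    (hX : ∀ m, f ((X : A[X]) • m) = (X : A[X]) • f m) (p : A[X]) (m : M) :
    f (p • m) = p • f m := by
  induction p using Polynomial.induction_on generalizing m with
  | C a => exact hC a m
  | add p q hp hq => rw [add_smul, map_add, hp, hq, add_smul]
  | monomial n a h =>
    rw [pow_succ, ← mul_assoc, mul_smul, h, hX, ← mul_smul]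

/-- The right-handed version of `polySMul`. -/
theorem polyOpSMul {M N : Type*} [AddCommGroup M] [AddCommGroup N] [Module (A[X])ᵐᵒᵖ M]
    [Module (A[X])ᵐᵒᵖ N]
    (f : M →+ N) (hC : ∀ (a : A) m, f (op (C a : A[X]) • m) = op (C a : A[X]) • f m)
    (hX : ∀ m, f (op (X : A[X]) • m) = op (X : A[X]) • f m) (p : (A[X])ᵐᵒᵖ) (m : M) :
    f (p • m) = p • f m := by
  induction p using MulOpposite.rec' with | _ p
  induction p using Polynomial.induction_on generalizing m with
  | C a => exact hC a m
  | add p q hp hq => rw [MulOpposite.op_add, add_smul, map_add, hp, hq, add_smul]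
  | monomial n a h =>
    rw [pow_succ, ← mul_assoc, op_mul, mul_smul, hX, h, ← mul_smul]

instance YMod.smulCommClass [SMulCommClass A Aᵐᵒᵖ M] (y : BiHom A A M M) :
    SMulCommClass A[X] (A[X])ᵐᵒᵖ (YMod y) where
  smul_comm p q m := by
    symm
    refine polySMul (DistribSMul.toAddMonoidHom (YMod y) q) (fun a m => ?_) (fun m => ?_) p m
    · change q • (C a : A[X]) • m = (C a : A[X]) • q • m
      symm
      refine polyOpSMul (DistribSMul.toAddMonoidHom (YMod y) (C a : A[X])) (fun b m => ?_)
        (fun m => ?_) q m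
      · obtain ⟨m, rfl⟩ := (of y).surjective m
        simp only [DistribSMul.toAddMonoidHom_apply, C_smul, op_C_smul, smul_comm]
      · obtain ⟨m, rfl⟩ := (of y).surjective m
        simp only [DistribSMul.toAddMonoidHom_apply, C_smul, op_X_smul, map_smul]
    · change q • (X : A[X]) • m = (X : A[X]) • q • m
      symm
      refine polyOpSMul (DistribSMul.toAddMonoidHom (YMod y) (X : A[X])) (fun b m => ?_)
        (fun m => ?_) q m
      · obtain ⟨m, rfl⟩ := (of y).surjective m
        simp only [DistribSMul.toAddMonoidHom_apply, X_smul, op_C_smul, BiHom.map_op]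
      · obtain ⟨m, rfl⟩ := (of y).surjective m
        simp only [DistribSMul.toAddMonoidHom_apply, X_smul, op_X_smul]

end YMod

end

noncomputable section

/-- `f ⊗ N` as a left `R`-linear map, for a bimodule map `f`. -/
def BTensor.rTensor {R S M M' : Type*} (N : Type*) [Ring R] [Ring S] [AddCommGroup M]
    [Module R M] [Module Sᵐᵒᵖ M] [SMulCommClass R Sᵐᵒᵖ M] [AddCommGroup M'] [Module R M']
    [Module Sᵐᵒᵖ M'] [SMulCommClass R Sᵐᵒᵖ M'] [AddCommGroup N] [Module S N]
    (f : BiHom R S M M') : BTensor S M N →ₗ[R] BTensor S M' N :=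
  { BTensor.map f.right LinearMap.id with
    map_smul' := fun r t => by
      induction t using BTensor.induction with
      | h0 => simp
      | ht m n =>
        change BTensor.tmul S (f.left (r • m)) n = r • BTensor.tmul S (f.left m) n
        rw [map_smul, BTensor.smul_tmul']
      | ha a b ha hb => simpa using congrArg₂ (· + ·) ha hb }

@[simp]
theorem BTensor.rTensor_tmul {R S M M' N : Type*} [Ring R] [Ring S] [AddCommGroup M]
    [Module R M] [Module Sᵐᵒᵖ M] [SMulCommClass R Sᵐᵒᵖ M] [AddCommGroup M'] [Module R M']
    [Module Sᵐᵒᵖ M'] [SMulCommClass R Sᵐᵒᵖ M'] [AddCommGroup N] [Module S N]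
    (f : BiHom R S M M') (m : M) (n : N) :
    BTensor.rTensor N f (tmul S m n) = tmul S (f.left m) n := rfl

section TwoRep
variable (A E : Type u) [Ring A] [AddCommGroup E] [Module A E] [Module Aᵐᵒᵖ E]
  [SMulCommClass A Aᵐᵒᵖ E]

/-- The data `(E, x, τ)` of a `2`-representation of `𝒰⁺`: bimodule endomorphisms `x` of `E` and `τ`
of `E² = E ⊗_A E` satisfying the nil affine Hecke relations. Here `Ex = id ⊗ x`, `xE = x ⊗ id`. -/
structure TwoRep where
  x : BiHom A A E E
  τ : BiHom A A (BTensor A E E) (BTensor A E E)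
  τ_sq : ∀ t, τ.left (τ.left t) = 0
  /-- `τE ∘ Eτ ∘ τE = Eτ ∘ τE ∘ Eτ` on `E³ = E ⊗ (E ⊗ E)`. -/
  braid : ∀ t : BTensor A E (BTensor A E E),
    let τE := fun t : BTensor A E (BTensor A E E) =>
      BTensor.assocHom (BTensor.rTensor E τ (BTensor.assocInv t))
    let Eτ := fun t : BTensor A E (BTensor A E E) => BTensor.lTensor A E τ.left t
    τE (Eτ (τE t)) = Eτ (τE (Eτ t))
  τ_Ex : ∀ t, τ.left (BTensor.lTensor A E x.left t) = BTensor.rTensor E x (τ.left t) + t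
  Ex_τ : ∀ t, BTensor.lTensor A E x.left (τ.left t) = τ.left (BTensor.rTensor E x t) + t

/-- Multiplication by `y` on the `(A, A)`-bimodule underlying `E[y]`. -/
def shift : BiHom A A (ℕ →₀ E) (ℕ →₀ E) :=
  { Finsupp.lmapDomain E A Nat.succ with
    map_op_smul' := (Finsupp.lmapDomain E Aᵐᵒᵖ Nat.succ).map_smul }

/-- The `(A[y], A[y])`-bimodule `E[y]`. -/
abbrev EPoly : Type u := YMod (shift A E)

variable {A E}

/-- The element `e yⁿ` of `E[y]`. -/
def EPoly.monomial (n : ℕ) : E →+ EPoly A E :=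
  (YMod.of (shift A E)).toAddMonoidHom.comp (Finsupp.singleAddHom n)

theorem EPoly.hom_eq {P : Type*} [AddCommGroup P] (f g : EPoly A E →+ P)
    (h : ∀ n e, f (EPoly.monomial n e) = g (EPoly.monomial n e)) (p : EPoly A E) : f p = g p :=
  DFunLike.congr_fun (Finsupp.addHom_ext (M := E) (N := P) (f := f) (g := g) h) p

theorem EPoly.C_smul (a : A) (n : ℕ) (e : E) :
    (C a : A[X]) • EPoly.monomial n e = EPoly.monomial (A := A) n (a • e) := by
  change (C a : A[X]) • YMod.of (shift A E) (Finsupp.single n e) = _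
  rw [YMod.C_smul, Finsupp.smul_single]; rfl

theorem EPoly.op_C_smul (a : A) (n : ℕ) (e : E) :
    op (C a : A[X]) • EPoly.monomial n e = EPoly.monomial (A := A) n (op a • e) := by
  change op (C a : A[X]) • YMod.of (shift A E) (Finsupp.single n e) = _
  rw [YMod.op_C_smul, Finsupp.smul_single]; rfl

theorem EPoly.X_smul (n : ℕ) (e : E) :
    (X : A[X]) • EPoly.monomial n e = EPoly.monomial (A := A) (n + 1) e := by
  change (X : A[X]) • YMod.of (shift A E) (Finsupp.single n e) = _
  rw [YMod.X_smul]
  exact congrArg (YMod.of (shift A E)) Finsupp.mapDomain_single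

theorem EPoly.op_X_smul (n : ℕ) (e : E) :
    op (X : A[X]) • EPoly.monomial n e = EPoly.monomial (A := A) (n + 1) e := by
  change op (X : A[X]) • YMod.of (shift A E) (Finsupp.single n e) = _
  rw [YMod.op_X_smul]
  exact congrArg (YMod.of (shift A E)) Finsupp.mapDomain_single

namespace TwoRep
variable (V : TwoRep A E)

/-- The `(A[y], A[y])`-bimodule `E_y = E[y] / (x - y)E[y]`: it is `E`, with `y` acting on both
sides by `x`. -/
abbrev Ey : Type u := YMod V.x

/-- The element of `E_y` given by `e ∈ E`. -/
abbrev toEy : E ≃+ V.Ey := YMod.of V.x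

/-- Build a bimodule map between `(A[y], A[y])`-bimodules by checking on `A` and `y`. -/
def mkBiHom {M N : Type*} [AddCommGroup M] [AddCommGroup N] [Module A[X] M] [Module A[X] N]
    [Module (A[X])ᵐᵒᵖ M] [Module (A[X])ᵐᵒᵖ N] (f : M →+ N)
    (hC : ∀ (a : A) m, f ((C a : A[X]) • m) = (C a : A[X]) • f m)
    (hX : ∀ m, f ((X : A[X]) • m) = (X : A[X]) • f m)
    (hC' : ∀ (a : A) m, f (op (C a : A[X]) • m) = op (C a : A[X]) • f m)
    (hX' : ∀ m, f (op (X : A[X]) • m) = op (X : A[X]) • f m) : BiHom A[X] A[X] M N :=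
  { f with
    map_smul' := polySMul f hC hX
    map_op_smul' := polyOpSMul f hC' hX' }

/-- The projection `π : E[y] → E_y`, `e yⁿ ↦ xⁿ(e)`. -/
def piHom : EPoly A E →+ V.Ey :=
  Finsupp.liftAddHom (fun n : ℕ => V.toEy.toAddMonoidHom.comp (V.x.left ^ n).toAddMonoidHom)

theorem piHom_monomial (n : ℕ) (e : E) :
    V.piHom (EPoly.monomial n e) = V.toEy ((V.x.left ^ n) e) :=
  Finsupp.liftAddHom_apply_single _ n e

theorem pow_op (n : ℕ) (a : Aᵐᵒᵖ) (e : E) : (V.x.left ^ n) (a • e) = a • (V.x.left ^ n) e := by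
  induction n with
  | zero => rfl
  | succ n ih => rw [pow_succ', Module.End.mul_apply, Module.End.mul_apply, ih, V.x.map_op]

/-- The projection `π : E[y] → E_y` as a bimodule map. -/
def π : BiHom A[X] A[X] (EPoly A E) V.Ey :=
  mkBiHom V.piHom
    (fun a => EPoly.hom_eq (V.piHom.comp (DistribSMul.toAddMonoidHom _ (C a : A[X])))
      ((DistribSMul.toAddMonoidHom V.Ey (C a : A[X])).comp V.piHom) (fun n e => by
        simp only [AddMonoidHom.comp_apply, DistribSMul.toAddMonoidHom_apply, EPoly.C_smul,
          piHom_monomial, YMod.C_smul, map_smul]))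
    (EPoly.hom_eq (V.piHom.comp (DistribSMul.toAddMonoidHom _ (X : A[X])))
      ((DistribSMul.toAddMonoidHom V.Ey (X : A[X])).comp V.piHom) (fun n e => by
        simp only [AddMonoidHom.comp_apply, DistribSMul.toAddMonoidHom_apply, EPoly.X_smul,
          piHom_monomial, YMod.X_smul, pow_succ', Module.End.mul_apply]))
    (fun a => EPoly.hom_eq (V.piHom.comp (DistribSMul.toAddMonoidHom _ (op (C a : A[X]))))
      ((DistribSMul.toAddMonoidHom V.Ey (op (C a : A[X]))).comp V.piHom) (fun n e => by
        simp only [AddMonoidHom.comp_apply, DistribSMul.toAddMonoidHom_apply, EPoly.op_C_smul,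
          piHom_monomial, YMod.op_C_smul, pow_op]))
    (EPoly.hom_eq (V.piHom.comp (DistribSMul.toAddMonoidHom _ (op (X : A[X]))))
      ((DistribSMul.toAddMonoidHom V.Ey (op (X : A[X]))).comp V.piHom) (fun n e => by
        simp only [AddMonoidHom.comp_apply, DistribSMul.toAddMonoidHom_apply, EPoly.op_X_smul,
          piHom_monomial, YMod.op_X_smul, pow_succ', Module.End.mul_apply]))

/-- `Ex` on `E²`. -/
abbrev Ex : BTensor A E E →ₗ[A] BTensor A E E := BTensor.lTensor A E V.x.left

/-- `xE` on `E²`. -/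
abbrev xE : BTensor A E E →ₗ[A] BTensor A E E := BTensor.rTensor E V.x

/-- `s = τ ∘ (Ex - xE) - 1` on `E²`. -/
def s : BTensor A E E →ₗ[A] BTensor A E E := V.τ.left ∘ₗ (V.Ex - V.xE) - LinearMap.id

theorem s_apply (t : BTensor A E E) : V.s t = V.τ.left (V.Ex t - V.xE t) - t := rfl

theorem Ex_xE (t : BTensor A E E) : V.Ex (V.xE t) = V.xE (V.Ex t) :=
  BTensor.hom_eq (V.Ex.toAddMonoidHom.comp V.xE.toAddMonoidHom)
    (V.xE.toAddMonoidHom.comp V.Ex.toAddMonoidHom) (fun _ _ => rfl) t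

theorem s_xE (t : BTensor A E E) : V.s (V.xE t) = V.Ex (V.s t) := by
  have h1 := V.Ex_τ (V.Ex t)
  have h2 := V.Ex_τ (V.xE t)
  simp only [s_apply, map_sub, Ex_xE]
  rw [h1, h2]
  abel

theorem Ex_op (a : Aᵐᵒᵖ) (t : BTensor A E E) : V.Ex (a • t) = a • V.Ex t :=
  BTensor.hom_eq (V.Ex.toAddMonoidHom.comp (DistribSMul.toAddMonoidHom _ a))
    ((DistribSMul.toAddMonoidHom _ a).comp V.Ex.toAddMonoidHom) (fun m n => by
      change BTensor.tmul A m (V.x.left (a • n)) = a • BTensor.tmul A m (V.x.left n)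
      rw [V.x.map_op, BTensor.smul_tmul_right]) t

theorem xE_op (a : Aᵐᵒᵖ) (t : BTensor A E E) : V.xE (a • t) = a • V.xE t :=
  BTensor.hom_eq (V.xE.toAddMonoidHom.comp (DistribSMul.toAddMonoidHom _ a))
    ((DistribSMul.toAddMonoidHom _ a).comp V.xE.toAddMonoidHom) (fun _ _ => rfl) t

theorem s_op (a : Aᵐᵒᵖ) (t : BTensor A E E) : V.s (a • t) = a • V.s t := by
  simp only [s_apply, Ex_op, xE_op, ← smul_sub, V.τ.map_op]

/-- The canonical map `E ⊗_A E → E[y] ⊗_{A[y]} E_y`, `e ⊗ e' ↦ e ⊗ e'`. -/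
def ι : BTensor A E E →+ BTensor A[X] (EPoly A E) V.Ey :=
  BTensor.lift (((AddMonoidHom.compHom (P := BTensor A[X] (EPoly A E) V.Ey)).flip
      V.toEy.toAddMonoidHom).comp
    ((BTensor.tmulHom A[X] (EPoly A E) V.Ey).comp (EPoly.monomial 0)))
    (fun a m n => by
      change BTensor.tmul A[X] (EPoly.monomial 0 (op a • m)) (V.toEy n) =
        BTensor.tmul A[X] (EPoly.monomial 0 m) (V.toEy (a • n))
      rw [← EPoly.op_C_smul, BTensor.op_smul_tmul, YMod.C_smul])

theorem ι_tmul (m n : E) : V.ι (BTensor.tmul A m n) =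
    BTensor.tmul A[X] (EPoly.monomial 0 m) (V.toEy n) := rfl

theorem ι_C (a : A) (t : BTensor A E E) : V.ι (a • t) = (C a : A[X]) • V.ι t :=
  BTensor.hom_eq (V.ι.comp (DistribSMul.toAddMonoidHom _ a))
    ((DistribSMul.toAddMonoidHom _ (C a : A[X])).comp V.ι) (fun m n => by
      simp only [AddMonoidHom.comp_apply, DistribSMul.toAddMonoidHom_apply, BTensor.smul_tmul',
        ι_tmul, EPoly.C_smul]) t

theorem ι_op_C (a : A) (t : BTensor A E E) : V.ι (op a • t) = op (C a : A[X]) • V.ι t :=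
  BTensor.hom_eq (V.ι.comp (DistribSMul.toAddMonoidHom _ (op a)))
    ((DistribSMul.toAddMonoidHom _ (op (C a : A[X]))).comp V.ι) (fun m n => by
      simp only [AddMonoidHom.comp_apply, DistribSMul.toAddMonoidHom_apply,
        BTensor.smul_tmul_right, ι_tmul, YMod.op_C_smul]) t

theorem ι_X (t : BTensor A E E) : V.ι (V.Ex t) = (X : A[X]) • V.ι t :=
  BTensor.hom_eq (V.ι.comp V.Ex.toAddMonoidHom)
    ((DistribSMul.toAddMonoidHom _ (X : A[X])).comp V.ι) (fun m n => by
      change BTensor.tmul A[X] (EPoly.monomial 0 m) (V.toEy (V.x.left n)) =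
        BTensor.tmul A[X] ((X : A[X]) • EPoly.monomial 0 m) (V.toEy n)
      rw [EPoly.X_smul, ← EPoly.op_X_smul, BTensor.op_smul_tmul, YMod.X_smul]) t

theorem ι_op_X (t : BTensor A E E) : V.ι (V.Ex t) = op (X : A[X]) • V.ι t :=
  BTensor.hom_eq (V.ι.comp V.Ex.toAddMonoidHom)
    ((DistribSMul.toAddMonoidHom _ (op (X : A[X]))).comp V.ι) (fun m n => by
      change BTensor.tmul A[X] (EPoly.monomial 0 m) (V.toEy (V.x.left n)) =
        BTensor.tmul A[X] (EPoly.monomial 0 m) (op (X : A[X]) • V.toEy n)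
      rw [YMod.op_X_smul]) t

/-- The biadditive map `E_y × E[y] → E[y] ⊗ E_y`, `(e, e' yⁿ) ↦ s(xⁿ(e) ⊗ e')`. -/
def sPair : V.Ey →+ EPoly A E →+ BTensor A[X] (EPoly A E) V.Ey :=
  AddMonoidHom.mk' (fun e => Finsupp.liftAddHom (fun n : ℕ =>
      V.ι.comp (V.s.toAddMonoidHom.comp
        (BTensor.tmulHom A E E ((V.x.left ^ n) (V.toEy.symm e))))))
    (fun e e' => by
      refine (congrArg Finsupp.liftAddHom (funext fun n => ?_)).trans
        (map_add (Finsupp.liftAddHom (M := E) (N := BTensor A[X] (EPoly A E) V.Ey)) _ _)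
      simp only [Pi.add_apply, map_add, AddMonoidHom.comp_add])

theorem sPair_apply (e : E) (n : ℕ) (e' : E) :
    V.sPair (V.toEy e) (EPoly.monomial n e') =
      V.ι (V.s (BTensor.tmul A ((V.x.left ^ n) e) e')) :=
  Finsupp.liftAddHom_apply_single _ n e'

theorem sPair_C_left (a : A) (e : V.Ey) (p : EPoly A E) :
    V.sPair ((C a : A[X]) • e) p = (C a : A[X]) • V.sPair e p := by
  obtain ⟨e, rfl⟩ := V.toEy.surjective e
  refine EPoly.hom_eq (V.sPair ((C a : A[X]) • V.toEy e))
    ((DistribSMul.toAddMonoidHom _ (C a : A[X])).comp (V.sPair (V.toEy e))) (fun n f => ?_) p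
  simp only [AddMonoidHom.comp_apply, DistribSMul.toAddMonoidHom_apply, YMod.C_smul, sPair_apply,
    map_smul, ← ι_C, ← BTensor.smul_tmul']

theorem sPair_X_left (e : V.Ey) (p : EPoly A E) :
    V.sPair ((X : A[X]) • e) p = (X : A[X]) • V.sPair e p := by
  obtain ⟨e, rfl⟩ := V.toEy.surjective e
  refine EPoly.hom_eq (V.sPair ((X : A[X]) • V.toEy e))
    ((DistribSMul.toAddMonoidHom _ (X : A[X])).comp (V.sPair (V.toEy e))) (fun n f => ?_) p
  simp only [AddMonoidHom.comp_apply, DistribSMul.toAddMonoidHom_apply, YMod.X_smul, sPair_apply,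
    ← ι_X, ← s_xE, BTensor.rTensor_tmul]
  rw [← Module.End.mul_apply, ← Module.End.mul_apply, ← pow_succ, ← pow_succ']

theorem sPair_balanced (q : A[X]) (e : V.Ey) (p : EPoly A E) :
    V.sPair (op q • e) p = V.sPair e (q • p) := by
  induction q using Polynomial.induction_on generalizing e p with
  | C a =>
    obtain ⟨e, rfl⟩ := V.toEy.surjective e
    refine EPoly.hom_eq (V.sPair (op (C a : A[X]) • V.toEy e))
      ((V.sPair (V.toEy e)).comp (DistribSMul.toAddMonoidHom _ (C a : A[X]))) (fun n f => ?_) p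
    simp only [AddMonoidHom.comp_apply, DistribSMul.toAddMonoidHom_apply, YMod.op_C_smul,
      sPair_apply, EPoly.C_smul, pow_op, BTensor.op_smul_tmul]
  | add p q hp hq =>
    rw [MulOpposite.op_add, add_smul, add_smul, map_add, map_add, AddMonoidHom.add_apply, hp, hq]
  | monomial n a h =>
    have hX : ∀ (e : V.Ey) (p : EPoly A E),
        V.sPair (op (X : A[X]) • e) p = V.sPair e ((X : A[X]) • p) := by
      intro e p
      obtain ⟨e, rfl⟩ := V.toEy.surjective e
      refine EPoly.hom_eq (V.sPair (op (X : A[X]) • V.toEy e))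
        ((V.sPair (V.toEy e)).comp (DistribSMul.toAddMonoidHom _ (X : A[X]))) (fun n f => ?_) p
      simp only [AddMonoidHom.comp_apply, DistribSMul.toAddMonoidHom_apply, YMod.op_X_smul,
        sPair_apply, EPoly.X_smul, pow_succ, Module.End.mul_apply]
    rw [pow_succ, ← mul_assoc, op_mul, mul_smul, mul_smul, hX, h]

theorem sPair_op_C (a : A) (e : V.Ey) (p : EPoly A E) :
    V.sPair e (op (C a : A[X]) • p) = op (C a : A[X]) • V.sPair e p := by
  obtain ⟨e, rfl⟩ := V.toEy.surjective e
  refine EPoly.hom_eq ((V.sPair (V.toEy e)).comp (DistribSMul.toAddMonoidHom _ (op (C a : A[X]))))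
    ((DistribSMul.toAddMonoidHom _ (op (C a : A[X]))).comp (V.sPair (V.toEy e)))
    (fun n f => ?_) p
  simp only [AddMonoidHom.comp_apply, DistribSMul.toAddMonoidHom_apply, EPoly.op_C_smul,
    sPair_apply, ← ι_op_C, ← s_op, BTensor.smul_tmul_right]

theorem sPair_op_X (e : V.Ey) (p : EPoly A E) :
    V.sPair e (op (X : A[X]) • p) = op (X : A[X]) • V.sPair e p := by
  obtain ⟨e, rfl⟩ := V.toEy.surjective e
  refine EPoly.hom_eq ((V.sPair (V.toEy e)).comp (DistribSMul.toAddMonoidHom _ (op (X : A[X]))))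
    ((DistribSMul.toAddMonoidHom _ (op (X : A[X]))).comp (V.sPair (V.toEy e)))
    (fun n f => ?_) p
  simp only [AddMonoidHom.comp_apply, DistribSMul.toAddMonoidHom_apply, EPoly.op_X_smul,
    sPair_apply, ← ι_op_X, ← s_xE, BTensor.rTensor_tmul]
  rw [← Module.End.mul_apply, ← pow_succ']

/-- The map `s : E_y ⊗ E[y] → E[y] ⊗ E_y` induced by `s`. -/
def sY : BTensor A[X] V.Ey (EPoly A E) →+ BTensor A[X] (EPoly A E) V.Ey :=
  BTensor.lift V.sPair V.sPair_balanced

theorem sY_smul (a : A[X]) (t : BTensor A[X] V.Ey (EPoly A E)) : V.sY (a • t) = a • V.sY t := by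
  refine polySMul V.sY (fun a t => ?_) (fun t => ?_) a t
  · exact BTensor.hom_eq (V.sY.comp (DistribSMul.toAddMonoidHom _ (C a : A[X])))
      ((DistribSMul.toAddMonoidHom _ (C a : A[X])).comp V.sY) (fun e p => V.sPair_C_left a e p) t
  · exact BTensor.hom_eq (V.sY.comp (DistribSMul.toAddMonoidHom _ (X : A[X])))
      ((DistribSMul.toAddMonoidHom _ (X : A[X])).comp V.sY) (fun e p => V.sPair_X_left e p) t

theorem sY_op_smul (a : (A[X])ᵐᵒᵖ) (t : BTensor A[X] V.Ey (EPoly A E)) :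
    V.sY (a • t) = a • V.sY t := by
  refine polyOpSMul V.sY (fun a t => ?_) (fun t => ?_) a t
  · exact BTensor.hom_eq (V.sY.comp (DistribSMul.toAddMonoidHom _ (op (C a : A[X]))))
      ((DistribSMul.toAddMonoidHom _ (op (C a : A[X]))).comp V.sY)
      (fun e p => V.sPair_op_C a e p) t
  · exact BTensor.hom_eq (V.sY.comp (DistribSMul.toAddMonoidHom _ (op (X : A[X]))))
      ((DistribSMul.toAddMonoidHom _ (op (X : A[X]))).comp V.sY) (fun e p => V.sPair_op_X e p) t

end TwoRep
end TwoRep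

end

noncomputable section

namespace TwoRep
open BTensor (tmul add_tmul tmul_add zero_tmul tmul_zero op_smul_tmul smul_tmul' smul_tmul_right)
variable {A E : Type u} [Ring A] [AddCommGroup E] [Module A E] [Module Aᵐᵒᵖ E]
  [SMulCommClass A Aᵐᵒᵖ E] (V : TwoRep A E)

/-- The algebra `B` of matrices `(a, e; 0, d)` with `a, d ∈ A[y]` and `e ∈ E_y`; such a matrix is
the triple `(a, e, d)`. -/
def B : Type u := A[X] × V.Ey × A[X]

instance : AddCommGroup V.B := inferInstanceAs (AddCommGroup (A[X] × V.Ey × A[X]))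

instance : Mul V.B :=
  ⟨fun b c => (b.1 * c.1, b.1 • c.2.1 + op c.2.2 • b.2.1, b.2.2 * c.2.2)⟩

instance : One V.B := ⟨(1, 0, 1)⟩

theorem B_mul_def (b c : V.B) :
    b * c = (b.1 * c.1, b.1 • c.2.1 + op c.2.2 • b.2.1, b.2.2 * c.2.2) := rfl

theorem B_one_def : (1 : V.B) = (1, 0, 1) := rfl

theorem B_ext {b c : V.B} (h1 : b.1 = c.1) (h2 : b.2.1 = c.2.1) (h3 : b.2.2 = c.2.2) : b = c :=
  Prod.ext h1 (Prod.ext h2 h3)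

instance : Ring V.B where
  __ := (inferInstance : AddCommGroup V.B)
  mul_assoc b c d := by
    apply B_ext
    · exact mul_assoc _ _ _
    · change (b.1 * c.1) • d.2.1 + op d.2.2 • (b.1 • c.2.1 + op c.2.2 • b.2.1) =
        b.1 • (c.1 • d.2.1 + op d.2.2 • c.2.1) + op (c.2.2 * d.2.2) • b.2.1
      rw [smul_add, smul_add, op_mul, mul_smul, mul_smul, add_assoc, smul_comm b.1 (op d.2.2)]
    · exact mul_assoc _ _ _
  one_mul b := by
    apply B_ext
    · exact one_mul _
    · change (1 : A[X]) • b.2.1 + op b.2.2 • (0 : V.Ey) = b.2.1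
      rw [one_smul, smul_zero, add_zero]
    · exact one_mul _
  mul_one b := by
    apply B_ext
    · exact mul_one _
    · change b.1 • (0 : V.Ey) + op (1 : A[X]) • b.2.1 = b.2.1
      rw [op_one, one_smul, smul_zero, zero_add]
    · exact mul_one _
  left_distrib b c d := by
    apply B_ext
    · exact mul_add _ _ _
    · change b.1 • (c.2.1 + d.2.1) + op (c.2.2 + d.2.2) • b.2.1 =
        (b.1 • c.2.1 + op c.2.2 • b.2.1) + (b.1 • d.2.1 + op d.2.2 • b.2.1)
      rw [smul_add, MulOpposite.op_add, add_smul]; abel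
    · exact mul_add _ _ _
  right_distrib b c d := by
    apply B_ext
    · exact add_mul _ _ _
    · change (b.1 + c.1) • d.2.1 + op d.2.2 • (b.2.1 + c.2.1) =
        (b.1 • d.2.1 + op d.2.2 • b.2.1) + (c.1 • d.2.1 + op d.2.2 • c.2.1)
      rw [smul_add, add_smul]; abel
    · exact add_mul _ _ _
  zero_mul b := by
    apply B_ext
    · exact zero_mul _
    · change (0 : A[X]) • b.2.1 + op b.2.2 • (0 : V.Ey) = 0
      rw [zero_smul, smul_zero, add_zero]
    · exact zero_mul _
  mul_zero b := by
    apply B_ext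
    · exact mul_zero _
    · change b.1 • (0 : V.Ey) + op (0 : A[X]) • b.2.1 = 0
      rw [op_zero, zero_smul, smul_zero, add_zero]
    · exact mul_zero _

/-- `E[y] ⊗_{A[y]} E_y`. -/
abbrev EEy : Type u := BTensor A[X] (EPoly A E) V.Ey

/-- `E_y ⊗_{A[y]} E_y`. -/
abbrev EyEy : Type u := BTensor A[X] V.Ey V.Ey

/-- The degree `0` part `(E[y], E[y]E_y; 0, E[y])` of `E'`; such a matrix `(p, t; 0, q)` is the
triple `(p, t, q)`. -/
def E0 : Type u := EPoly A E × V.EEy × EPoly A E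

instance : AddCommGroup V.E0 := inferInstanceAs (AddCommGroup (EPoly A E × V.EEy × EPoly A E))

theorem E0_ext {m n : V.E0} (h1 : m.1 = n.1) (h2 : m.2.1 = n.2.1) (h3 : m.2.2 = n.2.2) : m = n :=
  Prod.ext h1 (Prod.ext h2 h3)

/-- The left action of `B` on `E'⁰`: `E_y ⊂ B` acts through `s : E_y ⊗ E[y] → E[y] ⊗ E_y`. -/
instance : Module V.B V.E0 where
  smul b m := (b.1 • m.1, b.1 • m.2.1 + V.sY (tmul A[X] b.2.1 m.2.2), b.2.2 • m.2.2)
  one_smul m := by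
    apply E0_ext
    · exact one_smul _ _
    · change (1 : A[X]) • m.2.1 + V.sY (tmul A[X] (0 : V.Ey) m.2.2) = m.2.1
      rw [one_smul, zero_tmul, map_zero, add_zero]
    · exact one_smul _ _
  mul_smul b c m := by
    apply E0_ext
    · exact mul_smul _ _ _
    · change (b.1 * c.1) • m.2.1 +
          V.sY (tmul A[X] (b.1 • c.2.1 + op c.2.2 • b.2.1) m.2.2) =
        b.1 • (c.1 • m.2.1 + V.sY (tmul A[X] c.2.1 m.2.2)) +
          V.sY (tmul A[X] b.2.1 (c.2.2 • m.2.2))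
      rw [mul_smul, smul_add, add_tmul, map_add, op_smul_tmul, ← smul_tmul', sY_smul, add_assoc]
    · exact mul_smul _ _ _
  smul_zero b := by
    apply E0_ext
    · exact smul_zero _
    · change b.1 • (0 : V.EEy) + V.sY (tmul A[X] b.2.1 (0 : EPoly A E)) = 0
      rw [smul_zero, tmul_zero, map_zero, add_zero]
    · exact smul_zero _
  smul_add b m n := by
    apply E0_ext
    · exact smul_add _ _ _
    · change b.1 • (m.2.1 + n.2.1) + V.sY (tmul A[X] b.2.1 (m.2.2 + n.2.2)) =
        (b.1 • m.2.1 + V.sY (tmul A[X] b.2.1 m.2.2)) +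
          (b.1 • n.2.1 + V.sY (tmul A[X] b.2.1 n.2.2))
      rw [smul_add, tmul_add, map_add]; abel
    · exact smul_add _ _ _
  add_smul b c m := by
    apply E0_ext
    · exact add_smul _ _ _
    · change (b.1 + c.1) • m.2.1 + V.sY (tmul A[X] (b.2.1 + c.2.1) m.2.2) =
        (b.1 • m.2.1 + V.sY (tmul A[X] b.2.1 m.2.2)) +
          (c.1 • m.2.1 + V.sY (tmul A[X] c.2.1 m.2.2))
      rw [add_smul, add_tmul, map_add]; abel
    · exact add_smul _ _ _
  zero_smul m := by
    apply E0_ext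
    · exact zero_smul _ _
    · change (0 : A[X]) • m.2.1 + V.sY (tmul A[X] (0 : V.Ey) m.2.2) = 0
      rw [zero_smul, zero_tmul, map_zero, add_zero]
    · exact zero_smul _ _

theorem E0_smul_def (b : V.B) (m : V.E0) :
    b • m = (b.1 • m.1, b.1 • m.2.1 + V.sY (tmul A[X] b.2.1 m.2.2), b.2.2 • m.2.2) := rfl

/-- The right action of `B` on `E'⁰`. -/
instance : Module (V.B)ᵐᵒᵖ V.E0 where
  smul b m := (op b.unop.1 • m.1, tmul A[X] m.1 b.unop.2.1 + op b.unop.2.2 • m.2.1,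
    op b.unop.2.2 • m.2.2)
  one_smul m := by
    apply E0_ext
    · exact one_smul (A[X])ᵐᵒᵖ _
    · change tmul A[X] m.1 (0 : V.Ey) + op (1 : A[X]) • m.2.1 = m.2.1
      rw [op_one, one_smul, tmul_zero, zero_add]
    · exact one_smul (A[X])ᵐᵒᵖ _
  mul_smul b c m := by
    obtain ⟨b⟩ := b
    obtain ⟨c⟩ := c
    apply E0_ext
    · exact mul_smul (op b.1) (op c.1) m.1
    · change tmul A[X] m.1 (c.1 • b.2.1 + op b.2.2 • c.2.1) + op (c.2.2 * b.2.2) • m.2.1 =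
        tmul A[X] (op c.1 • m.1) b.2.1 +
          op b.2.2 • (tmul A[X] m.1 c.2.1 + op c.2.2 • m.2.1)
      rw [tmul_add, op_smul_tmul, smul_add, op_mul, mul_smul, smul_tmul_right, add_assoc]
    · exact mul_smul (op b.2.2) (op c.2.2) m.2.2
  smul_zero b := by
    apply E0_ext
    · exact smul_zero _
    · change tmul A[X] (0 : EPoly A E) b.unop.2.1 + op b.unop.2.2 • (0 : V.EEy) = 0
      rw [smul_zero, zero_tmul, add_zero]
    · exact smul_zero _
  smul_add b m n := by
    apply E0_ext
    · exact smul_add _ _ _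
    · change tmul A[X] (m.1 + n.1) b.unop.2.1 + op b.unop.2.2 • (m.2.1 + n.2.1) =
        (tmul A[X] m.1 b.unop.2.1 + op b.unop.2.2 • m.2.1) +
          (tmul A[X] n.1 b.unop.2.1 + op b.unop.2.2 • n.2.1)
      rw [smul_add, add_tmul]; abel
    · exact smul_add _ _ _
  add_smul b c m := by
    apply E0_ext
    · exact add_smul (op b.unop.1) (op c.unop.1) m.1
    · change tmul A[X] m.1 (b.unop.2.1 + c.unop.2.1) + op (b.unop.2.2 + c.unop.2.2) • m.2.1 =
        (tmul A[X] m.1 b.unop.2.1 + op b.unop.2.2 • m.2.1) +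
          (tmul A[X] m.1 c.unop.2.1 + op c.unop.2.2 • m.2.1)
      rw [MulOpposite.op_add, add_smul, tmul_add]; abel
    · exact add_smul (op b.unop.2.2) (op c.unop.2.2) m.2.2
  zero_smul m := by
    apply E0_ext
    · exact zero_smul (A[X])ᵐᵒᵖ _
    · change tmul A[X] m.1 (0 : V.Ey) + op (0 : A[X]) • m.2.1 = 0
      rw [op_zero, zero_smul, tmul_zero, add_zero]
    · exact zero_smul (A[X])ᵐᵒᵖ _

instance : SMulCommClass V.B (V.B)ᵐᵒᵖ V.E0 where
  smul_comm b c m := by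
    obtain ⟨c⟩ := c
    apply E0_ext
    · exact smul_comm b.1 (op c.1) m.1
    · change b.1 • (tmul A[X] m.1 c.2.1 + op c.2.2 • m.2.1) +
          V.sY (tmul A[X] b.2.1 (op c.2.2 • m.2.2)) =
        tmul A[X] (b.1 • m.1) c.2.1 +
          op c.2.2 • (b.1 • m.2.1 + V.sY (tmul A[X] b.2.1 m.2.2))
      rw [smul_add, smul_add, smul_tmul', ← smul_tmul_right, sY_op_smul,
        smul_comm b.1 (op c.2.2), add_assoc]
    · exact smul_comm b.2.2 (op c.2.2) m.2.2

/-- The degree `1` part `(E_y, E_yE_y; A[y], E_y)` of `E'`; such a matrix `(p, t; a, q)` is the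
tuple `(p, t, a, q)`. -/
def E1 : Type u := V.Ey × V.EyEy × A[X] × V.Ey

instance : AddCommGroup V.E1 := inferInstanceAs (AddCommGroup (V.Ey × V.EyEy × A[X] × V.Ey))

theorem E1_ext {m n : V.E1} (h1 : m.1 = n.1) (h2 : m.2.1 = n.2.1) (h3 : m.2.2.1 = n.2.2.1)
    (h4 : m.2.2.2 = n.2.2.2) : m = n :=
  Prod.ext h1 (Prod.ext h2 (Prod.ext h3 h4))

/-- The left action of `B` on `E'¹`, by matrix multiplication. -/
instance : Module V.B V.E1 where
  smul b m := (b.1 • m.1 + op m.2.2.1 • b.2.1, b.1 • m.2.1 + tmul A[X] b.2.1 m.2.2.2,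
    b.2.2 * m.2.2.1, b.2.2 • m.2.2.2)
  one_smul m := by
    apply E1_ext
    · change (1 : A[X]) • m.1 + op m.2.2.1 • (0 : V.Ey) = m.1
      rw [one_smul, smul_zero, add_zero]
    · change (1 : A[X]) • m.2.1 + tmul A[X] (0 : V.Ey) m.2.2.2 = m.2.1
      rw [one_smul, zero_tmul, add_zero]
    · exact one_mul _
    · exact one_smul _ _
  mul_smul b c m := by
    apply E1_ext
    · change (b.1 * c.1) • m.1 + op m.2.2.1 • (b.1 • c.2.1 + op c.2.2 • b.2.1) =
        b.1 • (c.1 • m.1 + op m.2.2.1 • c.2.1) + op (c.2.2 * m.2.2.1) • b.2.1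
      rw [smul_add, smul_add, op_mul, mul_smul, mul_smul, add_assoc, smul_comm b.1 (op m.2.2.1)]
    · change (b.1 * c.1) • m.2.1 + tmul A[X] (b.1 • c.2.1 + op c.2.2 • b.2.1) m.2.2.2 =
        b.1 • (c.1 • m.2.1 + tmul A[X] c.2.1 m.2.2.2) + tmul A[X] b.2.1 (c.2.2 • m.2.2.2)
      rw [mul_smul, smul_add, add_tmul, op_smul_tmul, smul_tmul', add_assoc]
    · exact mul_assoc _ _ _
    · exact mul_smul _ _ _
  smul_zero b := by
    apply E1_ext
    · change b.1 • (0 : V.Ey) + op (0 : A[X]) • b.2.1 = 0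
      rw [smul_zero, op_zero, zero_smul, add_zero]
    · change b.1 • (0 : V.EyEy) + tmul A[X] b.2.1 (0 : V.Ey) = 0
      rw [smul_zero, tmul_zero, add_zero]
    · exact mul_zero _
    · exact smul_zero _
  smul_add b m n := by
    apply E1_ext
    · change b.1 • (m.1 + n.1) + op (m.2.2.1 + n.2.2.1) • b.2.1 =
        (b.1 • m.1 + op m.2.2.1 • b.2.1) + (b.1 • n.1 + op n.2.2.1 • b.2.1)
      rw [smul_add, MulOpposite.op_add, add_smul]; abel
    · change b.1 • (m.2.1 + n.2.1) + tmul A[X] b.2.1 (m.2.2.2 + n.2.2.2) =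
        (b.1 • m.2.1 + tmul A[X] b.2.1 m.2.2.2) + (b.1 • n.2.1 + tmul A[X] b.2.1 n.2.2.2)
      rw [smul_add, tmul_add]; abel
    · exact mul_add _ _ _
    · exact smul_add _ _ _
  add_smul b c m := by
    apply E1_ext
    · change (b.1 + c.1) • m.1 + op m.2.2.1 • (b.2.1 + c.2.1) =
        (b.1 • m.1 + op m.2.2.1 • b.2.1) + (c.1 • m.1 + op m.2.2.1 • c.2.1)
      rw [smul_add, add_smul]; abel
    · change (b.1 + c.1) • m.2.1 + tmul A[X] (b.2.1 + c.2.1) m.2.2.2 =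
        (b.1 • m.2.1 + tmul A[X] b.2.1 m.2.2.2) + (c.1 • m.2.1 + tmul A[X] c.2.1 m.2.2.2)
      rw [add_smul, add_tmul]; abel
    · exact add_mul _ _ _
    · exact add_smul _ _ _
  zero_smul m := by
    apply E1_ext
    · change (0 : A[X]) • m.1 + op m.2.2.1 • (0 : V.Ey) = 0
      rw [smul_zero, zero_smul, add_zero]
    · change (0 : A[X]) • m.2.1 + tmul A[X] (0 : V.Ey) m.2.2.2 = 0
      rw [zero_smul, zero_tmul, add_zero]
    · exact zero_mul _
    · exact zero_smul _ _

/-- The right action of `B` on `E'¹`, by matrix multiplication. -/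
instance : Module (V.B)ᵐᵒᵖ V.E1 where
  smul b m := (op b.unop.1 • m.1, tmul A[X] m.1 b.unop.2.1 + op b.unop.2.2 • m.2.1,
    m.2.2.1 * b.unop.1, m.2.2.1 • b.unop.2.1 + op b.unop.2.2 • m.2.2.2)
  one_smul m := by
    apply E1_ext
    · exact one_smul (A[X])ᵐᵒᵖ _
    · change tmul A[X] m.1 (0 : V.Ey) + op (1 : A[X]) • m.2.1 = m.2.1
      rw [op_one, one_smul, tmul_zero, zero_add]
    · exact mul_one _
    · change m.2.2.1 • (0 : V.Ey) + op (1 : A[X]) • m.2.2.2 = m.2.2.2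
      rw [op_one, one_smul, smul_zero, zero_add]
  mul_smul b c m := by
    obtain ⟨b⟩ := b
    obtain ⟨c⟩ := c
    apply E1_ext
    · exact mul_smul (op b.1) (op c.1) m.1
    · change tmul A[X] m.1 (c.1 • b.2.1 + op b.2.2 • c.2.1) + op (c.2.2 * b.2.2) • m.2.1 =
        tmul A[X] (op c.1 • m.1) b.2.1 +
          op b.2.2 • (tmul A[X] m.1 c.2.1 + op c.2.2 • m.2.1)
      rw [tmul_add, op_smul_tmul, smul_add, op_mul, mul_smul, smul_tmul_right, add_assoc]
    · exact (mul_assoc m.2.2.1 c.1 b.1).symm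
    · change m.2.2.1 • (c.1 • b.2.1 + op b.2.2 • c.2.1) + op (c.2.2 * b.2.2) • m.2.2.2 =
        (m.2.2.1 * c.1) • b.2.1 + op b.2.2 • (m.2.2.1 • c.2.1 + op c.2.2 • m.2.2.2)
      rw [smul_add, smul_add, op_mul, mul_smul, mul_smul, add_assoc, smul_comm m.2.2.1 (op b.2.2)]
  smul_zero b := by
    apply E1_ext
    · exact smul_zero _
    · change tmul A[X] (0 : V.Ey) b.unop.2.1 + op b.unop.2.2 • (0 : V.EyEy) = 0
      rw [smul_zero, zero_tmul, add_zero]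
    · exact zero_mul _
    · change (0 : A[X]) • b.unop.2.1 + op b.unop.2.2 • (0 : V.Ey) = 0
      rw [smul_zero, zero_smul, add_zero]
  smul_add b m n := by
    apply E1_ext
    · exact smul_add _ _ _
    · change tmul A[X] (m.1 + n.1) b.unop.2.1 + op b.unop.2.2 • (m.2.1 + n.2.1) =
        (tmul A[X] m.1 b.unop.2.1 + op b.unop.2.2 • m.2.1) +
          (tmul A[X] n.1 b.unop.2.1 + op b.unop.2.2 • n.2.1)
      rw [smul_add, add_tmul]; abel
    · exact add_mul _ _ _
    · change (m.2.2.1 + n.2.2.1) • b.unop.2.1 + op b.unop.2.2 • (m.2.2.2 + n.2.2.2) =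
        (m.2.2.1 • b.unop.2.1 + op b.unop.2.2 • m.2.2.2) +
          (n.2.2.1 • b.unop.2.1 + op b.unop.2.2 • n.2.2.2)
      rw [smul_add, add_smul]; abel
  add_smul b c m := by
    apply E1_ext
    · exact add_smul (op b.unop.1) (op c.unop.1) m.1
    · change tmul A[X] m.1 (b.unop.2.1 + c.unop.2.1) + op (b.unop.2.2 + c.unop.2.2) • m.2.1 =
        (tmul A[X] m.1 b.unop.2.1 + op b.unop.2.2 • m.2.1) +
          (tmul A[X] m.1 c.unop.2.1 + op c.unop.2.2 • m.2.1)
      rw [MulOpposite.op_add, add_smul, tmul_add]; abel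
    · exact mul_add _ _ _
    · change m.2.2.1 • (b.unop.2.1 + c.unop.2.1) + op (b.unop.2.2 + c.unop.2.2) • m.2.2.2 =
        (m.2.2.1 • b.unop.2.1 + op b.unop.2.2 • m.2.2.2) +
          (m.2.2.1 • c.unop.2.1 + op c.unop.2.2 • m.2.2.2)
      rw [MulOpposite.op_add, add_smul, smul_add]; abel
  zero_smul m := by
    apply E1_ext
    · exact zero_smul (A[X])ᵐᵒᵖ _
    · change tmul A[X] m.1 (0 : V.Ey) + op (0 : A[X]) • m.2.1 = 0
      rw [op_zero, zero_smul, tmul_zero, add_zero]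
    · exact mul_zero _
    · change m.2.2.1 • (0 : V.Ey) + op (0 : A[X]) • m.2.2.2 = 0
      rw [op_zero, zero_smul, smul_zero, add_zero]

instance : SMulCommClass V.B (V.B)ᵐᵒᵖ V.E1 where
  smul_comm b c m := by
    obtain ⟨c⟩ := c
    apply E1_ext
    · change b.1 • op c.1 • m.1 + op (m.2.2.1 * c.1) • b.2.1 =
        op c.1 • (b.1 • m.1 + op m.2.2.1 • b.2.1)
      rw [smul_add, op_mul, mul_smul, smul_comm b.1 (op c.1)]
    · change b.1 • (tmul A[X] m.1 c.2.1 + op c.2.2 • m.2.1) +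
          tmul A[X] b.2.1 (m.2.2.1 • c.2.1 + op c.2.2 • m.2.2.2) =
        tmul A[X] (b.1 • m.1 + op m.2.2.1 • b.2.1) c.2.1 +
          op c.2.2 • (b.1 • m.2.1 + tmul A[X] b.2.1 m.2.2.2)
      rw [smul_add, smul_add, smul_tmul', add_tmul, tmul_add, op_smul_tmul, smul_tmul_right,
        smul_comm b.1 (op c.2.2)]
      abel
    · exact (mul_assoc b.2.2 m.2.2.1 c.1).symm
    · change b.2.2 • (m.2.2.1 • c.2.1 + op c.2.2 • m.2.2.2) =
        (b.2.2 * m.2.2.1) • c.2.1 + op c.2.2 • b.2.2 • m.2.2.2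
      rw [smul_add, mul_smul, smul_comm b.2.2 (op c.2.2)]

/-- `π E_y : E[y] E_y → E_y E_y`. -/
abbrev πEy : V.EEy →ₗ[A[X]] V.EyEy := BTensor.rTensor V.Ey V.π

theorem πEy_op (a : (A[X])ᵐᵒᵖ) (t : V.EEy) : V.πEy (a • t) = a • V.πEy t :=
  BTensor.hom_eq (V.πEy.toAddMonoidHom.comp (DistribSMul.toAddMonoidHom _ a))
    ((DistribSMul.toAddMonoidHom _ a).comp V.πEy.toAddMonoidHom) (fun _ _ => rfl) t

theorem πEy_ι_xE (t : BTensor A E E) : V.πEy (V.ι (V.xE t)) = V.πEy (V.ι (V.Ex t)) :=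
  BTensor.hom_eq (V.πEy.toAddMonoidHom.comp (V.ι.comp V.xE.toAddMonoidHom))
    (V.πEy.toAddMonoidHom.comp (V.ι.comp V.Ex.toAddMonoidHom)) (fun m n => by
      change tmul A[X] (V.piHom (EPoly.monomial 0 (V.x.left m))) (V.toEy n) =
        tmul A[X] (V.piHom (EPoly.monomial 0 m)) (V.toEy (V.x.left n))
      rw [piHom_monomial, piHom_monomial, ← YMod.X_smul, ← op_smul_tmul, pow_zero,
        YMod.op_X_smul]
      rfl) t

theorem s_eq (t : BTensor A E E) : V.s t = V.xE (V.τ.left t) - V.Ex (V.τ.left t) + t := by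
  have h1 := V.τ_Ex t
  have h2 := V.Ex_τ t
  rw [s_apply, map_sub, h1, h2]
  abel

theorem πEy_sY (e : V.Ey) (p : EPoly A E) :
    V.πEy (V.sY (tmul A[X] e p)) = tmul A[X] e (V.π.left p) := by
  obtain ⟨e, rfl⟩ := V.toEy.surjective e
  refine EPoly.hom_eq (V.πEy.toAddMonoidHom.comp (V.sPair (V.toEy e)))
    ((BTensor.tmulHom A[X] V.Ey V.Ey (V.toEy e)).comp V.piHom) (fun n f => ?_) p
  change V.πEy (V.sPair (V.toEy e) (EPoly.monomial n f)) =
    tmul A[X] (V.toEy e) (V.piHom (EPoly.monomial n f))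
  rw [sPair_apply, s_eq, map_add, map_sub, map_add, map_sub, πEy_ι_xE, sub_self, zero_add,
    piHom_monomial]
  change tmul A[X] (V.piHom (EPoly.monomial 0 ((V.x.left ^ n) e))) (V.toEy f) = _
  rw [piHom_monomial, pow_zero]
  change tmul A[X] (V.toEy ((V.x.left ^ n) e)) (V.toEy f) = _
  induction n generalizing f with
  | zero => rfl
  | succ n ih =>
    conv_lhs => rw [pow_succ', Module.End.mul_apply, ← YMod.op_X_smul, op_smul_tmul, YMod.X_smul,
      ih]
    rw [pow_succ, Module.End.mul_apply]

/-- The differential of `E'`, given by `π` on matrix entries. -/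
def d : BiHom V.B V.B V.E0 V.E1 where
  toFun m := (V.π.left m.1, V.πEy m.2.1, 0, V.π.left m.2.2)
  map_add' m n := by
    apply E1_ext
    · exact map_add _ _ _
    · exact map_add _ _ _
    · exact (add_zero _).symm
    · exact map_add _ _ _
  map_smul' b m := by
    apply E1_ext
    · change V.π.left (b.1 • m.1) = b.1 • V.π.left m.1 + op (0 : A[X]) • b.2.1
      rw [map_smul, op_zero, zero_smul, add_zero]
    · change V.πEy (b.1 • m.2.1 + V.sY (tmul A[X] b.2.1 m.2.2)) =
        b.1 • V.πEy m.2.1 + tmul A[X] b.2.1 (V.π.left m.2.2)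
      rw [map_add, map_smul, πEy_sY]
    · exact (mul_zero _).symm
    · exact map_smul _ _ _
  map_op_smul' b m := by
    apply E1_ext
    · exact V.π.map_op _ _
    · change V.πEy (tmul A[X] m.1 b.unop.2.1 + op b.unop.2.2 • m.2.1) =
        tmul A[X] (V.π.left m.1) b.unop.2.1 + op b.unop.2.2 • V.πEy m.2.1
      rw [map_add, πEy_op, BTensor.rTensor_tmul]
    · exact (zero_mul _).symm
    · change V.π.left (op b.unop.2.2 • m.2.2) =
        (0 : A[X]) • b.unop.2.1 + op b.unop.2.2 • V.π.left m.2.2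
      rw [V.π.map_op, zero_smul, zero_add]

end TwoRep

end

noncomputable section

section nilpotent
variable (A E : Type u) [Ring A] [AddCommGroup E] [Module A E] [Module Aᵐᵒᵖ E]
  [SMulCommClass A Aᵐᵒᵖ E]

/-- `E ⊗_A E ⊗_A ⋯ ⊗_A E ⊗_A M`, with `n` factors `E`. -/
def tensorIter (M : ModuleCat.{u} A) : ℕ → ModuleCat.{u} A
  | 0 => M
  | n + 1 => (BTensor.functor A A E).obj (tensorIter M n)

/-- The tensor power `Eⁿ`, with `E⁰ = A` and `Eⁿ⁺¹ = E ⊗_A Eⁿ`, as a left `A`-module. -/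
abbrev tensorPow (n : ℕ) : ModuleCat.{u} A := tensorIter A E (ModuleCat.of A A) n

/-- The bimodule `E` is locally nilpotent: each `A`-module is killed by some power of
`E ⊗_A -`. -/
def LocallyNilpotent : Prop :=
  ∀ M : ModuleCat.{u} A, ∃ n : ℕ, Subsingleton (tensorIter A E M n)

/-- Some tensor power `Eⁿ` vanishes. -/
def TensorNilpotent : Prop := ∃ n : ℕ, Subsingleton (tensorPow A E n)

end nilpotent

namespace TwoRep
variable {A E : Type u} [Ring A] [AddCommGroup E] [Module A E] [Module Aᵐᵒᵖ E]
  [SMulCommClass A Aᵐᵒᵖ E] (V : TwoRep A E)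

/-- The endomorphism `xᵢ = Eⁿ⁻ⁱ x Eⁱ⁻¹` of `Eⁿ`; the index `i ∈ {1, …, n}` is `i - 1 : Fin n`, so
that `xₙ` acts on the leftmost factor. -/
def xEnd : (n : ℕ) → Fin n → Module.End A (tensorPow A E n)
  | 0 => Fin.elim0
  | n + 1 => Fin.lastCases (motive := fun _ => Module.End A (tensorPow A E (n + 1)))
      (BTensor.rTensor (tensorPow A E n) V.x) (fun i => BTensor.lTensor A E (xEnd n i))

/-- `Eⁿ` is free as a module over `Pₙ = k[x₁, …, xₙ]`, where `xᵢ` acts by `Eⁿ⁻ⁱ x Eⁱ⁻¹`. -/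
def PowFree (k : Type*) [Field k] [Algebra k A] (n : ℕ) : Prop :=
  ∃ _ : Module (MvPolynomial (Fin n) k) (tensorPow A E n),
    (∀ (c : k) (t : tensorPow A E n),
      (MvPolynomial.C c : MvPolynomial (Fin n) k) • t = algebraMap k A c • t) ∧
    (∀ (i : Fin n) (t : tensorPow A E n),
      (MvPolynomial.X i : MvPolynomial (Fin n) k) • t = V.xEnd n i t) ∧
    Module.Free (MvPolynomial (Fin n) k) (tensorPow A E n)

/-- The differential of `E'` as a natural transformation `E'⁰ ⊗_B - ⟶ E'¹ ⊗_B -`. -/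
def dNat : BTensor.functor V.B V.B V.E0 ⟶ BTensor.functor V.B V.B V.E1 where
  app N := ModuleCat.ofHom (BTensor.rTensor N V.d)
  naturality N N' f := by
    ext t
    exact BTensor.hom_eq
      ((BTensor.rTensor N' V.d).toAddMonoidHom.comp
        (BTensor.lTensor V.B V.E0 f.hom).toAddMonoidHom)
      ((BTensor.lTensor V.B V.E1 f.hom).toAddMonoidHom.comp
        (BTensor.rTensor N V.d).toAddMonoidHom) (fun m n => rfl) t

/-- Complexes of left `B`-modules. -/
abbrev Cpx : Type (u + 1) := CochainComplex (ModuleCat.{u} V.B) ℤ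

/-- The homotopy category of complexes of left `B`-modules. -/
abbrev K : Type (u + 1) := HomotopyCategory (ModuleCat.{u} V.B) (ComplexShape.up ℤ)

/-- The functor `E' ⊗_B -` on complexes of left `B`-modules (total tensor product). -/
abbrev E' : V.Cpx ⥤ V.Cpx := CoconeFunctor.functor V.dNat

/-- The functor `E' ⊗_B -` on the homotopy category. -/
abbrev E'K : V.K ⥤ V.K := CoconeFunctor.homotopyFunctor V.dNat

/-- The idempotent `e₁` of `B`. -/
def e₁ : V.B := (1, 0, 0)

/-- `X₁ = B e₁`, in degree `0`. -/
def X₁ : V.Cpx :=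
  (CochainComplex.singleFunctor (ModuleCat.{u} V.B) 0).obj
    (ModuleCat.of V.B (Submodule.span V.B {V.e₁}))

/-- `X₂ = E' X₁`. -/
def X₂ : V.Cpx := V.E'.obj V.X₁

/-- `X = X₁ ⊕ X₂`. -/
def XX : V.K := (HomotopyCategory.quotient _ _).obj (V.X₁ ⊞ V.X₂)

/-- `C = End(X)ᵒᵖ`, endomorphisms being taken in the homotopy category. -/
def C : Type u := (End V.XX)ᵐᵒᵖ

instance : Ring V.C := inferInstanceAs (Ring (End V.XX)ᵐᵒᵖ)

/-- The endomorphism of `X` given by an element of `C`. -/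
def C.hom {V : TwoRep A E} (c : V.C) : V.XX ⟶ V.XX := MulOpposite.unop (α := End V.XX) c

/-- `Ẽ = Hom(X, E' X)`, in the homotopy category. -/
def Etilde : Type u := V.XX ⟶ V.E'K.obj V.XX

instance : AddCommGroup V.Etilde := inferInstanceAs (AddCommGroup (V.XX ⟶ V.E'K.obj V.XX))

theorem C.hom_mul (b c : V.C) : (b * c).hom = b.hom ≫ c.hom := rfl

theorem C.hom_add (b c : V.C) : (b + c).hom = b.hom + c.hom := rfl

/-- The left action of `C` on `Ẽ`, by composition on the source. -/
instance : Module V.C V.Etilde where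
  smul c f := c.hom ≫ (f : V.XX ⟶ V.E'K.obj V.XX)
  one_smul f := Category.id_comp (f : V.XX ⟶ V.E'K.obj V.XX)
  mul_smul b c f := Category.assoc b.hom c.hom (f : V.XX ⟶ V.E'K.obj V.XX)
  smul_zero _ := Limits.comp_zero
  smul_add c f g := Preadditive.comp_add _ _ _ c.hom (f : V.XX ⟶ V.E'K.obj V.XX) g
  add_smul b c f := Preadditive.add_comp _ _ _ b.hom c.hom (f : V.XX ⟶ V.E'K.obj V.XX)
  zero_smul _ := Limits.zero_comp

/-- The right action of `C` on `Ẽ`: `φ` acts by composition with `E'(φ)` on the target. -/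
instance : Module (V.C)ᵐᵒᵖ V.Etilde where
  smul c f := (f : V.XX ⟶ V.E'K.obj V.XX) ≫ V.E'K.map c.unop.hom
  one_smul f := (congrArg (CategoryStruct.comp (f : V.XX ⟶ V.E'K.obj V.XX))
    (V.E'K.map_id V.XX)).trans (Category.comp_id _)
  mul_smul b c f := (congrArg (CategoryStruct.comp (f : V.XX ⟶ V.E'K.obj V.XX))
    (V.E'K.map_comp c.unop.hom b.unop.hom)).trans (Category.assoc _ _ _).symm
  smul_zero _ := Limits.zero_comp
  smul_add c f g := Preadditive.add_comp _ _ _ (f : V.XX ⟶ V.E'K.obj V.XX) g _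
  add_smul b c f := (congrArg (CategoryStruct.comp (f : V.XX ⟶ V.E'K.obj V.XX))
    (V.E'K.map_add (f := b.unop.hom) (g := c.unop.hom))).trans (Preadditive.comp_add _ _ _ _ _ _)
  zero_smul f := (congrArg (CategoryStruct.comp (f : V.XX ⟶ V.E'K.obj V.XX))
    (V.E'K.map_zero V.XX V.XX)).trans Limits.comp_zero

instance : SMulCommClass V.C (V.C)ᵐᵒᵖ V.Etilde where
  smul_comm b c f := (Category.assoc b.hom (f : V.XX ⟶ V.E'K.obj V.XX) (V.E'K.map c.unop.hom)).symm

end TwoRep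

end

/-! Write `(N₁; N₂)` for a left `B`-module of column vectors and `T M` for `E' ⊗_B (M[y]; 0)`, so
that `X₂ ≅ T A`. The quantitative statement behind the theorem is that `Eⁿ = 0` implies `Ẽⁿ⁺¹ = 0`:
tensoring with one `Ẽ` over `C` can be traded for tensoring with one `E` over `A`.

If `Y` is a direct summand of a finite sum of copies of `X`, then `Ẽ ⊗_C Hom(X, Y)` is a quotient of
`Hom(X, E'Y)` (`exists_surjective_tensor`). As `Eᵐ` is a summand of a finite free `A`-module, this
applies to `Y = T Eᵐ` (`inAdd_TK`). The heart of the proof is that `Hom(X, E' T M)`, for `M = Eᵐ`,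
is generated by the images of two maps from `Hom(X, T(E ⊗_A M))` (`exists_jointlySurjective`). By
induction `Ẽⁿ ⊗_C Hom(X, T Eᵐ) = 0` as soon as `Eᵐ⁺ⁿ = 0` (`subsingleton_tensorIter_TK`). The case
`m = 0` treats `X₂`, one more factor `Ẽ` treats `X₁` because `E' X₁ = X₂`, and `C` is generated by
`Hom(X, X₁)` and `Hom(X, X₂)`.

The heart is a statement about honest chain maps. Put `L = M[y]`. The complex `E'(E L; 0)` is `(E E
L; 0) → (E_y E L; E L)`, whereas `E'E'(L; 0)` has the terms `(E E L; 0)`, then `(E E_y L; E L) ⊕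
(E_y E L; E L)`, then `(E_y E_y L; E_y L)`. The involution `s` induces an isomorphism `σ` from the
second summand in degree `1` to the first. A chain map from a complex in degrees `0` and `1` has
components `u`, `v` in degree `1`, and the vanishing of the differential into degree `2` says that
`u - σ v` is killed by the projection to `(E_y E_y L; E_y L)`. The kernel of that projection is the
image of `x - y`, so `u - σ v = (x - y) r`. The data `v` and `r` define two maps into `E'(E L; 0)`,
and `τ` supplies the correction in degree `0` (`exists_factor`, `exists_topCpx_factor`).

For this, `x - y` must be injective on `E L` and on `E E_y L`. On `E L` this is seen on leading
coefficients in `y` (`mu_LPoly_injective`). On `E E_y L` with `M = Eᵐ` it reduces to injectivity of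
`xₘ₊₂ - xₘ₊₁` on `Eᵐ⁺²`, which follows from freeness over the polynomial ring
(`mu_tensorPow_injective`).

The equivalence of local nilpotence with the vanishing of a power is formal: test on the module `A`,
and conversely use that every module is generated by maps from `A`. -/

noncomputable section

/-! ### Two-term complexes and chain maps out of degrees `0` and `1`. -/

namespace CoconeFunctor
open CategoryTheory.Limits CochainComplex CochainComplex.HomComplex HomologicalComplex
universe v w
variable {𝒜 : Type w} [Category.{v} 𝒜] [Preadditive 𝒜]

/-- The map of complexes given by its components in degrees `0` and `1`. -/
def homOfPair {X K : CochainComplex 𝒜 ℤ} (hX : ∀ n : ℤ, n ≠ 0 → n ≠ 1 → IsZero (X.X n))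
    (u₀ : X.X 0 ⟶ K.X 0) (u₁ : X.X 1 ⟶ K.X 1) (h : u₀ ≫ K.d 0 1 = X.d 0 1 ≫ u₁)
    (h' : u₁ ≫ K.d 1 2 = 0) : X ⟶ K where
  f n := match n with
    | Int.ofNat 0 => u₀
    | Int.ofNat 1 => u₁
    | _ => 0
  comm' i j hij := by
    by_cases h0 : i = 0
    · subst h0
      obtain rfl : j = 1 := by simpa using hij.symm
      exact h
    by_cases h1 : i = 1
    · subst h1
      obtain rfl : j = 2 := by simpa using hij.symm
      exact h'.trans comp_zero.symm
    exact (hX i h0 h1).eq_of_src _ _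

theorem hom_ext_pair {X K : CochainComplex 𝒜 ℤ}
    (hX : ∀ n : ℤ, n ≠ 0 → n ≠ 1 → IsZero (X.X n)) (f g : X ⟶ K)
    (h₀ : f.f 0 = g.f 0) (h₁ : f.f 1 = g.f 1) : f = g := by
  ext n
  by_cases h0 : n = 0
  · subst h0; exact h₀
  by_cases h1 : n = 1
  · subst h1; exact h₁
  exact (hX n h0 h1).eq_of_src _ _

/-- An identification of a complex with the two-term complex `f`, in degrees `0` and `1`. -/
structure TwoTerm (K : CochainComplex 𝒜 ℤ) {K₀ K₁ : 𝒜} (f : K₀ ⟶ K₁) where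
  e₀ : K.X 0 ≅ K₀
  e₁ : K.X 1 ≅ K₁
  comm : K.d 0 1 ≫ e₁.hom = e₀.hom ≫ f
  zero : ∀ n : ℤ, n ≠ 0 → n ≠ 1 → IsZero (K.X n)

variable [HasBinaryBiproducts 𝒜]

theorem isZero_X {K L : CochainComplex 𝒜 ℤ} (φ : K ⟶ L) (n m : ℤ) (h : n + -1 = m)
    (hK : IsZero (K.X n)) (hL : IsZero (L.X m)) : IsZero ((mappingCocone φ).X n) := by
  rw [IsZero.iff_id_eq_zero, ← mappingCocone.id_X φ n m h, hK.eq_of_tgt ((mappingCocone.fst φ).f n) 0,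
    hL.eq_of_tgt ((mappingCocone.snd φ).v n m h) 0]
  simp

theorem cocone_hom_ext {K L : CochainComplex 𝒜 ℤ} (φ : K ⟶ L) (n m : ℤ) (h : n + -1 = m) {W : 𝒜}
    (f g : W ⟶ (mappingCocone φ).X n)
    (h₁ : f ≫ (mappingCocone.fst φ).f n = g ≫ (mappingCocone.fst φ).f n)
    (h₂ : f ≫ (mappingCocone.snd φ).v n m h = g ≫ (mappingCocone.snd φ).v n m h) : f = g := by
  rw [← Category.comp_id f, ← Category.comp_id g, ← mappingCocone.id_X φ n m h,
    Preadditive.comp_add, Preadditive.comp_add, reassoc_of% h₁, reassoc_of% h₂]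

/-- The identity `δ_snd` of cochains, evaluated in a single degree. -/
theorem d_snd {K L : CochainComplex 𝒜 ℤ} (φ : K ⟶ L) (n m : ℤ) (h : n + 1 = m) (l : ℤ)
    (hl : n + -1 = l) :
    (mappingCocone φ).d n m ≫ (mappingCocone.snd φ).v m n (by lia) =
      -((mappingCocone.fst φ).f n ≫ φ.f n) -
        (mappingCocone.snd φ).v n l hl ≫ L.d l n := by
  have := Cochain.congr_v (δ_snd φ) n n (by lia)
  rw [δ_v (-1) 0 (by lia) _ n n (by lia) l m (by lia) h] at this
  simp only [Int.negOnePow_zero, one_smul, Cochain.neg_v, Cochain.ofHom_v, comp_f] at this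
  rw [← this]
  abel

variable {F G : 𝒜 ⥤ 𝒜} [F.Additive] [G.Additive] (α : F ⟶ G)

theorem isZero_obj {K : CochainComplex 𝒜 ℤ} (n m : ℤ) (h : n + -1 = m)
    (h₁ : IsZero (K.X n)) (h₂ : IsZero (K.X m)) : IsZero ((obj α K).X n) :=
  isZero_X _ n m h (F.map_isZero h₁) (G.map_isZero h₂)

end CoconeFunctor
end

/-! ### Coordinates on the total complex of `F K ⟶ G K`, and the factorization criterion. -/

noncomputable section

namespace CoconeFunctor
open CategoryTheory.Limits CochainComplex CochainComplex.HomComplex HomologicalComplex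
universe v w
variable {𝒜 : Type w} [Category.{v} 𝒜] [Preadditive 𝒜] [HasBinaryBiproducts 𝒜]
variable {F G : 𝒜 ⥤ 𝒜} [F.Additive] [G.Additive] (α : F ⟶ G)

variable (K : CochainComplex 𝒜 ℤ)

/-- The projection of the total complex of `F K ⟶ G K` to `F K`. -/
def prF (n : ℤ) : (obj α K).X n ⟶ F.obj (K.X n) := (mappingCocone.fst (-(transf α K))).f n

/-- The projection of the total complex of `F K ⟶ G K` to `G K`. -/
def prG (n m : ℤ) (h : n + -1 = m) : (obj α K).X n ⟶ G.obj (K.X m) :=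
  (mappingCocone.snd (-(transf α K))).v n m h

/-- The inclusion of `F K`. -/
def inF (n : ℤ) : F.obj (K.X n) ⟶ (obj α K).X n :=
  (mappingCocone.inl (-(transf α K))).v n n (add_zero n)

/-- The inclusion of `G K`. -/
def inG (n m : ℤ) (h : m + 1 = n) : G.obj (K.X m) ⟶ (obj α K).X n :=
  (mappingCocone.inr (-(transf α K))).1.v m n h

@[simp]
theorem inF_prF (n : ℤ) : inF α K n ≫ prF α K n = 𝟙 _ := mappingCocone.inl_v_fst_f _ n

@[simp]
theorem inF_prF_assoc (n : ℤ) {Z : 𝒜} (h : F.obj (K.X n) ⟶ Z) :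
    inF α K n ≫ prF α K n ≫ h = h := by
  rw [← Category.assoc, inF_prF, Category.id_comp]

@[simp]
theorem inF_prG (n m : ℤ) (h : n + -1 = m) : inF α K n ≫ prG α K n m h = 0 :=
  mappingCocone.inl_v_snd_v _ n m h

@[simp]
theorem inF_prG_assoc (n m : ℤ) (h : n + -1 = m) {Z : 𝒜} (k : G.obj (K.X m) ⟶ Z) :
    inF α K n ≫ prG α K n m h ≫ k = 0 := by
  rw [← Category.assoc, inF_prG, Limits.zero_comp]

@[simp]
theorem inG_prF (n m : ℤ) (h : m + 1 = n) : inG α K n m h ≫ prF α K n = 0 :=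
  mappingCocone.inr_v_fst_f _ m n h

@[simp]
theorem inG_prF_assoc (n m : ℤ) (h : m + 1 = n) {Z : 𝒜} (k : F.obj (K.X n) ⟶ Z) :
    inG α K n m h ≫ prF α K n ≫ k = 0 := by
  rw [← Category.assoc, inG_prF, Limits.zero_comp]

@[simp]
theorem inG_prG (n m : ℤ) (h : m + 1 = n) (h' : n + -1 = m) :
    inG α K n m h ≫ prG α K n m h' = 𝟙 _ :=
  mappingCocone.inr_v_snd_v _ m n h

@[simp]
theorem inG_prG_assoc (n m : ℤ) (h : m + 1 = n) (h' : n + -1 = m) {Z : 𝒜}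
    (k : G.obj (K.X m) ⟶ Z) : inG α K n m h ≫ prG α K n m h' ≫ k = k := by
  rw [← Category.assoc, inG_prG, Category.id_comp]

variable {K} in
theorem obj_hom_ext (n m : ℤ) (h : n + -1 = m) {W : 𝒜} (f g : W ⟶ (obj α K).X n)
    (h₁ : f ≫ prF α K n = g ≫ prF α K n) (h₂ : f ≫ prG α K n m h = g ≫ prG α K n m h) : f = g :=
  cocone_hom_ext _ n m h f g h₁ h₂

theorem d_prF (n m : ℤ) : (obj α K).d n m ≫ prF α K m = prF α K n ≫ F.map (K.d n m) :=
  ((mappingCocone.fst (-(transf α K))).comm n m).symm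

/-- The total complex is the cocone of `-α`, so the two signs in front of `α` cancel, while the
differential of `G K` keeps its sign. -/
theorem d_prG (n m : ℤ) (h : n + 1 = m) (l : ℤ) (hl : n + -1 = l) :
    (obj α K).d n m ≫ prG α K m n (by lia) =
      prF α K n ≫ α.app (K.X n) - prG α K n l hl ≫ G.map (K.d l n) := by
  refine (d_snd (-(transf α K)) n m h l hl).trans ?_
  exact congrArg₂ (· - ·) ((congrArg Neg.neg (Preadditive.comp_neg (prF α K n)
    (α.app (K.X n)))).trans (neg_neg _)) rfl

namespace TwoTerm
variable {K} {K₀ K₁ : 𝒜} {f : K₀ ⟶ K₁} (t : TwoTerm K f)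

/-- In degree `0`, the total complex of `F K ⟶ G K` is `F K₀`. -/
def fst₀ : (obj α K).X 0 ⟶ F.obj K₀ :=
  prF α K 0 ≫ F.map t.e₀.hom

/-- In degree `1`, the first component of the total complex of `F K ⟶ G K`. -/
def fst₁ : (obj α K).X 1 ⟶ F.obj K₁ :=
  prF α K 1 ≫ F.map t.e₁.hom

/-- In degree `1`, the second component of the total complex of `F K ⟶ G K`. -/
def snd₁ : (obj α K).X 1 ⟶ G.obj K₀ :=
  prG α K 1 0 (by lia) ≫ G.map t.e₀.hom

/-- In degree `2`, the total complex of `F K ⟶ G K` is `G K₁`. -/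
def snd₂ : (obj α K).X 2 ⟶ G.obj K₁ :=
  prG α K 2 1 (by lia) ≫ G.map t.e₁.hom

/-- The inclusion of the degree `0` part. -/
def in₀ : F.obj K₀ ⟶ (obj α K).X 0 :=
  F.map t.e₀.inv ≫ inF α K 0

/-- The map to the degree `1` part with given components. -/
def pair₁ {W : 𝒜} (a : W ⟶ F.obj K₁) (b : W ⟶ G.obj K₀) : W ⟶ (obj α K).X 1 :=
  a ≫ F.map t.e₁.inv ≫ inF α K 1 +
    b ≫ G.map t.e₀.inv ≫ inG α K 1 0 (by lia)

@[simp]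
theorem in₀_fst₀ : t.in₀ α ≫ t.fst₀ α = 𝟙 _ := by
  simp [in₀, fst₀, ← F.map_comp]

@[simp]
theorem in₀_fst₀_assoc {Z : 𝒜} (k : F.obj K₀ ⟶ Z) : t.in₀ α ≫ t.fst₀ α ≫ k = k := by
  rw [← Category.assoc, in₀_fst₀, Category.id_comp]

@[simp]
theorem pair₁_fst₁ {W : 𝒜} (a : W ⟶ F.obj K₁) (b : W ⟶ G.obj K₀) :
    t.pair₁ α a b ≫ t.fst₁ α = a := by
  simp [pair₁, fst₁, ← F.map_comp]

@[simp]
theorem pair₁_fst₁_assoc {W Z : 𝒜} (a : W ⟶ F.obj K₁) (b : W ⟶ G.obj K₀) (k : F.obj K₁ ⟶ Z) :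
    t.pair₁ α a b ≫ t.fst₁ α ≫ k = a ≫ k := by
  rw [← Category.assoc, pair₁_fst₁]

@[simp]
theorem pair₁_snd₁ {W : 𝒜} (a : W ⟶ F.obj K₁) (b : W ⟶ G.obj K₀) :
    t.pair₁ α a b ≫ t.snd₁ α = b := by
  simp [pair₁, snd₁, ← G.map_comp]

@[simp]
theorem pair₁_snd₁_assoc {W Z : 𝒜} (a : W ⟶ F.obj K₁) (b : W ⟶ G.obj K₀) (k : G.obj K₀ ⟶ Z) :
    t.pair₁ α a b ≫ t.snd₁ α ≫ k = b ≫ k := by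
  rw [← Category.assoc, pair₁_snd₁]

include t in
theorem prG_zero : prG α K 0 (-1) (by lia) = 0 :=
  (G.map_isZero (t.zero (-1) (by lia) (by lia))).eq_of_tgt _ _

/-- The `G`-summand in degree `0` comes from the degree `-1` term of `K`, which vanishes. In `ext₂`
it is the `F`-summand that vanishes. -/
theorem ext₀ {W : 𝒜} {a b : W ⟶ (obj α K).X 0} (h : a ≫ t.fst₀ α = b ≫ t.fst₀ α) : a = b := by
  apply obj_hom_ext α 0 (-1) (by lia)
  · rw [← cancel_mono (F.map t.e₀.hom)]
    simpa [fst₀] using h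
  · exact (G.map_isZero (t.zero (-1) (by lia) (by lia))).eq_of_tgt _ _

theorem ext₁ {W : 𝒜} {a b : W ⟶ (obj α K).X 1} (h : a ≫ t.fst₁ α = b ≫ t.fst₁ α)
    (h' : a ≫ t.snd₁ α = b ≫ t.snd₁ α) : a = b := by
  apply obj_hom_ext α 1 0 (by lia)
  · rw [← cancel_mono (F.map t.e₁.hom)]
    simpa [fst₁] using h
  · rw [← cancel_mono (G.map t.e₀.hom)]
    simpa [snd₁] using h'

theorem ext₂ {W : 𝒜} {a b : W ⟶ (obj α K).X 2} (h : a ≫ t.snd₂ α = b ≫ t.snd₂ α) : a = b := by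
  apply obj_hom_ext α 2 1 (by lia)
  · exact (F.map_isZero (t.zero 2 (by lia) (by lia))).eq_of_tgt _ _
  · rw [← cancel_mono (G.map t.e₁.hom)]
    simpa [snd₂] using h

theorem d₀_fst₁ : (obj α K).d 0 1 ≫ t.fst₁ α = t.fst₀ α ≫ F.map f := by
  rw [fst₁, reassoc_of% (d_prF α K 0 1), fst₀, Category.assoc, ← F.map_comp, ← F.map_comp, t.comm]

theorem d₀_snd₁ : (obj α K).d 0 1 ≫ t.snd₁ α = t.fst₀ α ≫ α.app K₀ := by
  rw [snd₁, reassoc_of% (d_prG α K 0 1 (by lia) (-1) (by lia)), t.prG_zero, fst₀, Category.assoc,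
    α.naturality]
  simp

theorem d₁_snd₂ : (obj α K).d 1 2 ≫ t.snd₂ α =
    t.fst₁ α ≫ α.app K₁ - t.snd₁ α ≫ G.map f := by
  rw [snd₂, reassoc_of% (d_prG α K 1 2 (by lia) 0 (by lia)), fst₁, snd₁, Category.assoc, Category.assoc,
    α.naturality, ← G.map_comp, ← t.comm, G.map_comp]
  simp

end TwoTerm

/-- If `K` is an object `S` in degree `0`, the total complex of `F K ⟶ G K` is a two-term
complex. -/
def twoTermOfDegreeZero {K : CochainComplex 𝒜 ℤ} {S : 𝒜} (e : K.X 0 ≅ S)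
    (hz : ∀ n : ℤ, n ≠ 0 → IsZero (K.X n)) : TwoTerm (obj α K) (α.app S) :=
  { e₀ :=
      { hom := prF α K 0 ≫ F.map e.hom
        inv := F.map e.inv ≫ inF α K 0
        hom_inv_id := by
          apply obj_hom_ext α 0 (-1) (by lia)
          · simp [← F.map_comp_assoc]
          · exact (G.map_isZero (hz (-1) (by lia))).eq_of_tgt _ _
        inv_hom_id := by simp [← F.map_comp] }
    e₁ :=
      { hom := prG α K 1 0 (by lia) ≫ G.map e.hom
        inv := G.map e.inv ≫ inG α K 1 0 (by lia)
        hom_inv_id := by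
          apply obj_hom_ext α 1 0 (by lia)
          · exact (F.map_isZero (hz 1 (by lia))).eq_of_tgt _ _
          · simp [← G.map_comp_assoc]
        inv_hom_id := by simp [← G.map_comp] }
    comm := by
      have h0 : prG α K 0 (-1) (by lia) = 0 := (G.map_isZero (hz (-1) (by lia))).eq_of_tgt _ _
      change _ = (prF α K 0 ≫ F.map e.hom) ≫ α.app S
      rw [reassoc_of% (d_prG α K 0 1 (by lia) (-1) (by lia)), h0, Category.assoc, α.naturality]
      simp
    zero := fun n h0 h1 => isZero_obj α n (n + -1) rfl (hz n h0) (hz _ (by lia)) }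

/-- For an object `S` in degree `0`, the total complex of `F S ⟶ G S` is a two-term complex. -/
def twoTermSingle [HasZeroObject 𝒜] (S : 𝒜) :
    TwoTerm (obj α ((CochainComplex.singleFunctor 𝒜 0).obj S)) (α.app S) :=
  twoTermOfDegreeZero α (HomologicalComplex.singleObjXSelf (ComplexShape.up ℤ) 0 S)
    (fun n hn => HomologicalComplex.isZero_single_obj_X (ComplexShape.up ℤ) 0 S n hn)

/-- Every map from a complex in degrees `0`, `1` to the total complex of `F K ⟶ G K` is a
combination of two fixed maps from a two-term complex. -/
theorem exists_factor {K K' : CochainComplex 𝒜 ℤ} {K₀ K₁ : 𝒜} {f : K₀ ⟶ K₁} (t : TwoTerm K f)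
    (t' : TwoTerm K' (α.app K₀)) (a τ μ₀ : F.obj K₀ ⟶ F.obj K₀) (μ₁ : F.obj K₁ ⟶ F.obj K₁)
    (σ : G.obj K₀ ≅ F.obj K₁) (h₁ : a ≫ F.map f = α.app K₀ ≫ σ.hom)
    (h₂ : a ≫ α.app K₀ = α.app K₀) (h₃ : σ.hom ≫ α.app K₁ = G.map f)
    (h₄ : a = 𝟙 _ + τ ≫ μ₀) (h₅ : τ ≫ a = τ) (h₆ : μ₀ ≫ F.map f = F.map f ≫ μ₁)
    (h₇ : μ₀ ≫ α.app K₀ = 0) (h₈ : μ₁ ≫ α.app K₁ = 0) (h₉ : Mono μ₁)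
    (h₁₀ : ∀ {W : 𝒜} (r : W ⟶ F.obj K₁), r ≫ α.app K₁ = 0 → ∃ r', r' ≫ μ₁ = r) :
    ∃ α₁ α₂ : K' ⟶ obj α K, ∀ (X : CochainComplex 𝒜 ℤ)
      (hX : ∀ n : ℤ, n ≠ 0 → n ≠ 1 → IsZero (X.X n)) (φ : X ⟶ obj α K),
        ∃ g₁ g₂ : X ⟶ K', φ = g₁ ≫ α₁ + g₂ ≫ α₂ := by
  have hμ : (a ≫ μ₀) ≫ F.map f = α.app K₀ ≫ σ.hom ≫ μ₁ := by
    rw [Category.assoc, h₆, reassoc_of% h₁]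
  -- The first map is `a` in degree `0` and `(σ, 1)` in degree `1`; the second is `a ≫ μ₀` and `(σ ≫
  -- μ₁, 0)`.
  refine ⟨homOfPair t'.zero (t'.e₀.hom ≫ a ≫ t.in₀ α) (t'.e₁.hom ≫ t.pair₁ α σ.hom (𝟙 _)) ?_ ?_,
    homOfPair t'.zero (t'.e₀.hom ≫ (a ≫ μ₀) ≫ t.in₀ α)
      (t'.e₁.hom ≫ t.pair₁ α (σ.hom ≫ μ₁) 0) ?_ ?_, fun X hX φ => ?_⟩
  · rw [reassoc_of% t'.comm]
    apply t.ext₁ α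
    · simp [TwoTerm.d₀_fst₁, h₁]
    · simp [TwoTerm.d₀_snd₁, h₂]
  · apply t.ext₂ α
    simp [TwoTerm.d₁_snd₂, h₃]
  · rw [reassoc_of% t'.comm]
    apply t.ext₁ α
    · simp only [Category.assoc, TwoTerm.d₀_fst₁, TwoTerm.in₀_fst₀_assoc, TwoTerm.pair₁_fst₁]
      rw [← hμ, Category.assoc]
    · simp [TwoTerm.d₀_snd₁, h₇]
  · apply t.ext₂ α
    simp [TwoTerm.d₁_snd₂, h₈]
  · have c1 : X.d 0 1 ≫ φ.f 1 ≫ t.fst₁ α = φ.f 0 ≫ t.fst₀ α ≫ F.map f := by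
      rw [← TwoTerm.d₀_fst₁, φ.comm_assoc]
    have c2 : X.d 0 1 ≫ φ.f 1 ≫ t.snd₁ α = φ.f 0 ≫ t.fst₀ α ≫ α.app K₀ := by
      rw [← TwoTerm.d₀_snd₁, φ.comm_assoc]
    -- As `X` vanishes in degree `2`, the degree `1` part of `φ` is a cocycle.
    have c3 : φ.f 1 ≫ t.fst₁ α ≫ α.app K₁ = φ.f 1 ≫ t.snd₁ α ≫ G.map f := by
      rw [← sub_eq_zero, ← Preadditive.comp_sub, ← TwoTerm.d₁_snd₂, φ.comm_assoc,
        (hX 2 (by lia) (by lia)).eq_of_src (φ.f 2) 0]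
      simp
    -- By `c3` and `h₃`, the amount by which the `F`-component of `φ` differs from what `σ` predicts
    -- out of its `G`-component is killed by `α.app K₁`, hence divisible by `μ₁`.
    obtain ⟨r, hr⟩ := h₁₀ (φ.f 1 ≫ t.fst₁ α - φ.f 1 ≫ t.snd₁ α ≫ σ.hom) (by
      rw [Preadditive.sub_comp, Category.assoc, Category.assoc, Category.assoc, h₃, c3, sub_self])
    have hz : K'.d 1 2 = 0 := (t'.zero 2 (by lia) (by lia)).eq_of_tgt _ _
    have hi : t'.e₀.inv ≫ K'.d 0 1 = α.app K₀ ≫ t'.e₁.inv := by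
      rw [Iso.inv_comp_eq, ← Category.assoc, Iso.eq_comp_inv, t'.comm]
    have hτ : τ ≫ a ≫ μ₀ = τ ≫ μ₀ := by rw [reassoc_of% h₅]
    -- The first map records the degree `0` part and the `G`-component of `φ`. The second carries
    -- the remainder `r`; its degree `0` part involves `-τ` to undo the term `τ ≫ μ₀` of `a`.
    refine ⟨homOfPair hX (φ.f 0 ≫ t.fst₀ α ≫ t'.e₀.inv) (φ.f 1 ≫ t.snd₁ α ≫ t'.e₁.inv) ?_ ?_,
      homOfPair hX (-(φ.f 0 ≫ t.fst₀ α ≫ τ ≫ t'.e₀.inv)) (r ≫ σ.inv ≫ t'.e₁.inv) ?_ ?_, ?_⟩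
    · rw [Category.assoc, Category.assoc, hi, ← reassoc_of% c2]
    · rw [hz, Limits.comp_zero]
    · rw [Preadditive.neg_comp]
      simp only [Category.assoc, hi]
      -- That the second pair is a chain map is tested after composing with the monomorphism `σ ≫
      -- μ₁`, where `r ≫ μ₁` is known; here `h₉` enters.
      rw [← Category.assoc r, ← Category.assoc (X.d 0 1), ← cancel_mono t'.e₁.hom,
        ← cancel_mono (σ.hom ≫ μ₁)]
      have e1 : X.d 0 1 ≫ r ≫ μ₁ = -(φ.f 0 ≫ t.fst₀ α ≫ τ ≫ μ₀ ≫ F.map f) := by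
        rw [hr, Preadditive.comp_sub, c1, reassoc_of% c2, ← h₁, h₄]
        simp
      simp only [Preadditive.neg_comp, Category.assoc, Iso.inv_hom_id_assoc, e1]
      rw [← hμ, Category.assoc, reassoc_of% h₅]
    · rw [hz, Limits.comp_zero]
    · apply hom_ext_pair hX
      · apply t.ext₀ α
        change φ.f 0 ≫ _ = ((φ.f 0 ≫ t.fst₀ α ≫ t'.e₀.inv) ≫ (t'.e₀.hom ≫ a ≫ t.in₀ α) +
          (-(φ.f 0 ≫ t.fst₀ α ≫ τ ≫ t'.e₀.inv)) ≫ (t'.e₀.hom ≫ (a ≫ μ₀) ≫ t.in₀ α)) ≫ _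
        simp only [Preadditive.add_comp, Preadditive.neg_comp, Category.assoc,
          Iso.inv_hom_id_assoc, TwoTerm.in₀_fst₀, Category.comp_id, hτ]
        -- Since `τ ≫ a ≫ μ₀ = τ ≫ μ₀`, the sum in degree `0` is `a - τ ≫ μ₀ = 1`.
        rw [h₄]
        simp
      · apply t.ext₁ α
        · change φ.f 1 ≫ _ = ((φ.f 1 ≫ t.snd₁ α ≫ t'.e₁.inv) ≫
            (t'.e₁.hom ≫ t.pair₁ α σ.hom (𝟙 _)) + (r ≫ σ.inv ≫ t'.e₁.inv) ≫
            (t'.e₁.hom ≫ t.pair₁ α (σ.hom ≫ μ₁) 0)) ≫ _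
          simp only [Preadditive.add_comp, Category.assoc, Iso.inv_hom_id_assoc,
            TwoTerm.pair₁_fst₁, hr]
          abel
        · change φ.f 1 ≫ _ = ((φ.f 1 ≫ t.snd₁ α ≫ t'.e₁.inv) ≫
            (t'.e₁.hom ≫ t.pair₁ α σ.hom (𝟙 _)) + (r ≫ σ.inv ≫ t'.e₁.inv) ≫
            (t'.e₁.hom ≫ t.pair₁ α (σ.hom ≫ μ₁) 0)) ≫ _
          simp only [Preadditive.add_comp, Category.assoc, Iso.inv_hom_id_assoc,
            TwoTerm.pair₁_snd₁]
          simp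

end CoconeFunctor
end

/-! ### Right exactness of tensor products, generation, and the formal part of nilpotence. -/

noncomputable section

namespace BTensor

theorem addSubgroup_eq_top {S M N : Type*} [Ring S] [AddCommGroup M] [Module Sᵐᵒᵖ M]
    [AddCommGroup N] [Module S N] (H : AddSubgroup (BTensor S M N)) (h : ∀ m n, tmul S m n ∈ H)
    (t : BTensor S M N) : t ∈ H :=
  induction H.zero_mem h (fun _ _ => H.add_mem) t

section exact
variable {R S M N N' N'' : Type*} [Ring R] [Ring S] [AddCommGroup M] [Module R M] [Module Sᵐᵒᵖ M]
  [SMulCommClass R Sᵐᵒᵖ M] [AddCommGroup N] [Module S N] [AddCommGroup N'] [Module S N']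
  [AddCommGroup N''] [Module S N'']

/-- The functor `M ⊗_S -` is right exact. -/
theorem lTensor_exact {f : N →ₗ[S] N'} {g : N' →ₗ[S] N''} (hg : Function.Surjective g)
    (hgf : ∀ n, g (f n) = 0) (hfg : ∀ n', g n' = 0 → ∃ n, f n = n') (t : BTensor S M N')
    (ht : lTensor R M g t = 0) : ∃ t', lTensor R M f t' = t := by
  let H : AddSubgroup (BTensor S M N') := (lTensor R M f).toAddMonoidHom.range
  -- Two preimages of the same element under `g` differ by an element of the image of `f`, so the
  -- class of `m ⊗ a` depends only on `g a`.
  have key : ∀ (m : M) (a b : N'), g a = g b →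
      (QuotientAddGroup.mk (tmul S m a) : BTensor S M N' ⧸ H) =
        QuotientAddGroup.mk (tmul S m b) := by
    intro m a b hab
    obtain ⟨n, hn⟩ := hfg (-a + b) (by rw [map_add, map_neg, hab, neg_add_cancel])
    rw [QuotientAddGroup.eq]
    refine ⟨tmul S m n, ?_⟩
    change tmul S m (f n) = _
    rw [hn]
    change tmulHom S M N' m _ = _
    rw [map_add, map_neg]
    rfl
  have hs := Function.surjInv_eq hg
  -- Choosing preimages under `g` is therefore additive and balanced modulo `H`. Composed with `M ⊗
  -- g`, the resulting map is the quotient map by `H`.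
  let k : BTensor S M N'' →+ BTensor S M N' ⧸ H :=
    lift (AddMonoidHom.mk' (fun m => AddMonoidHom.mk'
        (fun n => (QuotientAddGroup.mk (tmul S m (Function.surjInv hg n)) : BTensor S M N' ⧸ H))
        (fun a b => by
          rw [← QuotientAddGroup.mk_add, ← tmul_add]
          exact key _ _ _ (by rw [map_add, hs, hs, hs])))
        (fun m m' => by
          ext n
          change QuotientAddGroup.mk _ = _
          rw [add_tmul]; rfl))
      (fun s m n => by
        change (QuotientAddGroup.mk (tmul S (op s • m) (Function.surjInv hg n)) :
          BTensor S M N' ⧸ H) = QuotientAddGroup.mk (tmul S m (Function.surjInv hg (s • n)))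
        rw [op_smul_tmul]
        exact key _ _ _ (by rw [map_smul, hs, hs]))
  have h := hom_eq (k.comp (lTensor R M g).toAddMonoidHom) (QuotientAddGroup.mk' H)
    (fun m n => key _ _ _ (hs _)) t
  have h0 : (QuotientAddGroup.mk' H) t = 0 := by
    rw [← h, AddMonoidHom.comp_apply, LinearMap.toAddMonoidHom_coe, ht, map_zero]
  exact (QuotientAddGroup.eq_zero_iff t).1 h0

theorem lTensor_surjective {g : N' →ₗ[S] N''} (hg : Function.Surjective g) :
    Function.Surjective (lTensor R M g) := fun t =>
  addSubgroup_eq_top (lTensor R M g).toAddMonoidHom.range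
    (fun m n => by obtain ⟨n, rfl⟩ := hg n; exact ⟨tmul S m n, rfl⟩) t

end exact
end BTensor

section nilpotent
variable {A E : Type u} [Ring A] [AddCommGroup E] [Module A E] [Module Aᵐᵒᵖ E]
  [SMulCommClass A Aᵐᵒᵖ E]

/-- A family of linear maps is jointly surjective if the images generate the target. -/
def JointlySurjective {ι : Type*} {M : ModuleCat.{u} A} {N : ι → ModuleCat.{u} A}
    (f : ∀ i, N i ⟶ M) : Prop :=
  AddSubgroup.closure (⋃ i, Set.range (f i).hom) = ⊤

/-- Generation passes to `E ⊗_A -` because `e ⊗ m` is additive in `m`. -/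
theorem JointlySurjective.tensor {ι : Type*} {M : ModuleCat.{u} A} {N : ι → ModuleCat.{u} A}
    {f : ∀ i, N i ⟶ M} (h : JointlySurjective f) :
    JointlySurjective (fun i => (BTensor.functor A A E).map (f i)) := by
  refine eq_top_iff.2 fun t _ => BTensor.addSubgroup_eq_top _ (fun e m => ?_) t
  have hm : m ∈ AddSubgroup.closure (⋃ i, Set.range (f i).hom) := by rw [h]; trivial
  induction hm using AddSubgroup.closure_induction with
  | mem m hm =>
    obtain ⟨i, n, rfl⟩ := Set.mem_iUnion.1 hm
    exact AddSubgroup.subset_closure (Set.mem_iUnion.2 ⟨i, BTensor.tmul A e n, rfl⟩)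
  | zero => rw [BTensor.tmul_zero]; exact zero_mem _
  | add a b _ _ ha hb => rw [BTensor.tmul_add]; exact add_mem ha hb
  | neg a _ ha =>
    have : BTensor.tmul A e (-a) = -BTensor.tmul A e a := map_neg (BTensor.tmulHom A E M e) a
    rw [this]; exact neg_mem ha

theorem JointlySurjective.subsingleton {ι : Type*} {M : ModuleCat.{u} A}
    {N : ι → ModuleCat.{u} A} {f : ∀ i, N i ⟶ M} (h : JointlySurjective f)
    (hN : ∀ i, Subsingleton (N i)) : Subsingleton M := by
  have hle : AddSubgroup.closure (⋃ i, Set.range (f i).hom) ≤ ⊥ := by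
    rw [AddSubgroup.closure_le]
    rintro m hm
    obtain ⟨i, n, rfl⟩ := Set.mem_iUnion.1 hm
    have := hN i
    change (f i).hom n = 0
    rw [Subsingleton.elim n 0, map_zero]
  rw [h] at hle
  exact subsingleton_of_forall_eq 0 fun m => hle trivial

/-- The map induced on `Eⁿ ⊗_A M`. -/
def tensorIterMap {M N : ModuleCat.{u} A} (f : M ⟶ N) :
    (n : ℕ) → (tensorIter A E M n ⟶ tensorIter A E N n)
  | 0 => f
  | n + 1 => (BTensor.functor A A E).map (tensorIterMap f n)

theorem JointlySurjective.tensorIter {ι : Type*} {M : ModuleCat.{u} A}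
    {N : ι → ModuleCat.{u} A} {f : ∀ i, N i ⟶ M} (h : JointlySurjective f) (n : ℕ) :
    JointlySurjective (fun i => tensorIterMap (E := E) (f i) n) := by
  induction n with
  | zero => exact h
  | succ n ih => exact ih.tensor

/-- `tensorIter` adds new factors on the outside. Peeling off the factor next to the module instead
is what lets the final induction change the module at each step. -/
theorem tensorIter_succ_eq (M : ModuleCat.{u} A) (n : ℕ) :
    tensorIter A E M (n + 1) = tensorIter A E ((BTensor.functor A A E).obj M) n := by
  induction n with
  | zero => rfl
  | succ n ih => exact congrArg (BTensor.functor A A E).obj ih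

/-- The maps `A ⟶ M` given by the elements of `M` generate `M`, so `Eⁿ ⊗_A M` is generated by images
of `Eⁿ`. -/
theorem TensorNilpotent.locallyNilpotent (h : TensorNilpotent A E) : LocallyNilpotent A E := by
  obtain ⟨n, hn⟩ := h
  intro M
  refine ⟨n, ?_⟩
  have hM : JointlySurjective (fun m : M => (ModuleCat.ofHom (LinearMap.toSpanSingleton A M m) :
      ModuleCat.of A A ⟶ M)) :=
    eq_top_iff.2 fun m _ => AddSubgroup.subset_closure
      (Set.mem_iUnion.2 ⟨m, (1 : A), one_smul A m⟩)
  exact (hM.tensorIter n).subsingleton (fun _ => hn)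

theorem locallyNilpotent_iff : LocallyNilpotent A E ↔ TensorNilpotent A E :=
  ⟨fun h => h _, TensorNilpotent.locallyNilpotent⟩

end nilpotent
end

/-! ### Modules over `A[y]`, and the `A[y]`-module `E ⊗_A N`. -/

noncomputable section

section polyModule
variable {A : Type*} [Ring A]

/-- The `A[X]`-module structure on an `A`-module on which `X` acts by `y`. -/
abbrev polyModule {W : Type*} [AddCommGroup W] [Module A W] (y : W →ₗ[A] W) : Module A[X] W :=
  Module.compHom W (Polynomial.eval₂RingHom' (Module.toAddMonoidEnd A W) y.toAddMonoidHom
    (fun a => by ext m; exact (y.map_smul a m).symm))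

theorem polyModule_C_smul {W : Type*} [AddCommGroup W] [Module A W] (y : W →ₗ[A] W) (a : A)
    (w : W) : (letI := polyModule y; (C a : A[X]) • w) = a • w :=
  DFunLike.congr_fun (eval₂_C (Module.toAddMonoidEnd A W) y.toAddMonoidHom) w

theorem polyModule_X_smul {W : Type*} [AddCommGroup W] [Module A W] (y : W →ₗ[A] W)
    (w : W) : (letI := polyModule y; (X : A[X]) • w) = y w :=
  DFunLike.congr_fun (eval₂_X (Module.toAddMonoidEnd A W) y.toAddMonoidHom) w

theorem isScalarTower_of_C_smul {W : Type*} [AddCommGroup W] [Module A W] [Module A[X] W]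
    (h : ∀ (a : A) (w : W), (C a : A[X]) • w = a • w) : IsScalarTower A A[X] W where
  smul_assoc a p w := by rw [← h, ← mul_smul, ← smul_eq_C_mul]

theorem C_smul_eq {W : Type*} [AddCommGroup W] [Module A W] [Module A[X] W]
    [IsScalarTower A A[X] W] (a : A) (w : W) : (C a : A[X]) • w = a • w := by
  rw [← mul_one (C a), ← smul_eq_C_mul, smul_assoc, one_smul]

variable (A) in
/-- The action of `X`. -/
def yEnd (W : Type*) [AddCommGroup W] [Module A W] [Module A[X] W] [IsScalarTower A A[X] W] :
    W →ₗ[A] W where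
  toFun w := (X : A[X]) • w
  map_add' := smul_add _
  map_smul' a w := by
    rw [RingHom.id_apply, ← C_smul_eq (A := A), ← mul_smul, X_mul_C, mul_smul,
      C_smul_eq (A := A)]

/-- An `A`-linear map commuting with `X` is `A[X]`-linear. -/
def polyLinear {W W' : Type*} [AddCommGroup W] [Module A W] [Module A[X] W]
    [IsScalarTower A A[X] W] [AddCommGroup W'] [Module A W'] [Module A[X] W']
    [IsScalarTower A A[X] W'] (f : W →ₗ[A] W')
    (h : ∀ w, f ((X : A[X]) • w) = (X : A[X]) • f w) : W →ₗ[A[X]] W' where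
  toFun := f
  map_add' := map_add f
  map_smul' := polySMul f.toAddMonoidHom (fun a w => by
    simp only [C_smul_eq, LinearMap.toAddMonoidHom_coe, map_smul]) h

/-- An `A[X]`-linear map is `A`-linear. -/
def LinearMap.restrictC {W W' : Type*} [AddCommGroup W] [Module A W] [Module A[X] W]
    [IsScalarTower A A[X] W] [AddCommGroup W'] [Module A W'] [Module A[X] W']
    [IsScalarTower A A[X] W'] (f : W →ₗ[A[X]] W') : W →ₗ[A] W' where
  toFun := f
  map_add' := map_add f
  map_smul' a w := by rw [← C_smul_eq, map_smul, C_smul_eq]; rfl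

end polyModule

namespace BTensor

section poly
variable {A E N N' : Type*} [Ring A] [AddCommGroup E] [Module A E] [Module Aᵐᵒᵖ E]
  [SMulCommClass A Aᵐᵒᵖ E] [AddCommGroup N] [Module A N] [Module A[X] N] [IsScalarTower A A[X] N]
  [AddCommGroup N'] [Module A N'] [Module A[X] N'] [IsScalarTower A A[X] N']

/-- On `E ⊗_A N`, the variable acts through `N`. -/
instance : Module A[X] (BTensor A E N) := polyModule (lTensor A E (yEnd A N))

theorem X_smul (t : BTensor A E N) : (X : A[X]) • t = lTensor A E (yEnd A N) t :=
  polyModule_X_smul (lTensor A E (yEnd A N)) t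

theorem X_smul_tmul (e : E) (n : N) : (X : A[X]) • tmul A e n = tmul A e ((X : A[X]) • n) :=
  X_smul _

instance : IsScalarTower A A[X] (BTensor A E N) :=
  isScalarTower_of_C_smul fun a t => polyModule_C_smul (lTensor A E (yEnd A N)) a t

variable (E) in
/-- `E ⊗_A f` as an `A[X]`-linear map. -/
def lTensorX (f : N →ₗ[A[X]] N') : BTensor A E N →ₗ[A[X]] BTensor A E N' :=
  polyLinear (lTensor A E f.restrictC) (fun t => by
    rw [X_smul, X_smul]
    exact hom_eq ((lTensor A E f.restrictC).toAddMonoidHom.comp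
        (lTensor A E (yEnd A N)).toAddMonoidHom)
      ((lTensor A E (yEnd A N')).toAddMonoidHom.comp (lTensor A E f.restrictC).toAddMonoidHom)
      (fun e n => congrArg (tmul A e) (f.map_smul X n)) t)

@[simp]
theorem lTensorX_tmul (f : N →ₗ[A[X]] N') (e : E) (n : N) :
    lTensorX E f (tmul A e n) = tmul A e (f n) := rfl

variable (N) in
/-- `g ⊗_A N` as an `A[X]`-linear map, for a bimodule endomorphism `g`. -/
def rTensorX (g : BiHom A A E E) : BTensor A E N →ₗ[A[X]] BTensor A E N :=
  polyLinear (rTensor N g) (fun t => by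
    rw [X_smul, X_smul]
    exact hom_eq ((rTensor N g).toAddMonoidHom.comp (lTensor A E (yEnd A N)).toAddMonoidHom)
      ((lTensor A E (yEnd A N)).toAddMonoidHom.comp (rTensor N g).toAddMonoidHom)
      (fun e n => rfl) t)

@[simp]
theorem rTensorX_tmul (g : BiHom A A E E) (e : E) (n : N) :
    rTensorX N g (tmul A e n) = tmul A (g.left e) n := rfl

variable (N) in
/-- The action on `E ⊗_A (E ⊗_A N)` of a bimodule endomorphism of `E ⊗_A E`. -/
def twoTensor (g : BiHom A A (BTensor A E E) (BTensor A E E)) :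
    BTensor A E (BTensor A E N) →ₗ[A[X]] BTensor A E (BTensor A E N) :=
  polyLinear
    { assocHom.comp ((rTensor N g).toAddMonoidHom.comp assocInv) with
      map_smul' := fun a t => by
        have h1 := hom_eq (assocInv.comp
            (DistribSMul.toAddMonoidHom (BTensor A E (BTensor A E N)) a))
          ((DistribSMul.toAddMonoidHom (BTensor A (BTensor A E E) N) a).comp assocInv)
          (fun m u => by
            change assocInv (a • tmul A m u) = a • assocInv (tmul A m u)
            exact hom_eq ((assocInv (S := A) (T := A) (M := E) (N := E) (P := N)).comp
                (tmulHom A E (BTensor A E N) (a • m)))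
              ((DistribSMul.toAddMonoidHom (BTensor A (BTensor A E E) N) a).comp
                (assocInv.comp (tmulHom A E (BTensor A E N) m))) (fun _ _ => rfl) u) t
        have h2 : ∀ u : BTensor A (BTensor A E E) N, assocHom (a • u) = a • assocHom u :=
          hom_eq (assocHom.comp (DistribSMul.toAddMonoidHom _ a))
            ((DistribSMul.toAddMonoidHom _ a).comp assocHom) (fun u n =>
              hom_eq ((assocHom (S := A) (T := A) (M := E) (N := E) (P := N)).comp
                ((tmulHom A (BTensor A E E) N).flip n |>.comp (DistribSMul.toAddMonoidHom _ a)))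
              ((DistribSMul.toAddMonoidHom _ a).comp (assocHom.comp
                ((tmulHom A (BTensor A E E) N).flip n))) (fun _ _ => rfl) u)
        change assocHom (rTensor N g (assocInv (a • t))) = a • assocHom (rTensor N g (assocInv t))
        rw [← h2, ← map_smul]
        exact congrArg (fun z => assocHom (rTensor N g z)) h1 }
    (fun t => by
      rw [X_smul, X_smul]
      let φ := lTensor A E (yEnd A (BTensor A E N))
      let ψ := lTensor A (BTensor A E E) (yEnd A N)
      have h1 : assocInv (φ t) = ψ (assocInv t) :=
        hom_eq (assocInv.comp φ.toAddMonoidHom) (ψ.toAddMonoidHom.comp assocInv) (fun m u => by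
          change assocInv (tmul A m ((X : A[X]) • u)) = _
          rw [X_smul]
          exact hom_eq ((assocInv.comp (tmulHom A E _ m)).comp
              (lTensor A E (yEnd A N)).toAddMonoidHom)
            (ψ.toAddMonoidHom.comp (assocInv.comp (tmulHom A E _ m))) (fun _ _ => rfl) u) t
      have h2 : ∀ u, rTensor N g (ψ u) = ψ (rTensor N g u) :=
        hom_eq ((rTensor N g).toAddMonoidHom.comp ψ.toAddMonoidHom)
          (ψ.toAddMonoidHom.comp (rTensor N g).toAddMonoidHom) (fun _ _ => rfl)
      have h3 : ∀ u, assocHom (ψ u) = φ (assocHom u) :=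
        hom_eq (assocHom.comp ψ.toAddMonoidHom) (φ.toAddMonoidHom.comp assocHom) (fun u n =>
          hom_eq ((assocHom (S := A) (T := A) (M := E) (N := E) (P := N)).comp
              ((tmulHom A (BTensor A E E) N).flip ((X : A[X]) • n)))
            ((φ.toAddMonoidHom.comp assocHom).comp ((tmulHom A (BTensor A E E) N).flip n))
            (fun e e' => by
              change tmul A e (tmul A e' ((X : A[X]) • n)) =
                tmul A e ((X : A[X]) • tmul A e' n)
              rw [X_smul_tmul]) u)
      change assocHom (rTensor N g (assocInv (φ t))) = φ (assocHom (rTensor N g (assocInv t)))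
      rw [h1, h2, h3])

theorem twoTensor_apply (g : BiHom A A (BTensor A E E) (BTensor A E E))
    (t : BTensor A E (BTensor A E N)) :
    twoTensor N g t = assocHom (rTensor N g (assocInv t)) := rfl

theorem assocInv_assocHom (t : BTensor A (BTensor A E E) N) : assocInv (assocHom t) = t :=
  hom_eq (assocInv.comp assocHom) (AddMonoidHom.id _) (fun u n =>
    hom_eq ((assocInv.comp assocHom).comp ((tmulHom A (BTensor A E E) N).flip n))
      ((tmulHom A (BTensor A E E) N).flip n) (fun _ _ => rfl) u) t

theorem assocHom_assocInv (t : BTensor A E (BTensor A E N)) : assocHom (assocInv t) = t :=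
  hom_eq (assocHom.comp assocInv) (AddMonoidHom.id _) (fun m u =>
    hom_eq ((assocHom.comp assocInv).comp (tmulHom A E (BTensor A E N) m))
      (tmulHom A E (BTensor A E N) m) (fun _ _ => rfl) u) t

/-- The working form of `twoTensor`: on the elements `u ⊗ n` with `u` in `E ⊗_A E`, which determine
additive maps by `hom_eq_assoc`, identities in `End(E²)` transfer directly. -/
theorem twoTensor_assocHom (g : BiHom A A (BTensor A E E) (BTensor A E E))
    (u : BTensor A E E) (n : N) :
    twoTensor N g (assocHom (tmul A u n)) = assocHom (tmul A (g.left u) n) := by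
  rw [twoTensor_apply, assocInv_assocHom, rTensor_tmul]

/-- Two additive maps on `E ⊗_A (E ⊗_A N)` agree if they agree on the images of `u ⊗ n`. -/
theorem hom_eq_assoc {P : Type*} [AddCommGroup P] (f g : BTensor A E (BTensor A E N) →+ P)
    (h : ∀ (u : BTensor A E E) (n : N), f (assocHom (tmul A u n)) = g (assocHom (tmul A u n)))
    (t : BTensor A E (BTensor A E N)) : f t = g t := by
  rw [← assocHom_assocInv t]
  exact hom_eq (f.comp assocHom) (g.comp assocHom) h _

end poly
end BTensor
end

/-! ### `E_y ⊗_{A[y]} N` as the cokernel of `x - y` on `E ⊗_A N`. -/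

noncomputable section

section YModRestrict
variable {A M : Type*} [Ring A] [AddCommGroup M] [Module A M] [Module Aᵐᵒᵖ M]
  (y : BiHom A A M M)

instance YMod.moduleBase : Module A (YMod y) := inferInstanceAs (Module A M)

instance YMod.isScalarTower : IsScalarTower A A[X] (YMod y) :=
  isScalarTower_of_C_smul fun a m => YMod.C_smul y a m

instance YMod.smulCommClass_base [SMulCommClass A Aᵐᵒᵖ M] :
    SMulCommClass A (A[X])ᵐᵒᵖ (YMod y) where
  smul_comm a q m := by rw [← C_smul_eq (A := A), ← C_smul_eq (A := A), smul_comm]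

end YModRestrict

/-- The action of the central variable as an `A[X]`-linear map. -/
def yLin (A W : Type*) [Ring A] [AddCommGroup W] [Module A W] [Module A[X] W]
    [IsScalarTower A A[X] W] : W →ₗ[A[X]] W := polyLinear (yEnd A W) (fun _ => rfl)

namespace TwoRep
open BTensor (tmul add_tmul tmul_add zero_tmul tmul_zero op_smul_tmul smul_tmul' smul_tmul_right)
variable {A E : Type u} [Ring A] [AddCommGroup E] [Module A E] [Module Aᵐᵒᵖ E]
  [SMulCommClass A Aᵐᵒᵖ E] (V : TwoRep A E)

/-- The companion of `s_xE`, obtained from the expression `s_eq` in which `τ` is applied first: `s`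
interchanges the two copies of `x`. -/
theorem s_Ex (t : BTensor A E E) : V.s (V.Ex t) = V.xE (V.s t) := by
  have h1 := V.τ_Ex t
  rw [s_eq, s_eq, h1]
  simp only [map_add, map_sub, V.Ex_xE]
  abel

/-- Since `s` interchanges `xE` and `Ex`, it anticommutes with `Ex - xE`, and `τ ∘ s = -τ` because
`τ² = 0`. Substituting both into `s = τ ∘ (Ex - xE) - 1` gives the result. -/
theorem s_s (t : BTensor A E E) : V.s (V.s t) = t := by
  have h0 := V.τ_sq
  have h1 := V.Ex_τ (V.τ.left (V.xE t - V.Ex t))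
  have h2 := V.τ_Ex (V.τ.left (V.xE t - V.Ex t))
  rw [h0, map_zero] at h1 h2
  have h3 : V.τ.left (V.s (V.xE t - V.Ex t)) = -V.τ.left (V.xE t - V.Ex t) := by
    have h1' := add_eq_zero_iff_eq_neg.1 h1.symm
    rw [s_eq, map_add, map_sub, h2, h1', zero_add]
    abel
  have h4 : V.Ex (V.s t) - V.xE (V.s t) = V.s (V.xE t - V.Ex t) := by
    rw [map_sub, s_xE, s_Ex]
  rw [s_apply V (V.s t), h4, h3, s_apply, ← map_neg, neg_sub]
  abel

/-- `s` as a bimodule endomorphism. -/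
def sBi : BiHom A A (BTensor A E E) (BTensor A E E) :=
  { V.s with map_op_smul' := V.s_op }

variable (N N' : Type u) [AddCommGroup N] [Module A N] [Module A[X] N] [IsScalarTower A A[X] N]
  [AddCommGroup N'] [Module A N'] [Module A[X] N'] [IsScalarTower A A[X] N']

instance : IsScalarTower A A[X] (BTensor A[X] V.Ey N) :=
  isScalarTower_of_C_smul fun a t =>
    BTensor.hom_eq (DistribSMul.toAddMonoidHom (BTensor A[X] V.Ey N) (Polynomial.C a : A[X]))
      (DistribSMul.toAddMonoidHom (BTensor A[X] V.Ey N) a) (fun e n => by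
        change (Polynomial.C a : A[X]) • tmul A[X] e n = a • tmul A[X] e n
        rw [smul_tmul', smul_tmul', C_smul_eq (A := A)]) t

/-- The projection `E ⊗_A N → E_y ⊗_{A[y]} N` as an additive map. -/
def qHom : BTensor A E N →+ BTensor A[X] V.Ey N :=
  BTensor.lift ((BTensor.tmulHom A[X] V.Ey N).comp V.toEy.toAddMonoidHom) (fun a e n => by
    change tmul A[X] (V.toEy (op a • e)) n = tmul A[X] (V.toEy e) (a • n)
    rw [← YMod.op_C_smul, op_smul_tmul, C_smul_eq (A := A)])

/-- The projection `E ⊗_A N → E_y ⊗_{A[y]} N`. -/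
def q : BTensor A E N →ₗ[A[X]] BTensor A[X] V.Ey N :=
  polyLinear
    { V.qHom N with
      map_smul' := fun a t =>
        BTensor.hom_eq ((V.qHom N).comp (DistribSMul.toAddMonoidHom _ a))
          ((DistribSMul.toAddMonoidHom (BTensor A[X] V.Ey N) a).comp (V.qHom N))
          (fun e n => rfl) t }
    (fun t => by
      refine BTensor.hom_eq ((V.qHom N).comp (DistribSMul.toAddMonoidHom _ (X : A[X])))
          ((DistribSMul.toAddMonoidHom (BTensor A[X] V.Ey N) (X : A[X])).comp (V.qHom N))
          (fun e n => ?_) t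
      simp only [AddMonoidHom.comp_apply, DistribSMul.toAddMonoidHom_apply, BTensor.X_smul_tmul]
      change tmul A[X] (V.toEy e) ((X : A[X]) • n) = (X : A[X]) • tmul A[X] (V.toEy e) n
      rw [smul_tmul', YMod.X_smul, ← op_smul_tmul, YMod.op_X_smul])

@[simp]
theorem q_tmul (e : E) (n : N) : V.q N (tmul A e n) = tmul A[X] (V.toEy e) n := rfl

theorem q_surjective : Function.Surjective (V.q N) := fun t =>
  BTensor.addSubgroup_eq_top (V.q N).toAddMonoidHom.range
    (fun e n => ⟨tmul A (V.toEy.symm e) n, rfl⟩) t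

/-- The endomorphism `x ⊗ 1 - 1 ⊗ y` of `E ⊗_A N`. -/
def mu : BTensor A E N →ₗ[A[X]] BTensor A E N :=
  BTensor.rTensorX N V.x - yLin A (BTensor A E N)

theorem mu_apply (t : BTensor A E N) : V.mu N t = BTensor.rTensorX N V.x t - (X : A[X]) • t := rfl

theorem mu_tmul (e : E) (n : N) :
    V.mu N (tmul A e n) = tmul A (V.x.left e) n - tmul A e ((X : A[X]) • n) := by
  rw [mu_apply, BTensor.rTensorX_tmul, BTensor.X_smul_tmul]

theorem q_mu (t : BTensor A E N) : V.q N (V.mu N t) = 0 := by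
  refine BTensor.hom_eq ((V.q N).toAddMonoidHom.comp (V.mu N).toAddMonoidHom) 0 (fun e n => ?_) t
  simp only [AddMonoidHom.comp_apply, LinearMap.toAddMonoidHom_coe, mu_tmul, map_sub, q_tmul]
  rw [← op_smul_tmul, YMod.op_X_smul, sub_self]
  rfl

-- With `q_mu` and `q_surjective`, this makes `q` the cokernel of `mu`. A tensor over `A` is already
-- balanced for constants, and being balanced for `y` as well means exactly that the image of `mu`
-- is killed; so `E_y ⊗_{A[y]} N` maps back to the cokernel.
variable {N} in
theorem exists_mu_eq (t : BTensor A E N) (ht : V.q N t = 0) : ∃ t', V.mu N t' = t := by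
  let H : AddSubgroup (BTensor A E N) := (V.mu N).toAddMonoidHom.range
  let k : BTensor A[X] V.Ey N →+ BTensor A E N ⧸ H :=
    BTensor.lift (((AddMonoidHom.compHom (QuotientAddGroup.mk' H)).comp
        (BTensor.tmulHom A E N)).comp V.toEy.symm.toAddMonoidHom)
      (fun p e n => by
        induction p using Polynomial.induction_on generalizing e n with
        | C a =>
          obtain ⟨e, rfl⟩ := V.toEy.surjective e
          rw [YMod.op_C_smul, C_smul_eq (A := A)]
          exact congrArg (QuotientAddGroup.mk' H) (op_smul_tmul a e n)
        | add p p' hp hp' => rw [MulOpposite.op_add, add_smul, add_smul, map_add, map_add,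
            AddMonoidHom.add_apply, hp, hp']
        | monomial j a h =>
          have hX : ∀ (e : V.Ey) (n : N), (QuotientAddGroup.mk' H)
              (tmul A (V.toEy.symm (op (X : A[X]) • e)) n) =
              (QuotientAddGroup.mk' H) (tmul A (V.toEy.symm e) ((X : A[X]) • n)) := by
            intro e n
            obtain ⟨e, rfl⟩ := V.toEy.surjective e
            rw [YMod.op_X_smul]
            -- The failure of balance for `y` at `(e, n)` is `mu` of `e ⊗ n`.
            refine (QuotientAddGroup.eq_iff_sub_mem).2 ⟨tmul A e n, ?_⟩
            exact V.mu_tmul N e n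
          rw [pow_succ, ← mul_assoc, op_mul, mul_smul, mul_smul, ← h]
          exact hX _ _)
  have h := BTensor.hom_eq (k.comp (V.q N).toAddMonoidHom) (QuotientAddGroup.mk' H)
    (fun m n => rfl) t
  have h0 : (QuotientAddGroup.mk' H) t = 0 := by
    rw [← h, AddMonoidHom.comp_apply, LinearMap.toAddMonoidHom_coe, ht, map_zero]
  exact (QuotientAddGroup.eq_zero_iff t).1 h0
end TwoRep
end

/-! ### The action of `s` and `τ` on `E ⊗_A (E ⊗_A N)`, and its descent to `E_y`. -/

noncomputable section

/-- The map induced on the target of a surjective map. -/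
def LinearMap.descend {R M N P : Type*} [Ring R] [AddCommGroup M] [Module R M] [AddCommGroup N]
    [Module R N] [AddCommGroup P] [Module R P] (p : M →ₗ[R] N) (hp : Function.Surjective p)
    (g : M →ₗ[R] P) (h : ∀ m, p m = 0 → g m = 0) : N →ₗ[R] P :=
  ((LinearMap.ker p).liftQ g h).comp (p.quotKerEquivOfSurjective hp).symm.toLinearMap

@[simp]
theorem LinearMap.descend_apply {R M N P : Type*} [Ring R] [AddCommGroup M] [Module R M]
    [AddCommGroup N] [Module R N] [AddCommGroup P] [Module R P] (p : M →ₗ[R] N)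
    (hp : Function.Surjective p) (g : M →ₗ[R] P) (h : ∀ m, p m = 0 → g m = 0) (m : M) :
    p.descend hp g h (p m) = g m := by
  have : (p.quotKerEquivOfSurjective hp).symm (p m) = Submodule.Quotient.mk m := by
    rw [LinearEquiv.symm_apply_eq]; rfl
  change ((LinearMap.ker p).liftQ g h) ((p.quotKerEquivOfSurjective hp).symm (p m)) = g m
  rw [this]
  rfl

namespace TwoRep
open BTensor (tmul add_tmul tmul_add zero_tmul tmul_zero op_smul_tmul smul_tmul' smul_tmul_right
  assocHom twoTensor lTensorX hom_eq_assoc twoTensor_assocHom)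
variable {A E : Type u} [Ring A] [AddCommGroup E] [Module A E] [Module Aᵐᵒᵖ E]
  [SMulCommClass A Aᵐᵒᵖ E] (V : TwoRep A E)
variable (N N' : Type u) [AddCommGroup N] [Module A N] [Module A[X] N] [IsScalarTower A A[X] N]
  [AddCommGroup N'] [Module A N'] [Module A[X] N'] [IsScalarTower A A[X] N']

theorem X_smul_assocHom (u : BTensor A E E) (n : N) :
    (X : A[X]) • assocHom (tmul A u n) = assocHom (tmul A u ((X : A[X]) • n)) :=
  BTensor.hom_eq ((DistribSMul.toAddMonoidHom _ (X : A[X])).comp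
      ((assocHom (S := A) (T := A) (M := E) (N := E) (P := N)).comp
        ((BTensor.tmulHom A (BTensor A E E) N).flip n)))
    ((assocHom (S := A) (T := A) (M := E) (N := E) (P := N)).comp
        ((BTensor.tmulHom A (BTensor A E E) N).flip ((X : A[X]) • n)))
    (fun e e' => by
      change (X : A[X]) • tmul A e (tmul A e' n) = tmul A e (tmul A e' ((X : A[X]) • n))
      rw [BTensor.X_smul_tmul, BTensor.X_smul_tmul]) u

theorem mu_assocHom (u : BTensor A E E) (n : N) :
    V.mu (BTensor A E N) (assocHom (tmul A u n)) =
      assocHom (tmul A (V.xE u) n) - assocHom (tmul A u ((X : A[X]) • n)) := by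
  rw [mu_apply, X_smul_assocHom]
  congr 1
  exact BTensor.hom_eq ((BTensor.rTensorX (BTensor A E N) V.x).toAddMonoidHom.comp
      ((assocHom (S := A) (T := A) (M := E) (N := E) (P := N)).comp
        ((BTensor.tmulHom A (BTensor A E E) N).flip n)))
    (((assocHom (S := A) (T := A) (M := E) (N := E) (P := N)).comp
        ((BTensor.tmulHom A (BTensor A E E) N).flip n)).comp V.xE.toAddMonoidHom)
    (fun e e' => rfl) u

theorem lTensorX_mu_assocHom (u : BTensor A E E) (n : N) :
    lTensorX E (V.mu N) (assocHom (tmul A u n)) =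
      assocHom (tmul A (V.Ex u) n) - assocHom (tmul A u ((X : A[X]) • n)) :=
  BTensor.hom_eq ((lTensorX E (V.mu N)).toAddMonoidHom.comp
      ((assocHom (S := A) (T := A) (M := E) (N := E) (P := N)).comp
        ((BTensor.tmulHom A (BTensor A E E) N).flip n)))
    (((assocHom (S := A) (T := A) (M := E) (N := E) (P := N)).comp
        ((BTensor.tmulHom A (BTensor A E E) N).flip n)).comp V.Ex.toAddMonoidHom -
      (assocHom (S := A) (T := A) (M := E) (N := E) (P := N)).comp
        ((BTensor.tmulHom A (BTensor A E E) N).flip ((X : A[X]) • n)))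
    (fun e e' => by
      change tmul A e (V.mu N (tmul A e' n)) =
        tmul A e (tmul A (V.x.left e') n) - tmul A e (tmul A e' ((X : A[X]) • n))
      rw [mu_tmul]
      exact map_sub (BTensor.tmulHom A E (BTensor A E N) e) _ _) u

/-- The action of `s` on `E ⊗_A (E ⊗_A N)`. -/
abbrev sT : BTensor A E (BTensor A E N) →ₗ[A[X]] BTensor A E (BTensor A E N) :=
  twoTensor N V.sBi

/-- The action of `τ` on `E ⊗_A (E ⊗_A N)`. -/
abbrev τT : BTensor A E (BTensor A E N) →ₗ[A[X]] BTensor A E (BTensor A E N) :=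
  twoTensor N V.τ

variable {N N'}

theorem assocHom_sub_tmul (u v : BTensor A E E) (n : N) :
    (assocHom (tmul A (u - v) n) : BTensor A E (BTensor A E N)) =
      assocHom (tmul A u n) - assocHom (tmul A v n) :=
  map_sub ((assocHom (S := A) (T := A) (M := E) (N := E) (P := N)).comp
        ((BTensor.tmulHom A (BTensor A E E) N).flip n)) u v

theorem assocHom_add_tmul (u v : BTensor A E E) (n : N) :
    (assocHom (tmul A (u + v) n) : BTensor A E (BTensor A E N)) =
      assocHom (tmul A u n) + assocHom (tmul A v n) :=
  map_add ((assocHom (S := A) (T := A) (M := E) (N := E) (P := N)).comp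
        ((BTensor.tmulHom A (BTensor A E E) N).flip n)) u v

/-- `s` moves `x` from the outer to the inner factor and commutes with `y`, which acts on `N` alone.
So it turns `x - y` on the outer factor into `x - y` on the inner one; `mu_sT` is the reverse. -/
theorem sT_mu (t : BTensor A E (BTensor A E N)) :
    V.sT N (V.mu (BTensor A E N) t) = lTensorX E (V.mu N) (V.sT N t) :=
  hom_eq_assoc ((V.sT N).toAddMonoidHom.comp (V.mu (BTensor A E N)).toAddMonoidHom)
    ((lTensorX E (V.mu N)).toAddMonoidHom.comp (V.sT N).toAddMonoidHom) (fun u n => by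
      simp only [AddMonoidHom.comp_apply, LinearMap.toAddMonoidHom_coe, mu_assocHom, map_sub,
        twoTensor_assocHom, lTensorX_mu_assocHom]
      exact congrArg (fun v => assocHom (tmul A v n) - _) (V.s_xE u)) t

theorem mu_sT (t : BTensor A E (BTensor A E N)) :
    V.mu (BTensor A E N) (V.sT N t) = V.sT N (lTensorX E (V.mu N) t) :=
  hom_eq_assoc ((V.mu (BTensor A E N)).toAddMonoidHom.comp (V.sT N).toAddMonoidHom)
    ((V.sT N).toAddMonoidHom.comp (lTensorX E (V.mu N)).toAddMonoidHom) (fun u n => by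
      simp only [AddMonoidHom.comp_apply, LinearMap.toAddMonoidHom_coe, mu_assocHom, map_sub,
        twoTensor_assocHom, lTensorX_mu_assocHom]
      exact congrArg (fun v => assocHom (tmul A v n) - _) (V.s_Ex u).symm) t

theorem sT_sT (t : BTensor A E (BTensor A E N)) : V.sT N (V.sT N t) = t :=
  hom_eq_assoc ((V.sT N).toAddMonoidHom.comp (V.sT N).toAddMonoidHom) (AddMonoidHom.id _)
    (fun u n => by
      simp only [AddMonoidHom.comp_apply, LinearMap.toAddMonoidHom_coe, twoTensor_assocHom]
      exact congrArg (fun v => assocHom (tmul A v n)) (V.s_s u)) t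

theorem τT_τT (t : BTensor A E (BTensor A E N)) : V.τT N (V.τT N t) = 0 :=
  hom_eq_assoc ((V.τT N).toAddMonoidHom.comp (V.τT N).toAddMonoidHom) 0
    (fun u n => by
      simp only [AddMonoidHom.comp_apply, LinearMap.toAddMonoidHom_coe, twoTensor_assocHom,
        V.τ_sq, zero_tmul, map_zero, AddMonoidHom.zero_apply]) t

/-- The two occurrences of `y` cancel, and what remains is `s = 1 + (xE - Ex) ∘ τ`. -/
theorem sT_eq (t : BTensor A E (BTensor A E N)) :
    V.sT N t = t + V.mu (BTensor A E N) (V.τT N t) - lTensorX E (V.mu N) (V.τT N t) :=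
  hom_eq_assoc (V.sT N).toAddMonoidHom
    (AddMonoidHom.id (BTensor A E (BTensor A E N)) + (V.mu (BTensor A E N)).toAddMonoidHom.comp (V.τT N).toAddMonoidHom -
      (lTensorX E (V.mu N)).toAddMonoidHom.comp (V.τT N).toAddMonoidHom)
    (fun u n => by
      simp only [AddMonoidHom.comp_apply, LinearMap.toAddMonoidHom_coe, AddMonoidHom.sub_apply,
        AddMonoidHom.add_apply, AddMonoidHom.id_apply, twoTensor_assocHom, mu_assocHom,
        lTensorX_mu_assocHom]
      have : V.sBi.left u = V.xE (V.τ.left u) - V.Ex (V.τ.left u) + u := V.s_eq u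
      rw [this, assocHom_add_tmul, assocHom_sub_tmul]
      abel) t

theorem mu_naturality (f : N →ₗ[A[X]] N') (t : BTensor A E N) :
    V.mu N' (lTensorX E f t) = lTensorX E f (V.mu N t) :=
  BTensor.hom_eq ((V.mu N').toAddMonoidHom.comp (lTensorX E f).toAddMonoidHom)
    ((lTensorX E f).toAddMonoidHom.comp (V.mu N).toAddMonoidHom) (fun e n => by
      simp only [AddMonoidHom.comp_apply, LinearMap.toAddMonoidHom_coe,
        BTensor.lTensorX_tmul, mu_tmul, map_sub, map_smul]) t

theorem q_naturality (f : N →ₗ[A[X]] N') (t : BTensor A E N) :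
    V.q N' (lTensorX E f t) = BTensor.lTensor A[X] V.Ey f (V.q N t) :=
  BTensor.hom_eq ((V.q N').toAddMonoidHom.comp (lTensorX E f).toAddMonoidHom)
    ((BTensor.lTensor A[X] V.Ey f).toAddMonoidHom.comp (V.q N).toAddMonoidHom)
    (fun e n => rfl) t

theorem lTensorX_q_mu (t : BTensor A E (BTensor A E N)) :
    lTensorX E (V.q N) (lTensorX E (V.mu N) t) = 0 :=
  BTensor.hom_eq ((lTensorX E (V.q N)).toAddMonoidHom.comp
      (lTensorX E (V.mu N)).toAddMonoidHom) 0 (fun e n => by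
        change tmul A e (V.q N (V.mu N n)) = 0
        rw [q_mu, tmul_zero]) t

/-- Right exactness of `E ⊗_A -` is enough here, since only a cokernel is being tensored. -/
theorem exists_lTensorX_mu_eq (t : BTensor A E (BTensor A E N))
    (ht : lTensorX E (V.q N) t = 0) : ∃ t', lTensorX E (V.mu N) t' = t :=
  BTensor.lTensor_exact (R := A) (f := (V.mu N).restrictC) (g := (V.q N).restrictC)
    (V.q_surjective N) (V.q_mu N) (fun n hn => V.exists_mu_eq n hn) t ht

theorem lTensorX_q_surjective : Function.Surjective (lTensorX E (V.q N)) :=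
  BTensor.lTensor_surjective (R := A) (g := (V.q N).restrictC) (V.q_surjective N)

/-- The kernel of `q` is the image of `x - y` on the outer factor; `s` moves this to the inner
factor, where `E ⊗ q` kills it. Hence `s` descends to `sQ`. -/
theorem lTensorX_q_sT (t : BTensor A E (BTensor A E N)) (ht : V.q (BTensor A E N) t = 0) :
    lTensorX E (V.q N) (V.sT N t) = 0 := by
  obtain ⟨t, rfl⟩ := V.exists_mu_eq t ht
  rw [sT_mu, lTensorX_q_mu]

variable (N) in
/-- The map `E_y ⊗_{A[y]} (E ⊗_A N) → E ⊗_A (E_y ⊗_{A[y]} N)` induced by `s`. -/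
def sQ : BTensor A[X] V.Ey (BTensor A E N) →ₗ[A[X]] BTensor A E (BTensor A[X] V.Ey N) :=
  (V.q (BTensor A E N)).descend (V.q_surjective _) ((lTensorX E (V.q N)).comp (V.sT N))
    V.lTensorX_q_sT

theorem sQ_q (t : BTensor A E (BTensor A E N)) :
    V.sQ N (V.q (BTensor A E N) t) = lTensorX E (V.q N) (V.sT N t) :=
  LinearMap.descend_apply _ _ _ _ t

/-- If `E ⊗ q` kills `s t`, then `s t = (E ⊗ mu) t'`. Applying `s` once more gives `t = mu (s t')`,
which `q` kills. -/
theorem sQ_injective : Function.Injective (V.sQ N) := by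
  rw [injective_iff_map_eq_zero]
  intro w hw
  obtain ⟨t, rfl⟩ := V.q_surjective _ w
  rw [sQ_q] at hw
  obtain ⟨t', ht'⟩ := V.exists_lTensorX_mu_eq _ hw
  rw [← V.sT_sT t, ← ht', ← mu_sT, q_mu]

theorem sQ_surjective : Function.Surjective (V.sQ N) := fun w => by
  obtain ⟨t, rfl⟩ := V.lTensorX_q_surjective w
  exact ⟨V.q _ (V.sT N t), by rw [sQ_q, sT_sT]⟩

theorem sQ_mu (w : BTensor A[X] V.Ey (BTensor A E N)) :
    V.sQ N (BTensor.lTensor A[X] V.Ey (V.mu N) w) = V.mu _ (V.sQ N w) := by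
  obtain ⟨t, rfl⟩ := V.q_surjective _ w
  rw [← q_naturality, sQ_q, sQ_q, mu_naturality, mu_sT]

/-- Once both factors are projected to `E_y`, the two terms of `sT_eq` containing `τ` vanish and `s`
becomes the identity. -/
theorem q_sQ (w : BTensor A[X] V.Ey (BTensor A E N)) :
    V.q _ (V.sQ N w) = BTensor.lTensor A[X] V.Ey (V.q N) w := by
  obtain ⟨t, rfl⟩ := V.q_surjective _ w
  rw [sQ_q, sT_eq, map_sub, map_add, lTensorX_q_mu, sub_zero, map_add, ← mu_naturality, q_mu,
    add_zero, q_naturality]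

variable (N) in
/-- The idempotent `1 + (x ⊗ 1 ⊗ 1 - 1 ⊗ 1 ⊗ y) τ` of `E ⊗_A (E ⊗_A N)`. -/
def aT : BTensor A E (BTensor A E N) →ₗ[A[X]] BTensor A E (BTensor A E N) :=
  LinearMap.id + (V.mu (BTensor A E N)).comp (V.τT N)

theorem aT_apply (t : BTensor A E (BTensor A E N)) :
    V.aT N t = t + V.mu (BTensor A E N) (V.τT N t) := rfl

/-- This is `τ² = 0`; it supplies hypothesis `h₅` of `exists_factor`. -/
theorem aT_τT (t : BTensor A E (BTensor A E N)) : V.aT N (V.τT N t) = V.τT N t := by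
  rw [aT_apply, τT_τT, map_zero, add_zero]

/-- The maps `a` and `s` differ by `(E ⊗ mu) ∘ τ`, which `E ⊗ q` kills. With `q_aT`, where the
killed term is `mu ∘ τ`, this says that `a` is the degree `0` part of a chain map whose degree `1`
part is `(σ, 1)`. -/
theorem lTensorX_q_aT (t : BTensor A E (BTensor A E N)) :
    lTensorX E (V.q N) (V.aT N t) = V.sQ N (V.q _ t) := by
  rw [sQ_q, sT_eq, map_sub, lTensorX_q_mu, sub_zero, aT_apply]

theorem q_aT (t : BTensor A E (BTensor A E N)) : V.q _ (V.aT N t) = V.q _ t := by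
  rw [aT_apply, map_add, q_mu, add_zero]

end TwoRep
end

/-! ### Comparison of `E[y] ⊗_{A[y]} N` with `E ⊗_A N`, and column vectors over `B`. -/

noncomputable section

/-- A biadditive map is `A[X]`-balanced if it is so for constants and for `X`. -/
theorem balanced_of_C_X {A M N P : Type*} [Ring A] [AddCommGroup M] [Module (A[X])ᵐᵒᵖ M]
    [AddCommGroup N] [Module A[X] N] [AddCommGroup P] (f : M →+ N →+ P)
    (hC : ∀ (a : A) m n, f (op (C a : A[X]) • m) n = f m ((C a : A[X]) • n))
    (hX : ∀ m n, f (op (X : A[X]) • m) n = f m ((X : A[X]) • n)) (p : A[X]) (m : M) (n : N) :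
    f (op p • m) n = f m (p • n) := by
  induction p using Polynomial.induction_on generalizing m n with
  | C a => exact hC a m n
  | add p p' hp hp' =>
    rw [MulOpposite.op_add, add_smul, add_smul, map_add, map_add, AddMonoidHom.add_apply, hp, hp']
  | monomial j a h => rw [pow_succ, ← mul_assoc, op_mul, mul_smul, mul_smul, hX, h]

namespace TwoRep
open BTensor (tmul add_tmul tmul_add zero_tmul tmul_zero op_smul_tmul smul_tmul' smul_tmul_right
  assocHom twoTensor lTensorX hom_eq_assoc twoTensor_assocHom)
variable {A E : Type u} [Ring A] [AddCommGroup E] [Module A E] [Module Aᵐᵒᵖ E]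
  [SMulCommClass A Aᵐᵒᵖ E] (V : TwoRep A E)

section eps
variable (N : Type u) [AddCommGroup N] [Module A N] [Module A[X] N] [IsScalarTower A A[X] N]

theorem X_pow_smul_tmul (n : ℕ) (e : E) (m : N) :
    ((X : A[X]) ^ n) • tmul A e m = tmul A e (((X : A[X]) ^ n) • m) := by
  induction n generalizing m with
  | zero => rw [pow_zero, one_smul, one_smul]
  | succ n ih => rw [pow_succ, mul_smul, BTensor.X_smul_tmul, ih, mul_smul]

/-- The pairing `(e yⁿ, m) ↦ e ⊗ yⁿ m`. -/
def epsPair : EPoly A E →+ N →+ BTensor A E N :=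
  Finsupp.liftAddHom (fun n : ℕ => AddMonoidHom.mk'
    (fun e => (BTensor.tmulHom A E N e).comp (DistribSMul.toAddMonoidHom N ((X : A[X]) ^ n)))
    (fun e e' => by ext m; exact add_tmul e e' _))

theorem epsPair_monomial (n : ℕ) (e : E) (m : N) :
    epsPair (A := A) N (EPoly.monomial n e) m = tmul A e (((X : A[X]) ^ n) • m) :=
  DFunLike.congr_fun (Finsupp.liftAddHom_apply_single (fun n : ℕ => AddMonoidHom.mk'
    (fun e => (BTensor.tmulHom A E N e).comp (DistribSMul.toAddMonoidHom N ((X : A[X]) ^ n)))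
    (fun e e' => by ext m; exact add_tmul e e' _)) n e) m

theorem epsPair_balanced (p : A[X]) (f : EPoly A E) (m : N) :
    epsPair (A := A) N (op p • f) m = epsPair N f (p • m) := by
  refine balanced_of_C_X (epsPair N) (fun a f m => ?_) (fun f m => ?_) p f m
  · refine EPoly.hom_eq (((epsPair N).flip m).comp
      (DistribSMul.toAddMonoidHom (EPoly A E) (op (Polynomial.C a))))
      ((epsPair N).flip ((Polynomial.C a : A[X]) • m)) (fun n e => ?_) f
    simp only [AddMonoidHom.comp_apply, DistribSMul.toAddMonoidHom_apply, AddMonoidHom.flip_apply,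
      EPoly.op_C_smul, epsPair_monomial]
    rw [op_smul_tmul, ← C_smul_eq (A := A), ← mul_smul, ← mul_smul, X_pow_mul_C]
  · refine EPoly.hom_eq (((epsPair N).flip m).comp
      (DistribSMul.toAddMonoidHom (EPoly A E) (op (X : A[X]))))
      ((epsPair N).flip ((X : A[X]) • m)) (fun n e => ?_) f
    simp only [AddMonoidHom.comp_apply, DistribSMul.toAddMonoidHom_apply, AddMonoidHom.flip_apply,
      EPoly.op_X_smul, epsPair_monomial]
    rw [← mul_smul, ← pow_succ]

/-- The canonical map `E[y] ⊗_{A[y]} N → E ⊗_A N`. -/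
def eps : BTensor A[X] (EPoly A E) N →ₗ[A[X]] BTensor A E N where
  toFun := BTensor.lift (epsPair N) (epsPair_balanced N)
  map_add' := map_add _
  map_smul' := polySMul (BTensor.lift (epsPair N) (epsPair_balanced N))
    (fun a => BTensor.hom_eq ((BTensor.lift (epsPair N) (epsPair_balanced N)).comp
        (DistribSMul.toAddMonoidHom _ (Polynomial.C a : A[X])))
      ((DistribSMul.toAddMonoidHom _ (Polynomial.C a : A[X])).comp
        (BTensor.lift (epsPair N) (epsPair_balanced N)))
      (fun f m => EPoly.hom_eq (((epsPair N).flip m).comp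
          (DistribSMul.toAddMonoidHom (EPoly A E) (Polynomial.C a : A[X])))
        ((DistribSMul.toAddMonoidHom _ (Polynomial.C a : A[X])).comp ((epsPair N).flip m))
        (fun n e => by
          simp only [AddMonoidHom.comp_apply, DistribSMul.toAddMonoidHom_apply,
            AddMonoidHom.flip_apply, EPoly.C_smul, epsPair_monomial]
          rw [C_smul_eq (A := A), smul_tmul']) f))
    (BTensor.hom_eq ((BTensor.lift (epsPair N) (epsPair_balanced N)).comp
        (DistribSMul.toAddMonoidHom _ (X : A[X])))
      ((DistribSMul.toAddMonoidHom _ (X : A[X])).comp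
        (BTensor.lift (epsPair N) (epsPair_balanced N)))
      (fun f m => EPoly.hom_eq (((epsPair N).flip m).comp
          (DistribSMul.toAddMonoidHom (EPoly A E) (X : A[X])))
        ((DistribSMul.toAddMonoidHom _ (X : A[X])).comp ((epsPair N).flip m))
        (fun n e => by
          simp only [AddMonoidHom.comp_apply, DistribSMul.toAddMonoidHom_apply,
            AddMonoidHom.flip_apply, EPoly.X_smul, epsPair_monomial]
          rw [BTensor.X_smul_tmul, ← mul_smul, ← pow_succ']) f))

variable {N}

theorem eps_monomial_tmul (n : ℕ) (e : E) (m : N) :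
    eps N (tmul A[X] (EPoly.monomial n e) m) = tmul A e (((X : A[X]) ^ n) • m) :=
  epsPair_monomial N n e m

/-- Two additive maps on `E[y] ⊗_{A[y]} N` agree if they agree on the elements `e ⊗ m`. -/
theorem hom_eq_EPoly {P : Type*} [AddCommGroup P] (f g : BTensor A[X] (EPoly A E) N →+ P)
    (h : ∀ (e : E) (m : N), f (tmul A[X] (EPoly.monomial 0 e) m) =
      g (tmul A[X] (EPoly.monomial 0 e) m)) (t : BTensor A[X] (EPoly A E) N) : f t = g t := by
  refine BTensor.hom_eq f g (fun p m => ?_) t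
  refine EPoly.hom_eq (f.comp ((BTensor.tmulHom A[X] (EPoly A E) N).flip m))
    (g.comp ((BTensor.tmulHom A[X] (EPoly A E) N).flip m)) (fun n e => ?_) p
  have hn : EPoly.monomial n e = op ((X : A[X]) ^ n) • EPoly.monomial (A := A) 0 e := by
    induction n with
    | zero => rw [pow_zero, op_one, one_smul]
    | succ n ih => rw [pow_succ, op_mul, mul_smul, ← EPoly.op_X_smul, ih]
  change f (tmul A[X] (EPoly.monomial n e) m) = g (tmul A[X] (EPoly.monomial n e) m)
  rw [hn, op_smul_tmul]
  exact h e _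

theorem eps_naturality {N' : Type u} [AddCommGroup N'] [Module A N'] [Module A[X] N']
    [IsScalarTower A A[X] N'] (f : N →ₗ[A[X]] N') (t : BTensor A[X] (EPoly A E) N) :
    eps N' (BTensor.lTensor A[X] (EPoly A E) f t) = lTensorX E f (eps N t) :=
  hom_eq_EPoly ((eps N').toAddMonoidHom.comp
      (BTensor.lTensor A[X] (EPoly A E) f).toAddMonoidHom)
    ((lTensorX E f).toAddMonoidHom.comp (eps N).toAddMonoidHom) (fun e m => by
      simp only [AddMonoidHom.comp_apply, LinearMap.toAddMonoidHom_coe, BTensor.lTensor_tmul,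
        eps_monomial_tmul, BTensor.lTensorX_tmul, pow_zero, one_smul]) t

/-- This is why the differential of `E'` acts on column vectors through `q`. -/
theorem q_eps (t : BTensor A[X] (EPoly A E) N) :
    V.q N (eps N t) = BTensor.rTensor N V.π t :=
  hom_eq_EPoly ((V.q N).toAddMonoidHom.comp (eps N).toAddMonoidHom)
    (BTensor.rTensor N V.π).toAddMonoidHom (fun e m => by
      simp only [AddMonoidHom.comp_apply, LinearMap.toAddMonoidHom_coe, eps_monomial_tmul,
        pow_zero, one_smul, q_tmul, BTensor.rTensor_tmul]
      exact congrArg (fun z => tmul A[X] z m) (V.piHom_monomial 0 e).symm) t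

end eps

section tri
variable {N₁ N₂ : Type u} [AddCommGroup N₁] [Module A N₁] [Module A[X] N₁]
  [IsScalarTower A A[X] N₁] [AddCommGroup N₂] [Module A N₂] [Module A[X] N₂]
  [IsScalarTower A A[X] N₂] (ψ : BTensor A[X] V.Ey N₂ →ₗ[A[X]] N₁)

variable {V} in
/-- The `B`-module of column vectors `(n₁; n₂)`, on which `E_y` acts through `ψ`. -/
def Tri (_ : BTensor A[X] V.Ey N₂ →ₗ[A[X]] N₁) : Type u := N₁ × N₂

instance : AddCommGroup (Tri ψ) := inferInstanceAs (AddCommGroup (N₁ × N₂))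

instance : Module V.B (Tri ψ) where
  smul b n := (b.1 • n.1 + ψ (tmul A[X] b.2.1 n.2), b.2.2 • n.2)
  one_smul n := by
    refine Prod.ext ?_ (one_smul _ _)
    change (1 : A[X]) • n.1 + ψ (tmul A[X] (0 : V.Ey) n.2) = n.1
    rw [one_smul, zero_tmul, map_zero, add_zero]
  mul_smul b c n := by
    refine Prod.ext ?_ (mul_smul _ _ _)
    change (b.1 * c.1) • n.1 + ψ (tmul A[X] (b.1 • c.2.1 + op c.2.2 • b.2.1) n.2) =
      b.1 • (c.1 • n.1 + ψ (tmul A[X] c.2.1 n.2)) + ψ (tmul A[X] b.2.1 (c.2.2 • n.2))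
    rw [mul_smul, smul_add, add_tmul, map_add, op_smul_tmul, ← smul_tmul', map_smul, add_assoc]
  smul_zero b := by
    refine Prod.ext ?_ (smul_zero _)
    change b.1 • (0 : N₁) + ψ (tmul A[X] b.2.1 (0 : N₂)) = 0
    rw [smul_zero, tmul_zero, map_zero, add_zero]
  smul_add b m n := by
    refine Prod.ext ?_ (smul_add _ _ _)
    change b.1 • (m.1 + n.1) + ψ (tmul A[X] b.2.1 (m.2 + n.2)) =
      (b.1 • m.1 + ψ (tmul A[X] b.2.1 m.2)) + (b.1 • n.1 + ψ (tmul A[X] b.2.1 n.2))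
    rw [smul_add, tmul_add, map_add]; abel
  add_smul b c n := by
    refine Prod.ext ?_ (add_smul _ _ _)
    change (b.1 + c.1) • n.1 + ψ (tmul A[X] (b.2.1 + c.2.1) n.2) =
      (b.1 • n.1 + ψ (tmul A[X] b.2.1 n.2)) + (c.1 • n.1 + ψ (tmul A[X] c.2.1 n.2))
    rw [add_smul, add_tmul, map_add]; abel
  zero_smul n := by
    refine Prod.ext ?_ (zero_smul _ _)
    change (0 : A[X]) • n.1 + ψ (tmul A[X] (0 : V.Ey) n.2) = 0
    rw [zero_smul, zero_tmul, map_zero, add_zero]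

variable {V ψ} in
/-- The map of `B`-modules given by its components. -/
def Tri.map {N₁' N₂' : Type u} [AddCommGroup N₁'] [Module A N₁'] [Module A[X] N₁']
    [IsScalarTower A A[X] N₁'] [AddCommGroup N₂'] [Module A N₂'] [Module A[X] N₂']
    [IsScalarTower A A[X] N₂'] {ψ' : BTensor A[X] V.Ey N₂' →ₗ[A[X]] N₁'}
    (g₁ : N₁ →ₗ[A[X]] N₁') (g₂ : N₂ →ₗ[A[X]] N₂')
    (h : ∀ t, g₁ (ψ t) = ψ' (BTensor.lTensor A[X] V.Ey g₂ t)) : Tri ψ →ₗ[V.B] Tri ψ' where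
  toFun n := (g₁ n.1, g₂ n.2)
  map_add' m n := Prod.ext (map_add g₁ _ _) (map_add g₂ _ _)
  map_smul' b n := by
    refine Prod.ext ?_ (map_smul g₂ _ _)
    change g₁ (b.1 • n.1 + ψ (tmul A[X] b.2.1 n.2)) =
      b.1 • g₁ n.1 + ψ' (tmul A[X] b.2.1 (g₂ n.2))
    rw [map_add, map_smul, h, BTensor.lTensor_tmul]

end tri
end TwoRep
end

/-! ### The functor `E'⁰ ⊗_B -` on column vectors. -/

noncomputable section

namespace TwoRep
open BTensor (tmul add_tmul tmul_add zero_tmul tmul_zero op_smul_tmul smul_tmul' smul_tmul_right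
  assocHom twoTensor lTensorX hom_eq_assoc twoTensor_assocHom)
variable {A E : Type u} [Ring A] [AddCommGroup E] [Module A E] [Module Aᵐᵒᵖ E]
  [SMulCommClass A Aᵐᵒᵖ E] (V : TwoRep A E)
variable {N₁ N₂ : Type u} [AddCommGroup N₁] [Module A N₁] [Module A[X] N₁]
  [IsScalarTower A A[X] N₁] [AddCommGroup N₂] [Module A N₂] [Module A[X] N₂]
  [IsScalarTower A A[X] N₂] (ψ : BTensor A[X] V.Ey N₂ →ₗ[A[X]] N₁)

/-- The matrix in `E'⁰` with the given entries. -/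
def mk0 (p : EPoly A E) (t : V.EEy) (q : EPoly A E) : V.E0 := (p, t, q)

variable {V} in
/-- The column vector with the given entries. -/
def Tri.mk (n₁ : N₁) (n₂ : N₂) : Tri ψ := (n₁, n₂)

/-- The structure map of `E'⁰ ⊗_B (N₁; N₂) = (E ⊗_A N₁; E ⊗_A N₂)`. -/
def ψF : BTensor A[X] V.Ey (BTensor A E N₂) →ₗ[A[X]] BTensor A E N₁ :=
  (lTensorX E ψ).comp (V.sQ N₂)

theorem ψF_apply (w : BTensor A[X] V.Ey (BTensor A E N₂)) :
    V.ψF ψ w = lTensorX E ψ (V.sQ N₂ w) := rfl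

/-- The pairing of `E[y] ⊗ E_y` with `N₂`. -/
def kappa : V.EEy →+ N₂ →+ BTensor A E N₁ :=
  AddMonoidHom.mk' (fun t => ((eps N₁).toAddMonoidHom.comp
    ((BTensor.lTensor A[X] (EPoly A E) ψ).toAddMonoidHom.comp assocHom)).comp
      (BTensor.tmulHom A[X] V.EEy N₂ t)) (fun t t' => by
    ext n
    change eps N₁ (BTensor.lTensor A[X] (EPoly A E) ψ (assocHom (tmul A[X] (t + t') n))) = _
    rw [add_tmul, map_add, map_add, map_add]; rfl)

theorem kappa_tmul (p : EPoly A E) (e : V.Ey) (n : N₂) :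
    V.kappa ψ (tmul A[X] p e) n = eps N₁ (tmul A[X] p (ψ (tmul A[X] e n))) := rfl

theorem kappa_op (a : A[X]) (t : V.EEy) (n : N₂) :
    V.kappa ψ (op a • t) n = V.kappa ψ t (a • n) := by
  change eps N₁ (BTensor.lTensor A[X] (EPoly A E) ψ (assocHom (tmul A[X] (op a • t) n))) =
    eps N₁ (BTensor.lTensor A[X] (EPoly A E) ψ (assocHom (tmul A[X] t (a • n))))
  rw [op_smul_tmul]

theorem kappa_smul (a : A[X]) (t : V.EEy) (n : N₂) :
    V.kappa ψ (a • t) n = a • V.kappa ψ t n :=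
  BTensor.hom_eq (((V.kappa ψ).flip n).comp (DistribSMul.toAddMonoidHom V.EEy a))
    ((DistribSMul.toAddMonoidHom (BTensor A E N₁) a).comp ((V.kappa ψ).flip n)) (fun p e => by
      change V.kappa ψ (tmul A[X] (a • p) e) n = a • V.kappa ψ (tmul A[X] p e) n
      rw [kappa_tmul, kappa_tmul, ← smul_tmul', map_smul]) t

theorem kappa_ι (u : BTensor A E E) (n : N₂) :
    V.kappa ψ (V.ι u) n = lTensorX E ψ (lTensorX E (V.q N₂) (assocHom (tmul A u n))) :=
  BTensor.hom_eq (((V.kappa ψ).flip n).comp V.ι)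
    (((lTensorX E ψ).toAddMonoidHom.comp ((lTensorX E (V.q N₂)).toAddMonoidHom.comp
      (assocHom (S := A) (T := A) (M := E) (N := E) (P := N₂)))).comp
        ((BTensor.tmulHom A (BTensor A E E) N₂).flip n)) (fun e e' => by
      change V.kappa ψ (V.ι (tmul A e e')) n = tmul A e (ψ (tmul A[X] (V.toEy e') n))
      rw [ι_tmul, kappa_tmul, eps_monomial_tmul, pow_zero, one_smul]) u

/-- The compatibility that makes `E0TriHom` linear for the part `E_y` of `B`: on `E'⁰` that part
acts through `sY`, on the target through `ψF`, and both are induced by `s`. -/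
theorem kappa_sY (e : V.Ey) (p : EPoly A E) (n : N₂) :
    V.kappa ψ (V.sY (tmul A[X] e p)) n = V.ψF ψ (tmul A[X] e (eps N₂ (tmul A[X] p n))) := by
  obtain ⟨e, rfl⟩ := V.toEy.surjective e
  refine EPoly.hom_eq (((V.kappa ψ).flip n).comp (V.sPair (V.toEy e)))
    ((V.ψF ψ).toAddMonoidHom.comp ((BTensor.tmulHom A[X] V.Ey _ (V.toEy e)).comp
      ((eps N₂).toAddMonoidHom.comp ((BTensor.tmulHom A[X] (EPoly A E) N₂).flip n))))
    (fun j f => ?_) p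
  change V.kappa ψ (V.sPair (V.toEy e) (EPoly.monomial j f)) n =
    V.ψF ψ (tmul A[X] (V.toEy e) (eps N₂ (tmul A[X] (EPoly.monomial j f) n)))
  have hx : ∀ (e : E), op ((X : A[X]) ^ j) • V.toEy e = V.toEy ((V.x.left ^ j) e) := by
    induction j with
    | zero => intro e; rw [pow_zero, op_one, one_smul]; rfl
    | succ j ih => intro e; rw [pow_succ', op_mul, mul_smul, YMod.op_X_smul, ih, pow_succ]; rfl
  -- The power `yʲ` attached to `f` acts centrally, so it can be moved across to `e`, where it acts
  -- by `xʲ` as in `sPair`.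
  rw [sPair_apply, kappa_ι, eps_monomial_tmul, ← X_pow_smul_tmul, ← op_smul_tmul, hx, ψF_apply]
  have : tmul A[X] (V.toEy ((V.x.left ^ j) e)) (tmul A f n) =
    V.q _ (assocHom (tmul A (tmul A ((V.x.left ^ j) e) f) n)) := rfl
  rw [this, sQ_q, twoTensor_assocHom]
  rfl

/-- The pairing of `E'⁰` with `(N₁; N₂)`. -/
def E0Pair : V.E0 →+ Tri ψ →+ Tri (V.ψF ψ) :=
  AddMonoidHom.mk' (fun m => AddMonoidHom.mk'
    (fun n => ((eps N₁ (tmul A[X] m.1 n.1) + V.kappa ψ m.2.1 n.2, eps N₂ (tmul A[X] m.2.2 n.2)) :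
      BTensor A E N₁ × BTensor A E N₂))
    (fun n n' => by
      refine Prod.ext ?_ ?_
      · change eps N₁ (tmul A[X] m.1 (n.1 + n'.1)) + V.kappa ψ m.2.1 (n.2 + n'.2) =
          (eps N₁ (tmul A[X] m.1 n.1) + V.kappa ψ m.2.1 n.2) +
            (eps N₁ (tmul A[X] m.1 n'.1) + V.kappa ψ m.2.1 n'.2)
        rw [tmul_add, map_add, map_add]; abel
      · change eps N₂ (tmul A[X] m.2.2 (n.2 + n'.2)) =
          eps N₂ (tmul A[X] m.2.2 n.2) + eps N₂ (tmul A[X] m.2.2 n'.2)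
        rw [tmul_add, map_add]))
    (fun m m' => by
      ext n
      refine Prod.ext ?_ ?_
      · change eps N₁ (tmul A[X] (m.1 + m'.1) n.1) + V.kappa ψ (m.2.1 + m'.2.1) n.2 =
          (eps N₁ (tmul A[X] m.1 n.1) + V.kappa ψ m.2.1 n.2) +
            (eps N₁ (tmul A[X] m'.1 n.1) + V.kappa ψ m'.2.1 n.2)
        rw [add_tmul, map_add, map_add, AddMonoidHom.add_apply]; abel
      · change eps N₂ (tmul A[X] (m.2.2 + m'.2.2) n.2) =
          eps N₂ (tmul A[X] m.2.2 n.2) + eps N₂ (tmul A[X] m'.2.2 n.2)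
        rw [add_tmul, map_add])

/-- The map `E'⁰ ⊗_B (N₁; N₂) → (E ⊗_A N₁; E ⊗_A N₂)` as an additive map. -/
def E0TriHom : BTensor V.B V.E0 (Tri ψ) →+ Tri (V.ψF ψ) :=
  BTensor.lift (V.E0Pair ψ) (fun b m n => by
    refine Prod.ext ?_ ?_
    · change eps N₁ (tmul A[X] (op b.1 • m.1) n.1) +
          V.kappa ψ (tmul A[X] m.1 b.2.1 + op b.2.2 • m.2.1) n.2 =
        eps N₁ (tmul A[X] m.1 (b.1 • n.1 + ψ (tmul A[X] b.2.1 n.2))) +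
          V.kappa ψ m.2.1 (b.2.2 • n.2)
      rw [map_add, AddMonoidHom.add_apply, kappa_op, op_smul_tmul, kappa_tmul, tmul_add, map_add,
        add_assoc]
    · change eps N₂ (tmul A[X] (op b.2.2 • m.2.2) n.2) = eps N₂ (tmul A[X] m.2.2 (b.2.2 • n.2))
      rw [op_smul_tmul])

/-- The first part of the inverse of `E0TriHom`. -/
def E0TriInv₁ : BTensor A E N₁ →+ BTensor V.B V.E0 (Tri ψ) :=
  BTensor.lift (AddMonoidHom.mk' (fun e => AddMonoidHom.mk'
      (fun n => tmul V.B (V.mk0 (EPoly.monomial 0 e) 0 0) (Tri.mk ψ n 0))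
      (fun n n' => by
        rw [← tmul_add]; congr 1; exact Prod.ext rfl (add_zero _).symm))
      (fun e e' => by
        ext n
        change _ = tmul V.B _ _ + tmul V.B _ _
        rw [← add_tmul]
        change tmul V.B _ _ = tmul V.B _ _
        congr 1
        exact E0_ext V (map_add _ _ _) (add_zero _).symm (add_zero _).symm))
    (fun a e n => by
      change tmul V.B (V.mk0 (EPoly.monomial 0 (op a • e)) 0 0) (Tri.mk ψ n 0) =
        tmul V.B (V.mk0 (EPoly.monomial 0 e) 0 0) (Tri.mk ψ (a • n) 0)
      let b : V.B := (Polynomial.C a, 0, 0)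
      have h1 : (op b • (V.mk0 (EPoly.monomial 0 e) 0 0)) =
          (V.mk0 (EPoly.monomial 0 (op a • e)) 0 0) := by
        refine E0_ext V (EPoly.op_C_smul a 0 e) ?_ ?_
        · change tmul A[X] _ (0 : V.Ey) + op (0 : A[X]) • (0 : V.EEy) = 0
          rw [tmul_zero, smul_zero, add_zero]
        · exact smul_zero (op (0 : A[X]))
      have h2 : b • (Tri.mk ψ n 0) = (Tri.mk ψ (a • n) 0) := by
        refine Prod.ext ?_ (smul_zero (0 : A[X]))
        change (Polynomial.C a : A[X]) • n + ψ (tmul A[X] (0 : V.Ey) (0 : N₂)) = a • n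
        rw [tmul_zero, map_zero, add_zero, C_smul_eq (A := A)]
      rw [← h1, ← h2, op_smul_tmul])

/-- The second part of the inverse of `E0TriHom`. -/
def E0TriInv₂ : BTensor A E N₂ →+ BTensor V.B V.E0 (Tri ψ) :=
  BTensor.lift (AddMonoidHom.mk' (fun e => AddMonoidHom.mk'
      (fun n => tmul V.B (V.mk0 0 0 (EPoly.monomial 0 e)) (Tri.mk ψ 0 n))
      (fun n n' => by
        rw [← tmul_add]; congr 1; exact Prod.ext (add_zero _).symm rfl))
      (fun e e' => by
        ext n
        change _ = tmul V.B _ _ + tmul V.B _ _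
        rw [← add_tmul]
        change tmul V.B _ _ = tmul V.B _ _
        congr 1
        exact E0_ext V (add_zero _).symm (add_zero _).symm (map_add _ _ _)))
    (fun a e n => by
      change tmul V.B (V.mk0 0 0 (EPoly.monomial 0 (op a • e))) (Tri.mk ψ 0 n) =
        tmul V.B (V.mk0 0 0 (EPoly.monomial 0 e)) (Tri.mk ψ 0 (a • n))
      let b : V.B := (0, 0, Polynomial.C a)
      have h1 : (op b • (V.mk0 0 0 (EPoly.monomial 0 e))) =
          (V.mk0 0 0 (EPoly.monomial 0 (op a • e))) := by
        refine E0_ext V (smul_zero (op (0 : A[X]))) ?_ (EPoly.op_C_smul a 0 e)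
        change tmul A[X] _ (0 : V.Ey) + op (Polynomial.C a : A[X]) • (0 : V.EEy) = 0
        rw [tmul_zero, smul_zero, add_zero]
      have h2 : b • (Tri.mk ψ 0 n) = (Tri.mk ψ 0 (a • n)) := by
        refine Prod.ext ?_ (C_smul_eq (A := A) a n)
        change (0 : A[X]) • (0 : N₁) + ψ (tmul A[X] (0 : V.Ey) n) = 0
        rw [zero_tmul, map_zero, smul_zero, add_zero]
      rw [← h1, ← h2, op_smul_tmul])

theorem E0TriInv₁_tmul (e : E) (n : N₁) : V.E0TriInv₁ ψ (tmul A e n) =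
    tmul V.B (V.mk0 (EPoly.monomial 0 e) 0 0) (Tri.mk ψ n 0) := rfl

theorem E0TriInv₂_tmul (e : E) (n : N₂) : V.E0TriInv₂ ψ (tmul A e n) =
    tmul V.B (V.mk0 0 0 (EPoly.monomial 0 e)) (Tri.mk ψ 0 n) := rfl

theorem E0TriInv₁_eps (p : EPoly A E) (n : N₁) : V.E0TriInv₁ ψ (eps N₁ (tmul A[X] p n)) =
    tmul V.B (V.mk0 p 0 0) (Tri.mk ψ n 0) := by
  let k : EPoly A E →+ BTensor V.B V.E0 (Tri ψ) := AddMonoidHom.mk'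
    (fun p => tmul V.B (V.mk0 p 0 0) (Tri.mk ψ n 0)) (fun p p' => by
      rw [← add_tmul]
      congr 1
      exact E0_ext V rfl (add_zero _).symm (add_zero _).symm)
  refine EPoly.hom_eq ((V.E0TriInv₁ ψ).comp ((eps N₁).toAddMonoidHom.comp
    ((BTensor.tmulHom A[X] (EPoly A E) N₁).flip n))) k (fun j e => ?_) p
  change V.E0TriInv₁ ψ (eps N₁ (tmul A[X] (EPoly.monomial j e) n)) =
    tmul V.B (V.mk0 (EPoly.monomial j e) 0 0) (Tri.mk ψ n 0)
  rw [eps_monomial_tmul, E0TriInv₁_tmul]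
  -- The power of `y` is carried across the tensor sign by the diagonal matrix `(yʲ, 0; 0, 0)`.
  let b : V.B := ((X : A[X]) ^ j, 0, 0)
  have h1 : ∀ j : ℕ, op ((X : A[X]) ^ j) • EPoly.monomial (A := A) 0 e = EPoly.monomial j e := by
    intro j
    induction j with
    | zero => rw [pow_zero, op_one, one_smul]
    | succ j ih => rw [pow_succ, op_mul, mul_smul, ih, EPoly.op_X_smul]
  have h2 : (op b • (V.mk0 (EPoly.monomial 0 e) 0 0)) = (V.mk0 (EPoly.monomial j e) 0 0) := by
    refine E0_ext V (h1 j) ?_ ?_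
    · change tmul A[X] _ (0 : V.Ey) + op (0 : A[X]) • (0 : V.EEy) = 0
      rw [tmul_zero, smul_zero, add_zero]
    · exact smul_zero (op (0 : A[X]))
  have h3 : b • (Tri.mk ψ n 0) = (Tri.mk ψ (((X : A[X]) ^ j) • n) 0) := by
    refine Prod.ext ?_ (smul_zero (0 : A[X]))
    change ((X : A[X]) ^ j) • n + ψ (tmul A[X] (0 : V.Ey) (0 : N₂)) = _
    rw [tmul_zero, map_zero, add_zero]; rfl
  rw [← h2, ← h3, op_smul_tmul]

theorem E0TriInv₂_eps (p : EPoly A E) (n : N₂) : V.E0TriInv₂ ψ (eps N₂ (tmul A[X] p n)) =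
    tmul V.B (V.mk0 0 0 p) (Tri.mk ψ 0 n) := by
  let k : EPoly A E →+ BTensor V.B V.E0 (Tri ψ) := AddMonoidHom.mk'
    (fun p => tmul V.B (V.mk0 0 0 p) (Tri.mk ψ 0 n)) (fun p p' => by
      rw [← add_tmul]
      congr 1
      exact E0_ext V (add_zero _).symm (add_zero _).symm rfl)
  refine EPoly.hom_eq ((V.E0TriInv₂ ψ).comp ((eps N₂).toAddMonoidHom.comp
    ((BTensor.tmulHom A[X] (EPoly A E) N₂).flip n))) k (fun j e => ?_) p
  change V.E0TriInv₂ ψ (eps N₂ (tmul A[X] (EPoly.monomial j e) n)) =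
    tmul V.B (V.mk0 0 0 (EPoly.monomial j e)) (Tri.mk ψ 0 n)
  rw [eps_monomial_tmul, E0TriInv₂_tmul]
  let b : V.B := (0, 0, (X : A[X]) ^ j)
  have h1 : ∀ j : ℕ, op ((X : A[X]) ^ j) • EPoly.monomial (A := A) 0 e = EPoly.monomial j e := by
    intro j
    induction j with
    | zero => rw [pow_zero, op_one, one_smul]
    | succ j ih => rw [pow_succ, op_mul, mul_smul, ih, EPoly.op_X_smul]
  have h2 : (op b • (V.mk0 0 0 (EPoly.monomial 0 e))) = (V.mk0 0 0 (EPoly.monomial j e)) := by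
    refine E0_ext V (smul_zero (op (0 : A[X]))) ?_ (h1 j)
    change tmul A[X] _ (0 : V.Ey) + op ((X : A[X]) ^ j) • (0 : V.EEy) = 0
    rw [tmul_zero, smul_zero, add_zero]
  have h3 : b • (Tri.mk ψ 0 n) = (Tri.mk ψ 0 (((X : A[X]) ^ j) • n)) := by
    refine Prod.ext ?_ rfl
    change (0 : A[X]) • (0 : N₁) + ψ (tmul A[X] (0 : V.Ey) n) = 0
    rw [zero_tmul, map_zero, smul_zero, add_zero]
  rw [← h2, ← h3, op_smul_tmul]

theorem E0TriInv₁_kappa (t : V.EEy) (n : N₂) : V.E0TriInv₁ ψ (V.kappa ψ t n) =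
    tmul V.B (V.mk0 0 t 0) (Tri.mk ψ 0 n) := by
  let k : V.EEy →+ BTensor V.B V.E0 (Tri ψ) := AddMonoidHom.mk'
    (fun t => tmul V.B (V.mk0 0 t 0) (Tri.mk ψ 0 n)) (fun p p' => by
      rw [← add_tmul]
      congr 1
      exact E0_ext V (add_zero _).symm rfl (add_zero _).symm)
  refine BTensor.hom_eq ((V.E0TriInv₁ ψ).comp ((V.kappa ψ).flip n)) k (fun p e => ?_) t
  change V.E0TriInv₁ ψ (V.kappa ψ (tmul A[X] p e) n) =
    tmul V.B (V.mk0 0 (tmul A[X] p e) 0) (Tri.mk ψ 0 n)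
  rw [kappa_tmul, E0TriInv₁_eps]
  -- An off-diagonal entry `p ⊗ e` is the diagonal entry `p` multiplied on the right by `e`, viewed
  -- in `B`; across the tensor sign this `e` acts on `n` through `ψ`.
  let b : V.B := (0, e, 0)
  have h2 : (op b • (V.mk0 p 0 0)) = (V.mk0 0 (tmul A[X] p e) 0) := by
    refine E0_ext V (zero_smul (A[X])ᵐᵒᵖ p) ?_ (smul_zero (op (0 : A[X])))
    change tmul A[X] p e + op (0 : A[X]) • (0 : V.EEy) = _
    rw [smul_zero, add_zero]; rfl
  have h3 : b • (Tri.mk ψ 0 n) = (Tri.mk ψ (ψ (tmul A[X] e n)) 0) := by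
    refine Prod.ext ?_ (zero_smul A[X] n)
    change (0 : A[X]) • (0 : N₁) + ψ (tmul A[X] e n) = _
    rw [smul_zero, zero_add]; rfl
  rw [← h2, ← h3, op_smul_tmul]

/-- Inserting `1 = b₁² + b₂²` for the two diagonal idempotents of `B`, and moving one copy of each
across the tensor sign, separates the entries. -/
theorem E0_tmul_eq (m : V.E0) (n : Tri ψ) : tmul V.B m n =
    tmul V.B (V.mk0 m.1 0 0) (Tri.mk ψ n.1 0) +
      tmul V.B (V.mk0 0 m.2.1 0) (Tri.mk ψ 0 n.2) +
        tmul V.B (V.mk0 0 0 m.2.2) (Tri.mk ψ 0 n.2) := by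
  let b₁ : V.B := (1, 0, 0)
  let b₂ : V.B := (0, 0, 1)
  have hb : b₁ + b₂ = 1 := B_ext V (add_zero _) (add_zero _) (zero_add _)
  have h1 : op b₁ • m = (V.mk0 m.1 0 0) := by
    refine E0_ext V (one_smul (A[X])ᵐᵒᵖ _) ?_ (zero_smul (A[X])ᵐᵒᵖ _)
    change tmul A[X] m.1 (0 : V.Ey) + op (0 : A[X]) • m.2.1 = 0
    rw [tmul_zero, op_zero, zero_smul, add_zero]
  have h2 : op b₂ • m = (V.mk0 0 m.2.1 0) + (V.mk0 0 0 m.2.2) := by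
    refine E0_ext V ((zero_smul (A[X])ᵐᵒᵖ _).trans (add_zero _).symm) ?_
      ((one_smul (A[X])ᵐᵒᵖ _).trans (zero_add _).symm)
    change tmul A[X] m.1 (0 : V.Ey) + op (1 : A[X]) • m.2.1 = m.2.1 + 0
    rw [tmul_zero, op_one, one_smul, add_zero, zero_add]
  have h1' : b₁ * b₁ = b₁ := B_ext V (one_mul _) (by
    change (1 : A[X]) • (0 : V.Ey) + op (0 : A[X]) • (0 : V.Ey) = 0
    rw [smul_zero, smul_zero, add_zero]) (zero_mul _)
  have h2' : b₂ * b₂ = b₂ := B_ext V (zero_mul _) (by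
    change (0 : A[X]) • (0 : V.Ey) + op (1 : A[X]) • (0 : V.Ey) = 0
    rw [smul_zero, smul_zero, add_zero]) (one_mul _)
  have h3 : b₁ • n = (Tri.mk ψ n.1 0) := by
    refine Prod.ext ?_ (zero_smul _ _)
    change (1 : A[X]) • n.1 + ψ (tmul A[X] (0 : V.Ey) n.2) = n.1
    rw [zero_tmul, map_zero, one_smul, add_zero]
  have h4 : b₂ • n = (Tri.mk ψ 0 n.2) := by
    refine Prod.ext ?_ (one_smul _ _)
    change (0 : A[X]) • n.1 + ψ (tmul A[X] (0 : V.Ey) n.2) = 0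
    rw [zero_tmul, map_zero, zero_smul, add_zero]
  have h5 : tmul V.B m n = tmul V.B m (b₁ • b₁ • n) + tmul V.B m (b₂ • b₂ • n) := by
    rw [← mul_smul, ← mul_smul, h1', h2', ← tmul_add, ← add_smul, hb, one_smul]
  rw [h5, ← op_smul_tmul b₁, ← op_smul_tmul b₂, h1, h2, h3, h4, add_tmul, add_assoc]

/-- The isomorphism `E'⁰ ⊗_B (N₁; N₂) ≃ (E ⊗_A N₁; E ⊗_A N₂)`. -/
def E0Tri : BTensor V.B V.E0 (Tri ψ) ≃ₗ[V.B] Tri (V.ψF ψ) where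
  toFun := V.E0TriHom ψ
  map_add' := map_add _
  map_smul' b t := BTensor.hom_eq ((V.E0TriHom ψ).comp (DistribSMul.toAddMonoidHom _ b))
    ((DistribSMul.toAddMonoidHom (Tri (V.ψF ψ)) b).comp (V.E0TriHom ψ)) (fun m n => by
      refine Prod.ext ?_ ?_
      · change eps N₁ (tmul A[X] (b.1 • m.1) n.1) +
            V.kappa ψ (b.1 • m.2.1 + V.sY (tmul A[X] b.2.1 m.2.2)) n.2 =
          b.1 • (eps N₁ (tmul A[X] m.1 n.1) + V.kappa ψ m.2.1 n.2) +
            V.ψF ψ (tmul A[X] b.2.1 (eps N₂ (tmul A[X] m.2.2 n.2)))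
        rw [map_add, AddMonoidHom.add_apply, kappa_sY, kappa_smul, ← smul_tmul', map_smul, smul_add,
          add_assoc]
      · change eps N₂ (tmul A[X] (b.2.2 • m.2.2) n.2) = b.2.2 • eps N₂ (tmul A[X] m.2.2 n.2)
        rw [← smul_tmul', map_smul]) t
  invFun n := V.E0TriInv₁ ψ n.1 + V.E0TriInv₂ ψ n.2
  left_inv t := BTensor.hom_eq (((V.E0TriInv₁ ψ).comp (AddMonoidHom.fst _ _) +
      (V.E0TriInv₂ ψ).comp (AddMonoidHom.snd _ _)).comp
        (M := BTensor V.B V.E0 (Tri ψ)) (N := BTensor A E N₁ × BTensor A E N₂) (V.E0TriHom ψ))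
    (AddMonoidHom.id _) (fun m n => by
      change V.E0TriInv₁ ψ (eps N₁ (tmul A[X] m.1 n.1) + V.kappa ψ m.2.1 n.2) +
        V.E0TriInv₂ ψ (eps N₂ (tmul A[X] m.2.2 n.2)) = tmul V.B m n
      rw [map_add, E0TriInv₁_eps, E0TriInv₁_kappa, E0TriInv₂_eps, ← E0_tmul_eq]) t
  right_inv n := by
    have h1 : ∀ t, V.E0TriHom ψ (V.E0TriInv₁ ψ t) = (Tri.mk (V.ψF ψ) t 0) :=
      BTensor.hom_eq ((V.E0TriHom ψ).comp (V.E0TriInv₁ ψ))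
        (AddMonoidHom.inl (BTensor A E N₁) (BTensor A E N₂)) (fun e n => by
          refine Prod.ext ?_ ?_
          · change eps N₁ (tmul A[X] (EPoly.monomial 0 e) n) + V.kappa ψ 0 0 = tmul A e n
            rw [map_zero, add_zero, eps_monomial_tmul, pow_zero, one_smul]
          · change eps N₂ (tmul A[X] (0 : EPoly A E) (0 : N₂)) = 0
            rw [tmul_zero, map_zero])
    have h2 : ∀ t, V.E0TriHom ψ (V.E0TriInv₂ ψ t) = (Tri.mk (V.ψF ψ) 0 t) :=
      BTensor.hom_eq ((V.E0TriHom ψ).comp (V.E0TriInv₂ ψ))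
        (AddMonoidHom.inr (BTensor A E N₁) (BTensor A E N₂)) (fun e n => by
          refine Prod.ext ?_ ?_
          · change eps N₁ (tmul A[X] (0 : EPoly A E) (0 : N₁)) + V.kappa ψ 0 n = 0
            rw [map_zero, tmul_zero, map_zero, zero_add, AddMonoidHom.zero_apply]
          · change eps N₂ (tmul A[X] (EPoly.monomial 0 e) n) = tmul A e n
            rw [eps_monomial_tmul, pow_zero, one_smul])
    change V.E0TriHom ψ (V.E0TriInv₁ ψ n.1 + V.E0TriInv₂ ψ n.2) = n
    rw [map_add, h1, h2]
    exact Prod.ext (add_zero _) (zero_add _)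

end TwoRep
end

/-! ### The functor `E'¹ ⊗_B -` on column vectors. -/

noncomputable section

namespace TwoRep
open BTensor (tmul add_tmul tmul_add zero_tmul tmul_zero op_smul_tmul smul_tmul' smul_tmul_right
  assocHom twoTensor lTensorX hom_eq_assoc twoTensor_assocHom)
variable {A E : Type u} [Ring A] [AddCommGroup E] [Module A E] [Module Aᵐᵒᵖ E]
  [SMulCommClass A Aᵐᵒᵖ E] (V : TwoRep A E)
variable {N₁ N₂ : Type u} [AddCommGroup N₁] [Module A N₁] [Module A[X] N₁]
  [IsScalarTower A A[X] N₁] [AddCommGroup N₂] [Module A N₂] [Module A[X] N₂]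
  [IsScalarTower A A[X] N₂] (ψ : BTensor A[X] V.Ey N₂ →ₗ[A[X]] N₁)

/-- The matrix in `E'¹` with the given entries. -/
def mk1 (p : V.Ey) (t : V.EyEy) (a : A[X]) (q : V.Ey) : V.E1 := (p, t, a, q)

/-- The structure map of `E'¹ ⊗_B (N₁; N₂) = (E_y ⊗_{A[y]} N₁; N₁)`. -/
abbrev ψG (V : TwoRep A E) (N₁ : Type u) [AddCommGroup N₁] [Module A N₁] [Module A[X] N₁]
    [IsScalarTower A A[X] N₁] : BTensor A[X] V.Ey N₁ →ₗ[A[X]] BTensor A[X] V.Ey N₁ :=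
  LinearMap.id

/-- The pairing of `E_y ⊗ E_y` with `N₂`. -/
def lam : V.EyEy →+ N₂ →+ BTensor A[X] V.Ey N₁ :=
  AddMonoidHom.mk' (fun t => ((BTensor.lTensor A[X] V.Ey ψ).toAddMonoidHom.comp assocHom).comp
      (BTensor.tmulHom A[X] V.EyEy N₂ t)) (fun t t' => by
    ext n
    change BTensor.lTensor A[X] V.Ey ψ (assocHom (tmul A[X] (t + t') n)) = _
    rw [add_tmul, map_add, map_add]; rfl)

theorem lam_tmul (p e : V.Ey) (n : N₂) :
    V.lam ψ (tmul A[X] p e) n = tmul A[X] p (ψ (tmul A[X] e n)) := rfl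

theorem lam_op (a : A[X]) (t : V.EyEy) (n : N₂) :
    V.lam ψ (op a • t) n = V.lam ψ t (a • n) := by
  change BTensor.lTensor A[X] V.Ey ψ (assocHom (tmul A[X] (op a • t) n)) =
    BTensor.lTensor A[X] V.Ey ψ (assocHom (tmul A[X] t (a • n)))
  rw [op_smul_tmul]

theorem lam_smul (a : A[X]) (t : V.EyEy) (n : N₂) :
    V.lam ψ (a • t) n = a • V.lam ψ t n :=
  BTensor.hom_eq (((V.lam ψ).flip n).comp (DistribSMul.toAddMonoidHom V.EyEy a))
    ((DistribSMul.toAddMonoidHom (BTensor A[X] V.Ey N₁) a).comp ((V.lam ψ).flip n))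
    (fun p e => rfl) t

/-- The pairing of `E'¹` with `(N₁; N₂)`. -/
def E1Pair : V.E1 →+ Tri ψ →+ Tri (V.ψG N₁) :=
  AddMonoidHom.mk' (fun m => AddMonoidHom.mk'
    (fun n => Tri.mk (V.ψG N₁) (tmul A[X] m.1 n.1 + V.lam ψ m.2.1 n.2)
      (m.2.2.1 • n.1 + ψ (tmul A[X] m.2.2.2 n.2)))
    (fun n n' => by
      refine Prod.ext ?_ ?_
      · change tmul A[X] m.1 (n.1 + n'.1) + V.lam ψ m.2.1 (n.2 + n'.2) =
          (tmul A[X] m.1 n.1 + V.lam ψ m.2.1 n.2) +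
            (tmul A[X] m.1 n'.1 + V.lam ψ m.2.1 n'.2)
        rw [tmul_add, map_add]; abel
      · change m.2.2.1 • (n.1 + n'.1) + ψ (tmul A[X] m.2.2.2 (n.2 + n'.2)) =
          (m.2.2.1 • n.1 + ψ (tmul A[X] m.2.2.2 n.2)) +
            (m.2.2.1 • n'.1 + ψ (tmul A[X] m.2.2.2 n'.2))
        rw [tmul_add, map_add, smul_add]; abel))
    (fun m m' => by
      ext n
      refine Prod.ext ?_ ?_
      · change tmul A[X] (m.1 + m'.1) n.1 + V.lam ψ (m.2.1 + m'.2.1) n.2 =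
          (tmul A[X] m.1 n.1 + V.lam ψ m.2.1 n.2) +
            (tmul A[X] m'.1 n.1 + V.lam ψ m'.2.1 n.2)
        rw [add_tmul, map_add, AddMonoidHom.add_apply]; abel
      · change (m.2.2.1 + m'.2.2.1) • n.1 + ψ (tmul A[X] (m.2.2.2 + m'.2.2.2) n.2) =
          (m.2.2.1 • n.1 + ψ (tmul A[X] m.2.2.2 n.2)) +
            (m'.2.2.1 • n.1 + ψ (tmul A[X] m'.2.2.2 n.2))
        rw [add_tmul, map_add, add_smul]; abel)

/-- The map `E'¹ ⊗_B (N₁; N₂) → (E_y ⊗_{A[y]} N₁; N₁)` as an additive map. -/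
def E1TriHom : BTensor V.B V.E1 (Tri ψ) →+ Tri (V.ψG N₁) :=
  BTensor.lift (V.E1Pair ψ) (fun b m n => by
    refine Prod.ext ?_ ?_
    · change tmul A[X] (op b.1 • m.1) n.1 +
          V.lam ψ (tmul A[X] m.1 b.2.1 + op b.2.2 • m.2.1) n.2 =
        tmul A[X] m.1 (b.1 • n.1 + ψ (tmul A[X] b.2.1 n.2)) + V.lam ψ m.2.1 (b.2.2 • n.2)
      rw [map_add, AddMonoidHom.add_apply, lam_op, op_smul_tmul, lam_tmul, tmul_add, add_assoc]
    · change (m.2.2.1 * b.1) • n.1 +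
          ψ (tmul A[X] (m.2.2.1 • b.2.1 + op b.2.2 • m.2.2.2) n.2) =
        m.2.2.1 • (b.1 • n.1 + ψ (tmul A[X] b.2.1 n.2)) + ψ (tmul A[X] m.2.2.2 (b.2.2 • n.2))
      rw [add_tmul, map_add, op_smul_tmul, ← smul_tmul', map_smul, mul_smul, smul_add, add_assoc])

theorem B₁_smul_mk (a : A[X]) (n : N₁) :
    (show V.B from (a, 0, 0)) • Tri.mk ψ n 0 = Tri.mk ψ (a • n) 0 := by
  refine Prod.ext ?_ (smul_zero (0 : A[X]))
  change a • n + ψ (tmul A[X] (0 : V.Ey) (0 : N₂)) = a • n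
  rw [tmul_zero, map_zero, add_zero]

theorem B₂_smul_mk (e : V.Ey) (n : N₂) :
    (show V.B from (0, e, 0)) • Tri.mk ψ 0 n = Tri.mk ψ (ψ (tmul A[X] e n)) 0 := by
  refine Prod.ext ?_ (zero_smul A[X] n)
  change (0 : A[X]) • (0 : N₁) + ψ (tmul A[X] e n) = ψ (tmul A[X] e n)
  rw [smul_zero, zero_add]

/-- The first part of the inverse of `E1TriHom`. -/
def E1TriInv₁ : BTensor A[X] V.Ey N₁ →+ BTensor V.B V.E1 (Tri ψ) :=
  BTensor.lift (AddMonoidHom.mk' (fun e => AddMonoidHom.mk'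
      (fun n => tmul V.B (V.mk1 e 0 0 0) (Tri.mk ψ n 0))
      (fun n n' => by
        rw [← tmul_add]; congr 1; exact Prod.ext rfl (add_zero _).symm))
      (fun e e' => by
        ext n
        change _ = tmul V.B _ _ + tmul V.B _ _
        rw [← add_tmul]
        change tmul V.B _ _ = tmul V.B _ _
        congr 1
        exact E1_ext V rfl (add_zero _).symm (add_zero _).symm (add_zero _).symm))
    (fun a e n => by
      change tmul V.B (V.mk1 (op a • e) 0 0 0) (Tri.mk ψ n 0) =
        tmul V.B (V.mk1 e 0 0 0) (Tri.mk ψ (a • n) 0)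
      have h1 : op (show V.B from (a, 0, 0)) • V.mk1 e 0 0 0 = V.mk1 (op a • e) 0 0 0 := by
        refine E1_ext V rfl ?_ (zero_mul _) ?_
        · change tmul A[X] _ (0 : V.Ey) + op (0 : A[X]) • (0 : V.EyEy) = 0
          rw [tmul_zero, smul_zero, add_zero]
        · change (0 : A[X]) • (0 : V.Ey) + op (0 : A[X]) • (0 : V.Ey) = 0
          rw [smul_zero, smul_zero, add_zero]
      rw [← h1, ← B₁_smul_mk, op_smul_tmul])

/-- The second part of the inverse of `E1TriHom`. -/
def E1TriInv₂ : N₁ →+ BTensor V.B V.E1 (Tri ψ) :=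
  AddMonoidHom.mk' (fun n => tmul V.B (V.mk1 0 0 1 0) (Tri.mk ψ n 0)) (fun n n' => by
    rw [← tmul_add]; congr 1; exact Prod.ext rfl (add_zero _).symm)

theorem E1TriInv₁_tmul (e : V.Ey) (n : N₁) : V.E1TriInv₁ ψ (tmul A[X] e n) =
    tmul V.B (V.mk1 e 0 0 0) (Tri.mk ψ n 0) := rfl

theorem E1TriInv₁_lam (t : V.EyEy) (n : N₂) : V.E1TriInv₁ ψ (V.lam ψ t n) =
    tmul V.B (V.mk1 0 t 0 0) (Tri.mk ψ 0 n) := by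
  let k : V.EyEy →+ BTensor V.B V.E1 (Tri ψ) := AddMonoidHom.mk'
    (fun t => tmul V.B (V.mk1 0 t 0 0) (Tri.mk ψ 0 n)) (fun p p' => by
      rw [← add_tmul]
      congr 1
      exact E1_ext V (add_zero _).symm rfl (add_zero _).symm (add_zero _).symm)
  refine BTensor.hom_eq ((V.E1TriInv₁ ψ).comp ((V.lam ψ).flip n)) k (fun p e => ?_) t
  change V.E1TriInv₁ ψ (V.lam ψ (tmul A[X] p e) n) =
    tmul V.B (V.mk1 0 (tmul A[X] p e) 0 0) (Tri.mk ψ 0 n)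
  rw [lam_tmul, E1TriInv₁_tmul, ← B₂_smul_mk, ← op_smul_tmul]
  congr 1
  refine E1_ext V (zero_smul (A[X])ᵐᵒᵖ p) ?_ (zero_mul _) ?_
  · change tmul A[X] p e + op (0 : A[X]) • (0 : V.EyEy) = tmul A[X] p e
    rw [smul_zero, add_zero]
  · change (0 : A[X]) • e + op (0 : A[X]) • (0 : V.Ey) = 0
    rw [zero_smul, smul_zero, add_zero]

/-- The bottom row `(A[y], E_y)` of `E'¹` is `e₁B` as a right module, so tensoring it with `(N₁;
N₂)` yields the top entry `N₁`. Its generator is the matrix whose only nonzero entry is the `1` in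
`A[y]`. -/
theorem E1TriInv₂_smul (a : A[X]) (n : N₁) : V.E1TriInv₂ ψ (a • n) =
    tmul V.B (V.mk1 0 0 a 0) (Tri.mk ψ n 0) := by
  change tmul V.B (V.mk1 0 0 1 0) (Tri.mk ψ (a • n) 0) = _
  rw [← B₁_smul_mk, ← op_smul_tmul]
  congr 1
  refine E1_ext V (smul_zero (op a)) ?_ (one_mul a) ?_
  · change tmul A[X] (0 : V.Ey) (0 : V.Ey) + op (0 : A[X]) • (0 : V.EyEy) = 0
    rw [tmul_zero, smul_zero, add_zero]
  · change (1 : A[X]) • (0 : V.Ey) + op (0 : A[X]) • (0 : V.Ey) = 0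
    rw [smul_zero, smul_zero, add_zero]

theorem E1TriInv₂_ψ (e : V.Ey) (n : N₂) : V.E1TriInv₂ ψ (ψ (tmul A[X] e n)) =
    tmul V.B (V.mk1 0 0 0 e) (Tri.mk ψ 0 n) := by
  change tmul V.B (V.mk1 0 0 1 0) (Tri.mk ψ (ψ (tmul A[X] e n)) 0) = _
  rw [← B₂_smul_mk, ← op_smul_tmul]
  congr 1
  refine E1_ext V (smul_zero (op (0 : A[X]))) ?_ (mul_zero (1 : A[X])) ?_
  · change tmul A[X] (0 : V.Ey) e + op (0 : A[X]) • (0 : V.EyEy) = 0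
    rw [zero_tmul, smul_zero, add_zero]
  · change (1 : A[X]) • e + op (0 : A[X]) • (0 : V.Ey) = e
    rw [one_smul, smul_zero, add_zero]

theorem E1_tmul_eq (m : V.E1) (n : Tri ψ) : tmul V.B m n =
    tmul V.B (V.mk1 m.1 0 0 0) (Tri.mk ψ n.1 0) + tmul V.B (V.mk1 0 m.2.1 0 0) (Tri.mk ψ 0 n.2) +
      (tmul V.B (V.mk1 0 0 m.2.2.1 0) (Tri.mk ψ n.1 0) +
        tmul V.B (V.mk1 0 0 0 m.2.2.2) (Tri.mk ψ 0 n.2)) := by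
  let b₁ : V.B := (1, 0, 0)
  let b₂ : V.B := (0, 0, 1)
  have hb : b₁ + b₂ = 1 := B_ext V (add_zero _) (add_zero _) (zero_add _)
  have h1 : op b₁ • m = V.mk1 m.1 0 0 0 + V.mk1 0 0 m.2.2.1 0 := by
    refine E1_ext V ((one_smul (A[X])ᵐᵒᵖ _).trans (add_zero _).symm) ?_
      ((mul_one _).trans (zero_add _).symm) ?_
    · change tmul A[X] m.1 (0 : V.Ey) + op (0 : A[X]) • m.2.1 = 0 + 0
      rw [tmul_zero, op_zero, zero_smul]
    · change m.2.2.1 • (0 : V.Ey) + op (0 : A[X]) • m.2.2.2 = 0 + 0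
      rw [smul_zero, op_zero, zero_smul]
  have h2 : op b₂ • m = V.mk1 0 m.2.1 0 0 + V.mk1 0 0 0 m.2.2.2 := by
    refine E1_ext V ((zero_smul (A[X])ᵐᵒᵖ _).trans (add_zero _).symm) ?_
      ((mul_zero _).trans (add_zero _).symm) ?_
    · change tmul A[X] m.1 (0 : V.Ey) + op (1 : A[X]) • m.2.1 = m.2.1 + 0
      rw [tmul_zero, op_one, one_smul, add_zero, zero_add]
    · change m.2.2.1 • (0 : V.Ey) + op (1 : A[X]) • m.2.2.2 = 0 + m.2.2.2
      rw [smul_zero, op_one, one_smul]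
  have h1' : b₁ * b₁ = b₁ := B_ext V (one_mul _) (by
    change (1 : A[X]) • (0 : V.Ey) + op (0 : A[X]) • (0 : V.Ey) = 0
    rw [smul_zero, smul_zero, add_zero]) (zero_mul _)
  have h2' : b₂ * b₂ = b₂ := B_ext V (zero_mul _) (by
    change (0 : A[X]) • (0 : V.Ey) + op (1 : A[X]) • (0 : V.Ey) = 0
    rw [smul_zero, smul_zero, add_zero]) (one_mul _)
  have h3 : b₁ • n = Tri.mk ψ n.1 0 := by
    refine Prod.ext ?_ (zero_smul _ _)
    change (1 : A[X]) • n.1 + ψ (tmul A[X] (0 : V.Ey) n.2) = n.1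
    rw [zero_tmul, map_zero, one_smul, add_zero]
  have h4 : b₂ • n = Tri.mk ψ 0 n.2 := by
    refine Prod.ext ?_ (one_smul _ _)
    change (0 : A[X]) • n.1 + ψ (tmul A[X] (0 : V.Ey) n.2) = 0
    rw [zero_tmul, map_zero, zero_smul, add_zero]
  have h5 : tmul V.B m n = tmul V.B m (b₁ • b₁ • n) + tmul V.B m (b₂ • b₂ • n) := by
    rw [← mul_smul, ← mul_smul, h1', h2', ← tmul_add, ← add_smul, hb, one_smul]
  rw [h5, ← op_smul_tmul b₁, ← op_smul_tmul b₂, h1, h2, h3, h4, add_tmul, add_tmul]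
  abel

/-- The isomorphism `E'¹ ⊗_B (N₁; N₂) ≃ (E_y ⊗_{A[y]} N₁; N₁)`. -/
def E1Tri : BTensor V.B V.E1 (Tri ψ) ≃ₗ[V.B] Tri (V.ψG N₁) where
  toFun := V.E1TriHom ψ
  map_add' := map_add _
  map_smul' b t := BTensor.hom_eq ((V.E1TriHom ψ).comp (DistribSMul.toAddMonoidHom _ b))
    ((DistribSMul.toAddMonoidHom (Tri (V.ψG N₁)) b).comp (V.E1TriHom ψ)) (fun m n => by
      refine Prod.ext ?_ ?_
      · change tmul A[X] (b.1 • m.1 + op m.2.2.1 • b.2.1) n.1 +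
            V.lam ψ (b.1 • m.2.1 + tmul A[X] b.2.1 m.2.2.2) n.2 =
          b.1 • (tmul A[X] m.1 n.1 + V.lam ψ m.2.1 n.2) +
            tmul A[X] b.2.1 (m.2.2.1 • n.1 + ψ (tmul A[X] m.2.2.2 n.2))
        rw [map_add, AddMonoidHom.add_apply, lam_tmul, lam_smul, add_tmul, ← smul_tmul',
          op_smul_tmul, smul_add, tmul_add]
        abel
      · change (b.2.2 * m.2.2.1) • n.1 + ψ (tmul A[X] (b.2.2 • m.2.2.2) n.2) =
          b.2.2 • (m.2.2.1 • n.1 + ψ (tmul A[X] m.2.2.2 n.2))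
        rw [← smul_tmul', map_smul, mul_smul, smul_add]) t
  invFun n := V.E1TriInv₁ ψ n.1 + V.E1TriInv₂ ψ n.2
  left_inv t := BTensor.hom_eq (((V.E1TriInv₁ ψ).comp (AddMonoidHom.fst _ _) +
      (V.E1TriInv₂ ψ).comp (AddMonoidHom.snd _ _)).comp
        (M := BTensor V.B V.E1 (Tri ψ)) (N := BTensor A[X] V.Ey N₁ × N₁) (V.E1TriHom ψ))
    (AddMonoidHom.id _) (fun m n => by
      change V.E1TriInv₁ ψ (tmul A[X] m.1 n.1 + V.lam ψ m.2.1 n.2) +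
        V.E1TriInv₂ ψ (m.2.2.1 • n.1 + ψ (tmul A[X] m.2.2.2 n.2)) = tmul V.B m n
      rw [map_add, map_add, E1TriInv₁_tmul, E1TriInv₁_lam, E1TriInv₂_smul, E1TriInv₂_ψ,
        ← E1_tmul_eq]) t
  right_inv n := by
    have h1 : ∀ t, V.E1TriHom ψ (V.E1TriInv₁ ψ t) = Tri.mk (V.ψG N₁) t 0 :=
      BTensor.hom_eq ((V.E1TriHom ψ).comp (V.E1TriInv₁ ψ))
        (AddMonoidHom.inl (BTensor A[X] V.Ey N₁) N₁) (fun e n => by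
          refine Prod.ext ?_ ?_
          · change tmul A[X] e n + V.lam ψ 0 0 = tmul A[X] e n
            rw [map_zero, add_zero]
          · change (0 : A[X]) • n + ψ (tmul A[X] (0 : V.Ey) (0 : N₂)) = 0
            rw [tmul_zero, map_zero, zero_smul, add_zero])
    have h2 : ∀ t, V.E1TriHom ψ (V.E1TriInv₂ ψ t) = Tri.mk (V.ψG N₁) 0 t := fun n => by
      refine Prod.ext ?_ ?_
      · change tmul A[X] (0 : V.Ey) n + V.lam ψ 0 0 = 0
        rw [map_zero, zero_tmul, zero_add]
      · change (1 : A[X]) • n + ψ (tmul A[X] (0 : V.Ey) (0 : N₂)) = n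
        rw [tmul_zero, map_zero, one_smul, add_zero]
    change V.E1TriHom ψ (V.E1TriInv₁ ψ n.1 + V.E1TriInv₂ ψ n.2) = n
    rw [map_add, h1, h2]
    exact Prod.ext (add_zero _) (zero_add _)

end TwoRep
end

/-! ### The factorization criterion, transported along isomorphisms. -/

namespace CoconeFunctor
open CategoryTheory.Limits
universe v w
variable {𝒜 : Type w} [Category.{v} 𝒜] [Preadditive 𝒜] [HasBinaryBiproducts 𝒜]
  {F G : 𝒜 ⥤ 𝒜} [F.Additive] [G.Additive] (α : F ⟶ G)

/-- `exists_factor`, with the values of the functors replaced by isomorphic objects. -/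
theorem exists_factor_of_iso {K K' : CochainComplex 𝒜 ℤ} {K₀ K₁ : 𝒜} {f : K₀ ⟶ K₁}
    (t : TwoTerm K f) (t' : TwoTerm K' (α.app K₀)) {P Q R S : 𝒜} (eP : F.obj K₀ ≅ P)
    (eQ : G.obj K₀ ≅ Q) (eR : F.obj K₁ ≅ R) (eS : G.obj K₁ ≅ S) (φF : P ⟶ R) (φG : Q ⟶ S)
    (α₀ : P ⟶ Q) (α₁ : R ⟶ S) (hF : F.map f ≫ eR.hom = eP.hom ≫ φF)
    (hG : G.map f ≫ eS.hom = eQ.hom ≫ φG) (hα₀ : α.app K₀ ≫ eQ.hom = eP.hom ≫ α₀)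
    (hα₁ : α.app K₁ ≫ eS.hom = eR.hom ≫ α₁)
    (a τ μ₀ : P ⟶ P) (μ₁ : R ⟶ R) (σ : Q ≅ R) (h₁ : a ≫ φF = α₀ ≫ σ.hom)
    (h₂ : a ≫ α₀ = α₀) (h₃ : σ.hom ≫ α₁ = φG) (h₄ : a = 𝟙 _ + τ ≫ μ₀) (h₅ : τ ≫ a = τ)
    (h₆ : μ₀ ≫ φF = φF ≫ μ₁) (h₇ : μ₀ ≫ α₀ = 0) (h₈ : μ₁ ≫ α₁ = 0) (h₉ : Mono μ₁)
    (h₁₀ : ∀ {W : 𝒜} (r : W ⟶ R), r ≫ α₁ = 0 → ∃ r', r' ≫ μ₁ = r) :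
    ∃ β₁ β₂ : K' ⟶ obj α K, ∀ (X : CochainComplex 𝒜 ℤ)
      (hX : ∀ n : ℤ, n ≠ 0 → n ≠ 1 → IsZero (X.X n)) (φ : X ⟶ obj α K),
        ∃ g₁ g₂ : X ⟶ K', φ = g₁ ≫ β₁ + g₂ ≫ β₂ := by
  have hF' : F.map f = eP.hom ≫ φF ≫ eR.inv := by
    rw [← Category.assoc, ← hF, Category.assoc, Iso.hom_inv_id, Category.comp_id]
  have hG' : G.map f = eQ.hom ≫ φG ≫ eS.inv := by
    rw [← Category.assoc, ← hG, Category.assoc, Iso.hom_inv_id, Category.comp_id]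
  have hα₀' : α.app K₀ = eP.hom ≫ α₀ ≫ eQ.inv := by
    rw [← Category.assoc, ← hα₀, Category.assoc, Iso.hom_inv_id, Category.comp_id]
  have hα₁' : α.app K₁ = eR.hom ≫ α₁ ≫ eS.inv := by
    rw [← Category.assoc, ← hα₁, Category.assoc, Iso.hom_inv_id, Category.comp_id]
  refine exists_factor α t t' (eP.hom ≫ a ≫ eP.inv) (eP.hom ≫ τ ≫ eP.inv) (eP.hom ≫ μ₀ ≫ eP.inv)
    (eR.hom ≫ μ₁ ≫ eR.inv) (eQ ≪≫ σ ≪≫ eR.symm) ?_ ?_ ?_ ?_ ?_ ?_ ?_ ?_ ?_ ?_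
  · rw [hF', hα₀']
    simp [reassoc_of% h₁]
  · rw [hα₀']
    simp [reassoc_of% h₂]
  · rw [hα₁', hG']
    simp [reassoc_of% h₃]
  · rw [h₄]
    simp
  · simp [reassoc_of% h₅]
  · rw [hF']
    simp [reassoc_of% h₆]
  · rw [hα₀']
    simp [reassoc_of% h₇]
  · rw [hα₁']
    simp [reassoc_of% h₈]
  · infer_instance
  · intro W r hr
    rw [hα₁'] at hr
    obtain ⟨r', hr'⟩ := h₁₀ (r ≫ eR.hom) (by
      rw [← cancel_mono eS.inv, Category.assoc, Category.assoc, hr, Limits.zero_comp])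
    exact ⟨r' ≫ eR.inv, by simp [reassoc_of% hr']⟩

end CoconeFunctor

/-! ### Compatibility of the identifications with morphisms and with the differential of `E'`. -/

noncomputable section

namespace TwoRep
open BTensor (tmul add_tmul tmul_add zero_tmul tmul_zero op_smul_tmul smul_tmul' smul_tmul_right
  assocHom twoTensor lTensorX hom_eq_assoc twoTensor_assocHom)
variable {A E : Type u} [Ring A] [AddCommGroup E] [Module A E] [Module Aᵐᵒᵖ E]
  [SMulCommClass A Aᵐᵒᵖ E] (V : TwoRep A E)

section naturality
variable {N₁ N₂ : Type u} [AddCommGroup N₁] [Module A N₁] [Module A[X] N₁]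
  [IsScalarTower A A[X] N₁] [AddCommGroup N₂] [Module A N₂] [Module A[X] N₂]
  [IsScalarTower A A[X] N₂] {ψ : BTensor A[X] V.Ey N₂ →ₗ[A[X]] N₁}
  {N₁' N₂' : Type u} [AddCommGroup N₁'] [Module A N₁'] [Module A[X] N₁']
  [IsScalarTower A A[X] N₁'] [AddCommGroup N₂'] [Module A N₂'] [Module A[X] N₂']
  [IsScalarTower A A[X] N₂'] {ψ' : BTensor A[X] V.Ey N₂' →ₗ[A[X]] N₁'}

theorem sT_naturality (f : N₁ →ₗ[A[X]] N₁') (t : BTensor A E (BTensor A E N₁)) :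
    V.sT N₁' (lTensorX E (lTensorX E f) t) = lTensorX E (lTensorX E f) (V.sT N₁ t) := by
  have h : ∀ (u : BTensor A E E) (n : N₁), lTensorX E (lTensorX E f) (assocHom (tmul A u n)) =
      assocHom (tmul A u (f n)) := fun u n =>
    BTensor.hom_eq ((lTensorX E (lTensorX E f)).toAddMonoidHom.comp
      ((assocHom (S := A) (T := A) (M := E) (N := E) (P := N₁)).comp
        ((BTensor.tmulHom A (BTensor A E E) N₁).flip n)))
      ((assocHom (S := A) (T := A) (M := E) (N := E) (P := N₁')).comp
        ((BTensor.tmulHom A (BTensor A E E) N₁').flip (f n))) (fun _ _ => rfl) u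
  exact hom_eq_assoc ((V.sT N₁').toAddMonoidHom.comp (lTensorX E (lTensorX E f)).toAddMonoidHom)
    ((lTensorX E (lTensorX E f)).toAddMonoidHom.comp (V.sT N₁).toAddMonoidHom) (fun u n => by
      simp only [AddMonoidHom.comp_apply, LinearMap.toAddMonoidHom_coe, h, twoTensor_assocHom]) t

theorem sQ_naturality (f : N₁ →ₗ[A[X]] N₁') (w : BTensor A[X] V.Ey (BTensor A E N₁)) :
    V.sQ N₁' (BTensor.lTensor A[X] V.Ey (lTensorX E f) w) =
      lTensorX E (BTensor.lTensor A[X] V.Ey f) (V.sQ N₁ w) := by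
  obtain ⟨t, rfl⟩ := V.q_surjective _ w
  rw [← q_naturality, sQ_q, sQ_q, sT_naturality]
  refine BTensor.hom_eq ((lTensorX E (V.q N₁')).toAddMonoidHom.comp
    (lTensorX E (lTensorX E f)).toAddMonoidHom)
    ((lTensorX E (BTensor.lTensor A[X] V.Ey f)).toAddMonoidHom.comp
      (lTensorX E (V.q N₁)).toAddMonoidHom) (fun e n => ?_) _
  change tmul A e (V.q N₁' (lTensorX E f n)) = tmul A e (BTensor.lTensor A[X] V.Ey f (V.q N₁ n))
  rw [q_naturality]

/-- This is what makes the pair `(E ⊗ g₁, E ⊗ g₂)` a map of column modules. -/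
theorem lTensorX_ψF {g₁ : N₁ →ₗ[A[X]] N₁'} {g₂ : N₂ →ₗ[A[X]] N₂'}
    (h : ∀ t, g₁ (ψ t) = ψ' (BTensor.lTensor A[X] V.Ey g₂ t))
    (t : BTensor A[X] V.Ey (BTensor A E N₂)) :
    lTensorX E g₁ (V.ψF ψ t) = V.ψF ψ' (BTensor.lTensor A[X] V.Ey (lTensorX E g₂) t) := by
  rw [ψF_apply, ψF_apply, sQ_naturality]
  exact BTensor.hom_eq ((lTensorX E g₁).toAddMonoidHom.comp (lTensorX E ψ).toAddMonoidHom)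
    ((lTensorX E ψ').toAddMonoidHom.comp
      (lTensorX E (BTensor.lTensor A[X] V.Ey g₂)).toAddMonoidHom) (fun e n => by
      change tmul A e (g₁ (ψ n)) = tmul A e (ψ' (BTensor.lTensor A[X] V.Ey g₂ n))
      rw [h]) _

theorem lTensorX_kappa {g₁ : N₁ →ₗ[A[X]] N₁'} {g₂ : N₂ →ₗ[A[X]] N₂'}
    (h : ∀ t, g₁ (ψ t) = ψ' (BTensor.lTensor A[X] V.Ey g₂ t)) (t : V.EEy) (n : N₂) :
    lTensorX E g₁ (V.kappa ψ t n) = V.kappa ψ' t (g₂ n) :=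
  BTensor.hom_eq ((lTensorX E g₁).toAddMonoidHom.comp ((V.kappa ψ).flip n))
    ((V.kappa ψ').flip (g₂ n)) (fun p e => by
      change lTensorX E g₁ (eps N₁ (tmul A[X] p (ψ (tmul A[X] e n)))) =
        eps N₁' (tmul A[X] p (ψ' (tmul A[X] e (g₂ n))))
      rw [← eps_naturality, BTensor.lTensor_tmul, h, BTensor.lTensor_tmul]) t

theorem q_kappa (t : V.EEy) (n : N₂) : V.q N₁ (V.kappa ψ t n) = V.lam ψ (V.πEy t) n :=
  BTensor.hom_eq ((V.q N₁).toAddMonoidHom.comp ((V.kappa ψ).flip n))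
    (((V.lam ψ).flip n).comp V.πEy.toAddMonoidHom) (fun p e => by
      change V.q N₁ (eps N₁ (tmul A[X] p (ψ (tmul A[X] e n)))) =
        V.lam ψ (tmul A[X] (V.π.left p) e) n
      rw [q_eps, lam_tmul, BTensor.rTensor_tmul]) t

theorem E0Tri_naturality (g₁ : N₁ →ₗ[A[X]] N₁') (g₂ : N₂ →ₗ[A[X]] N₂')
    (h : ∀ t, g₁ (ψ t) = ψ' (BTensor.lTensor A[X] V.Ey g₂ t)) (t : BTensor V.B V.E0 (Tri ψ)) :
    V.E0Tri ψ' (BTensor.lTensor V.B V.E0 (Tri.map g₁ g₂ h) t) =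
      Tri.map (lTensorX E g₁) (lTensorX E g₂) (V.lTensorX_ψF h) (V.E0Tri ψ t) :=
  BTensor.hom_eq ((V.E0TriHom ψ').comp
      (BTensor.lTensor V.B V.E0 (Tri.map g₁ g₂ h)).toAddMonoidHom)
    ((Tri.map (lTensorX E g₁) (lTensorX E g₂) (V.lTensorX_ψF h)).toAddMonoidHom.comp
      (V.E0TriHom ψ)) (fun m n => by
      refine Prod.ext ?_ ?_
      · change eps N₁' (tmul A[X] m.1 (g₁ n.1)) + V.kappa ψ' m.2.1 (g₂ n.2) =
          lTensorX E g₁ (eps N₁ (tmul A[X] m.1 n.1) + V.kappa ψ m.2.1 n.2)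
        rw [map_add, ← eps_naturality, lTensorX_kappa V h, BTensor.lTensor_tmul]
      · change eps N₂' (tmul A[X] m.2.2 (g₂ n.2)) = lTensorX E g₂ (eps N₂ (tmul A[X] m.2.2 n.2))
        rw [← eps_naturality, BTensor.lTensor_tmul]) t

theorem E1Tri_naturality (g₁ : N₁ →ₗ[A[X]] N₁') (g₂ : N₂ →ₗ[A[X]] N₂')
    (h : ∀ t, g₁ (ψ t) = ψ' (BTensor.lTensor A[X] V.Ey g₂ t)) (t : BTensor V.B V.E1 (Tri ψ)) :
    V.E1Tri ψ' (BTensor.lTensor V.B V.E1 (Tri.map g₁ g₂ h) t) =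
      Tri.map (ψ := V.ψG N₁) (ψ' := V.ψG N₁') (BTensor.lTensor A[X] V.Ey g₁) g₁ (fun _ => rfl)
        (V.E1Tri ψ t) :=
  BTensor.hom_eq ((V.E1TriHom ψ').comp
      (BTensor.lTensor V.B V.E1 (Tri.map g₁ g₂ h)).toAddMonoidHom)
    ((Tri.map (ψ := V.ψG N₁) (ψ' := V.ψG N₁') (BTensor.lTensor A[X] V.Ey g₁) g₁
      (fun _ => rfl)).toAddMonoidHom.comp (V.E1TriHom ψ)) (fun m n => by
      have hl : ∀ t : V.EyEy, V.lam ψ' t (g₂ n.2) =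
          BTensor.lTensor A[X] V.Ey g₁ (V.lam ψ t n.2) :=
        BTensor.hom_eq ((V.lam ψ').flip (g₂ n.2))
          ((BTensor.lTensor A[X] V.Ey g₁).toAddMonoidHom.comp ((V.lam ψ).flip n.2))
          (fun p e => by
            change tmul A[X] p (ψ' (tmul A[X] e (g₂ n.2))) = tmul A[X] p (g₁ (ψ (tmul A[X] e n.2)))
            rw [h, BTensor.lTensor_tmul])
      refine Prod.ext ?_ ?_
      · change tmul A[X] m.1 (g₁ n.1) + V.lam ψ' m.2.1 (g₂ n.2) =
          BTensor.lTensor A[X] V.Ey g₁ (tmul A[X] m.1 n.1 + V.lam ψ m.2.1 n.2)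
        rw [map_add, hl, BTensor.lTensor_tmul]
      · change m.2.2.1 • g₁ n.1 + ψ' (tmul A[X] m.2.2.2 (g₂ n.2)) =
          g₁ (m.2.2.1 • n.1 + ψ (tmul A[X] m.2.2.2 n.2))
        rw [map_add, map_smul, h, BTensor.lTensor_tmul]) t

theorem lTensor_comp_apply {N₃ : Type u} [AddCommGroup N₃] [Module A[X] N₃] (f : N₁ →ₗ[A[X]] N₁')
    (g : N₃ →ₗ[A[X]] N₁) (t : BTensor A[X] V.Ey N₃) :
    BTensor.lTensor A[X] V.Ey (f.comp g) t =
      BTensor.lTensor A[X] V.Ey f (BTensor.lTensor A[X] V.Ey g t) :=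
  BTensor.hom_eq (BTensor.lTensor A[X] V.Ey (f.comp g)).toAddMonoidHom
    ((BTensor.lTensor A[X] V.Ey f).toAddMonoidHom.comp
      (BTensor.lTensor A[X] V.Ey g).toAddMonoidHom) (fun _ _ => rfl) t

/-- The `B`-linearity of the differential in column form. It rests on `q_sQ`: the twist by `s` in
the structure map of `E'⁰ ⊗_B (N₁; N₂)` disappears after projection to `E_y`. -/
theorem q_ψF (t : BTensor A[X] V.Ey (BTensor A E N₂)) :
    V.q N₁ (V.ψF ψ t) = V.ψG N₁ (BTensor.lTensor A[X] V.Ey (ψ.comp (V.q N₂)) t) := by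
  rw [ψF_apply, q_naturality, q_sQ, LinearMap.id_apply, lTensor_comp_apply]

-- The differential has zero in its `A[y]` entry and `π` elsewhere. Hence the bottom row, which
-- lands in `N₁`, sees `N₂` only through `ψ` after projection.
variable (ψ) in
theorem E1Tri_d (t : BTensor V.B V.E0 (Tri ψ)) : V.E1Tri ψ (BTensor.rTensor (Tri ψ) V.d t) =
    Tri.map (V.q N₁) (ψ.comp (V.q N₂)) V.q_ψF (V.E0Tri ψ t) :=
  BTensor.hom_eq ((V.E1TriHom ψ).comp (BTensor.rTensor (Tri ψ) V.d).toAddMonoidHom)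
    ((Tri.map (ψ' := V.ψG N₁) (V.q N₁) (ψ.comp (V.q N₂)) V.q_ψF).toAddMonoidHom.comp
      (V.E0TriHom ψ)) (fun m n => by
      refine Prod.ext ?_ ?_
      · change tmul A[X] (V.π.left m.1) n.1 + V.lam ψ (V.πEy m.2.1) n.2 =
          V.q N₁ (eps N₁ (tmul A[X] m.1 n.1) + V.kappa ψ m.2.1 n.2)
        rw [map_add, q_eps, q_kappa, BTensor.rTensor_tmul]
      · change (0 : A[X]) • n.1 + ψ (tmul A[X] (V.π.left m.2.2) n.2) =
          ψ (V.q N₂ (eps N₂ (tmul A[X] m.2.2 n.2)))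
        rw [zero_smul, zero_add, q_eps, BTensor.rTensor_tmul]) t

end naturality

end TwoRep
end

/-! ### Factoring maps into `E'E'(L; 0)` through `E'(E L; 0)`. -/

noncomputable section

theorem BTensor.subsingleton_right {S M N : Type*} [Ring S] [AddCommGroup M] [Module Sᵐᵒᵖ M]
    [AddCommGroup N] [Module S N] [Subsingleton N] : Subsingleton (BTensor S M N) :=
  subsingleton_of_forall_eq 0 (fun t => BTensor.hom_eq (AddMonoidHom.id _) 0 (fun m n => by
    rw [Subsingleton.elim n 0]; exact BTensor.tmul_zero m) t)

namespace TwoRep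
open BTensor (tmul add_tmul tmul_add zero_tmul tmul_zero op_smul_tmul smul_tmul' smul_tmul_right
  assocHom twoTensor lTensorX hom_eq_assoc twoTensor_assocHom)
variable {A E : Type u} [Ring A] [AddCommGroup E] [Module A E] [Module Aᵐᵒᵖ E]
  [SMulCommClass A Aᵐᵒᵖ E] (V : TwoRep A E)

section tri
variable {N₁ N₂ : Type u} [AddCommGroup N₁] [Module A N₁] [Module A[X] N₁]
  [IsScalarTower A A[X] N₁] [AddCommGroup N₂] [Module A N₂] [Module A[X] N₂]
  [IsScalarTower A A[X] N₂] (ψ : BTensor A[X] V.Ey N₂ →ₗ[A[X]] N₁)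
  {N₁' N₂' : Type u} [AddCommGroup N₁'] [Module A N₁'] [Module A[X] N₁']
  [IsScalarTower A A[X] N₁'] [AddCommGroup N₂'] [Module A N₂'] [Module A[X] N₂']
  [IsScalarTower A A[X] N₂'] {ψ' : BTensor A[X] V.Ey N₂' →ₗ[A[X]] N₁'}

/-- `Tri ψ` as an object of the category of `B`-modules. -/
abbrev triObj : ModuleCat.{u} V.B := ModuleCat.of V.B (Tri ψ)

variable {V ψ} in
/-- `Tri.map` as a morphism. -/
abbrev triHom (g₁ : N₁ →ₗ[A[X]] N₁') (g₂ : N₂ →ₗ[A[X]] N₂')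
    (h : ∀ t, g₁ (ψ t) = ψ' (BTensor.lTensor A[X] V.Ey g₂ t)) : V.triObj ψ ⟶ V.triObj ψ' :=
  ModuleCat.ofHom (Tri.map g₁ g₂ h)

/-- The functor `E'⁰ ⊗_B -`. -/
abbrev F0 : ModuleCat.{u} V.B ⥤ ModuleCat.{u} V.B := BTensor.functor V.B V.B V.E0

/-- The functor `E'¹ ⊗_B -`. -/
abbrev F1 : ModuleCat.{u} V.B ⥤ ModuleCat.{u} V.B := BTensor.functor V.B V.B V.E1

/-- `E0Tri` as an isomorphism of objects. -/
def e0 : V.F0.obj (V.triObj ψ) ≅ V.triObj (V.ψF ψ) := (V.E0Tri ψ).toModuleIso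

/-- `E1Tri` as an isomorphism of objects. -/
def e1 : V.F1.obj (V.triObj ψ) ≅ V.triObj (V.ψG N₁) := (V.E1Tri ψ).toModuleIso

variable {ψ} in
theorem F0_map_e0 (g₁ : N₁ →ₗ[A[X]] N₁') (g₂ : N₂ →ₗ[A[X]] N₂')
    (h : ∀ t, g₁ (ψ t) = ψ' (BTensor.lTensor A[X] V.Ey g₂ t)) :
    V.F0.map (triHom g₁ g₂ h) ≫ (V.e0 ψ').hom =
      (V.e0 ψ).hom ≫ triHom (lTensorX E g₁) (lTensorX E g₂) (V.lTensorX_ψF h) := by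
  ext t
  exact V.E0Tri_naturality g₁ g₂ h t

variable {ψ} in
theorem F1_map_e1 (g₁ : N₁ →ₗ[A[X]] N₁') (g₂ : N₂ →ₗ[A[X]] N₂')
    (h : ∀ t, g₁ (ψ t) = ψ' (BTensor.lTensor A[X] V.Ey g₂ t)) :
    V.F1.map (triHom g₁ g₂ h) ≫ (V.e1 ψ').hom =
      (V.e1 ψ).hom ≫ triHom (ψ := V.ψG N₁) (ψ' := V.ψG N₁') (BTensor.lTensor A[X] V.Ey g₁) g₁
        (fun _ => rfl) := by
  ext t
  exact V.E1Tri_naturality g₁ g₂ h t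

theorem dNat_e1 : V.dNat.app (V.triObj ψ) ≫ (V.e1 ψ).hom =
    (V.e0 ψ).hom ≫ triHom (V.q N₁) (ψ.comp (V.q N₂)) V.q_ψF := by
  ext t
  exact V.E1Tri_d ψ t

theorem triHom_comp {N₁'' N₂'' : Type u} [AddCommGroup N₁''] [Module A N₁''] [Module A[X] N₁'']
    [IsScalarTower A A[X] N₁''] [AddCommGroup N₂''] [Module A N₂''] [Module A[X] N₂'']
    [IsScalarTower A A[X] N₂''] {ψ'' : BTensor A[X] V.Ey N₂'' →ₗ[A[X]] N₁''}
    (g₁ : N₁ →ₗ[A[X]] N₁') (g₂ : N₂ →ₗ[A[X]] N₂')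
    (h : ∀ t, g₁ (ψ t) = ψ' (BTensor.lTensor A[X] V.Ey g₂ t))
    (g₁' : N₁' →ₗ[A[X]] N₁'') (g₂' : N₂' →ₗ[A[X]] N₂'')
    (h' : ∀ t, g₁' (ψ' t) = ψ'' (BTensor.lTensor A[X] V.Ey g₂' t)) :
    triHom g₁ g₂ h ≫ triHom g₁' g₂' h' = triHom (g₁' ∘ₗ g₁) (g₂' ∘ₗ g₂) (fun t => by
      rw [LinearMap.comp_apply, h, h', lTensor_comp_apply]) := rfl

theorem triHom_congr {g₁ g₁' : N₁ →ₗ[A[X]] N₁'} {g₂ g₂' : N₂ →ₗ[A[X]] N₂'}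
    (h : ∀ t, g₁ (ψ t) = ψ' (BTensor.lTensor A[X] V.Ey g₂ t))
    (h' : ∀ t, g₁' (ψ t) = ψ' (BTensor.lTensor A[X] V.Ey g₂' t)) (h₁ : ∀ n, g₁ n = g₁' n)
    (h₂ : ∀ n, g₂ n = g₂' n) : triHom g₁ g₂ h = triHom g₁' g₂' h' := by
  ext t
  exact Prod.ext (h₁ _) (h₂ _)

theorem triHom_eq_zero {g₁ : N₁ →ₗ[A[X]] N₁'} {g₂ : N₂ →ₗ[A[X]] N₂'}
    (h : ∀ t, g₁ (ψ t) = ψ' (BTensor.lTensor A[X] V.Ey g₂ t)) (h₁ : ∀ n, g₁ n = 0)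
    (h₂ : ∀ n, g₂ n = 0) : triHom g₁ g₂ h = 0 := by
  ext t
  exact Prod.ext (h₁ _) (h₂ _)

variable {V ψ} in
/-- An isomorphism given by its components. -/
def triIso (g₁ : N₁ ≃ₗ[A[X]] N₁') (g₂ : N₂ ≃ₗ[A[X]] N₂')
    (h : ∀ t, g₁ (ψ t) = ψ' (BTensor.lTensor A[X] V.Ey g₂.toLinearMap t)) :
    V.triObj ψ ≅ V.triObj ψ' where
  hom := triHom g₁.toLinearMap g₂.toLinearMap h
  inv := triHom g₁.symm.toLinearMap g₂.symm.toLinearMap (fun t => by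
    apply g₁.injective
    have := h (BTensor.lTensor A[X] V.Ey g₂.symm.toLinearMap t)
    rw [← lTensor_comp_apply, LinearEquiv.comp_symm] at this
    rw [this, LinearEquiv.coe_coe, LinearEquiv.apply_symm_apply]
    exact congrArg ψ' (BTensor.hom_eq (AddMonoidHom.id _)
      (BTensor.lTensor A[X] V.Ey (LinearMap.id (R := A[X]) (M := N₂'))).toAddMonoidHom
      (fun _ _ => rfl) t))
  hom_inv_id := by
    ext t
    exact Prod.ext (g₁.symm_apply_apply _) (g₂.symm_apply_apply _)
  inv_hom_id := by
    ext t
    exact Prod.ext (g₁.apply_symm_apply _) (g₂.apply_symm_apply _)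

end tri

variable (L L' : Type u) [AddCommGroup L] [Module A L] [Module A[X] L] [IsScalarTower A A[X] L]
  [AddCommGroup L'] [Module A L'] [Module A[X] L'] [IsScalarTower A A[X] L']

/-- The zero map to `L`. -/
abbrev zeroTo : BTensor A[X] V.Ey PUnit.{u + 1} →ₗ[A[X]] L := 0

/-- The `B`-module `(L; 0)`. -/
abbrev topObj : ModuleCat.{u} V.B := V.triObj (V.zeroTo L)

instance : Subsingleton (BTensor A E PUnit.{u + 1}) := BTensor.subsingleton_right

/-- `E'⁰ ⊗_B (L; 0) ≅ (E ⊗_A L; 0)`. -/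
def topIso : V.F0.obj (V.topObj L) ≅ V.topObj (BTensor A E L) :=
  V.e0 (V.zeroTo L) ≪≫ triIso (LinearEquiv.refl _ _)
    { (0 : BTensor A E PUnit.{u + 1} →ₗ[A[X]] PUnit.{u + 1}) with
      invFun := 0
      left_inv := fun _ => Subsingleton.elim _ _
      right_inv := fun _ => Subsingleton.elim _ _ } (fun t => by
    have : Subsingleton (BTensor A[X] V.Ey (BTensor A E PUnit.{u + 1})) :=
      BTensor.subsingleton_right
    rw [Subsingleton.elim t 0, map_zero, map_zero, map_zero, map_zero])

/-- The complex `E' ⊗_B (L; 0)`. -/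
def topCpx : V.Cpx :=
  V.E'.obj ((CochainComplex.singleFunctor (ModuleCat.{u} V.B) 0).obj (V.topObj L))

/-- The structure map of `G F S` is the identity and that of `F G S` is `sQ`, so the pair `(sQ, 1)`
is `B`-linear. -/
theorem sIso_aux (t : BTensor A[X] V.Ey (BTensor A E L)) : V.sQ L (V.ψG (BTensor A E L) t) =
    V.ψF (V.ψG L) (BTensor.lTensor A[X] V.Ey LinearMap.id t) := by
  have h1 : BTensor.lTensor A[X] V.Ey LinearMap.id t = t :=
    BTensor.hom_eq (BTensor.lTensor A[X] V.Ey LinearMap.id).toAddMonoidHom (AddMonoidHom.id _)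
      (fun _ _ => rfl) t
  have h2 : ∀ t, lTensorX E (V.ψG L) t = t :=
    BTensor.hom_eq (lTensorX E (V.ψG L)).toAddMonoidHom (AddMonoidHom.id _) (fun _ _ => rfl)
  rw [ψF_apply, h1, h2, LinearMap.id_apply]

/-- The isomorphism `σ : G F S ≅ F G S`. -/
def sIso : V.triObj (V.ψG (BTensor A E L)) ≅ V.triObj (V.ψF (V.ψG L)) :=
  triIso (LinearEquiv.ofBijective (V.sQ L) ⟨V.sQ_injective, V.sQ_surjective⟩)
    (LinearEquiv.refl A[X] (BTensor A E L)) (V.sIso_aux L)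

variable {V L L'} in
theorem mono_triHom {N₁ N₂ : Type u} [AddCommGroup N₁] [Module A N₁] [Module A[X] N₁]
    [IsScalarTower A A[X] N₁] [AddCommGroup N₂] [Module A N₂] [Module A[X] N₂]
    [IsScalarTower A A[X] N₂] {ψ : BTensor A[X] V.Ey N₂ →ₗ[A[X]] N₁}
    {N₁' N₂' : Type u} [AddCommGroup N₁'] [Module A N₁'] [Module A[X] N₁']
    [IsScalarTower A A[X] N₁'] [AddCommGroup N₂'] [Module A N₂'] [Module A[X] N₂']
    [IsScalarTower A A[X] N₂'] {ψ' : BTensor A[X] V.Ey N₂' →ₗ[A[X]] N₁'}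
    {g₁ : N₁ →ₗ[A[X]] N₁'} {g₂ : N₂ →ₗ[A[X]] N₂'}
    (h : ∀ t, g₁ (ψ t) = ψ' (BTensor.lTensor A[X] V.Ey g₂ t)) (h₁ : Function.Injective g₁)
    (h₂ : Function.Injective g₂) : Mono (triHom g₁ g₂ h) :=
  (ModuleCat.mono_iff_injective _).2 fun m n hmn =>
    Prod.ext (h₁ (congrArg Prod.fst hmn)) (h₂ (congrArg Prod.snd hmn))

/-- A morphism landing in the range of a monomorphism factors through it. -/
theorem _root_.ModuleCat.exists_factor_of_mono {R : Type*} [Ring R] {M N W : ModuleCat.{u} R}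
    (f : M ⟶ N) [Mono f] (r : W ⟶ N) (h : ∀ w, ∃ m, f m = r w) : ∃ r', r' ≫ f = r := by
  have hf := (ModuleCat.mono_iff_injective f).1 inferInstance
  let e := LinearEquiv.ofInjective f.hom hf
  refine ⟨ModuleCat.ofHom (e.symm.toLinearMap.comp
    (r.hom.codRestrict (LinearMap.range f.hom) (fun w => h w))), ?_⟩
  ext w
  exact congrArg Subtype.val (e.apply_symm_apply
    (r.hom.codRestrict (LinearMap.range f.hom) (fun w => h w) w))

/-- The isomorphism `F F S ≅ (E E L; 0)`. -/
abbrev eFF : V.F0.obj (V.F0.obj (V.topObj L)) ≅ V.triObj (V.ψF (V.ψF (V.zeroTo L))) :=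
  V.F0.mapIso (V.e0 (V.zeroTo L)) ≪≫ V.e0 _

/-- The isomorphism `G F S ≅ (E_y E L; E L)`. -/
abbrev eGF : V.F1.obj (V.F0.obj (V.topObj L)) ≅ V.triObj (V.ψG (BTensor A E L)) :=
  V.F1.mapIso (V.e0 (V.zeroTo L)) ≪≫ V.e1 _

/-- The isomorphism `F G S ≅ (E E_y L; E L)`. -/
abbrev eFG : V.F0.obj (V.F1.obj (V.topObj L)) ≅ V.triObj (V.ψF (V.ψG L)) :=
  V.F0.mapIso (V.e1 (V.zeroTo L)) ≪≫ V.e0 _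

/-- The isomorphism `G G S ≅ (E_y E_y L; E_y L)`. -/
abbrev eGG : V.F1.obj (V.F1.obj (V.topObj L)) ≅ V.triObj (V.ψG (BTensor A[X] V.Ey L)) :=
  V.F1.mapIso (V.e1 (V.zeroTo L)) ≪≫ V.e1 _

instance : Subsingleton (BTensor A E (BTensor A E PUnit.{u + 1})) := BTensor.subsingleton_right

instance {M : Type*} [AddCommGroup M] [Module (A[X])ᵐᵒᵖ M] :
    Subsingleton (BTensor A[X] M (BTensor A E (BTensor A E PUnit.{u + 1}))) :=
  BTensor.subsingleton_right

/-- An endomorphism of `(E E L; 0)`. -/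
abbrev endFF (f : BTensor A E (BTensor A E L) →ₗ[A[X]] BTensor A E (BTensor A E L)) :
    V.triObj (V.ψF (V.ψF (V.zeroTo L))) ⟶ V.triObj (V.ψF (V.ψF (V.zeroTo L))) :=
  triHom f LinearMap.id (fun t => by
    rw [Subsingleton.elim t 0, map_zero, map_zero, map_zero, map_zero])

/-- This and the next three statements compute the sides of the square `F F S`, `F G S`, `G F S`, `G
G S` for `S = (L; 0)`: on top entries each side is the projection `q`, applied to the inner factor
when the differential lies inside a functor and to the outer one otherwise. -/
theorem F0_map_dNat : V.F0.map (V.dNat.app (V.topObj L)) ≫ (V.eFG L).hom = (V.eFF L).hom ≫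
    triHom (lTensorX E (V.q L)) (lTensorX E ((V.zeroTo L).comp (V.q PUnit)))
      (V.lTensorX_ψF V.q_ψF) := by
  rw [Iso.trans_hom, Iso.trans_hom, Functor.mapIso_hom, Functor.mapIso_hom, ← Category.assoc,
    ← Functor.map_comp, dNat_e1, Functor.map_comp, Category.assoc, F0_map_e0, Category.assoc]

theorem F1_map_dNat : V.F1.map (V.dNat.app (V.topObj L)) ≫ (V.eGG L).hom = (V.eGF L).hom ≫
    triHom (ψ := V.ψG _) (ψ' := V.ψG _) (BTensor.lTensor A[X] V.Ey (V.q L)) (V.q L)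
      (fun _ => rfl) := by
  rw [Iso.trans_hom, Iso.trans_hom, Functor.mapIso_hom, Functor.mapIso_hom, ← Category.assoc,
    ← Functor.map_comp, dNat_e1, Functor.map_comp, Category.assoc, F1_map_e1, Category.assoc]

theorem dNat_F0 : V.dNat.app (V.F0.obj (V.topObj L)) ≫ (V.eGF L).hom = (V.eFF L).hom ≫
    triHom (V.q _) ((V.ψF (V.zeroTo L)).comp (V.q _)) V.q_ψF := by
  rw [Iso.trans_hom, Iso.trans_hom, Functor.mapIso_hom, Functor.mapIso_hom, Category.assoc,
    ← Category.assoc, ← V.dNat.naturality, Category.assoc, dNat_e1]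

theorem dNat_F1 : V.dNat.app (V.F1.obj (V.topObj L)) ≫ (V.eGG L).hom = (V.eFG L).hom ≫
    triHom (V.q _) ((V.ψG L).comp (V.q L)) V.q_ψF := by
  rw [Iso.trans_hom, Iso.trans_hom, Functor.mapIso_hom, Functor.mapIso_hom, Category.assoc,
    ← Category.assoc, ← V.dNat.naturality, Category.assoc, dNat_e1]

/-- By `sQ_mu`, the map `x - y` respects the structure map of `F G S`. The resulting endomorphism
plays the role of `μ₁` in the criterion. -/
theorem mu_ψF (t : BTensor A[X] V.Ey (BTensor A E L)) :
    V.mu (BTensor A[X] V.Ey L) (V.ψF (V.ψG L) t) =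
      V.ψF (V.ψG L) (BTensor.lTensor A[X] V.Ey (V.mu L) t) := by
  have h : ∀ t, lTensorX E (V.ψG L) t = t :=
    BTensor.hom_eq (lTensorX E (V.ψG L)).toAddMonoidHom (AddMonoidHom.id _) (fun _ _ => rfl)
  rw [ψF_apply, ψF_apply, h, h, sQ_mu]

theorem sIso_hom : (V.sIso L).hom = triHom (ψ := V.ψG _) (V.sQ L) LinearMap.id (V.sIso_aux L) :=
  rfl

/-- Hypothesis `h₃` of the criterion; its top entry is `q_sQ`. -/
theorem sIso_hom_comp : (V.sIso L).hom ≫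
    triHom (ψ' := V.ψG (BTensor A[X] V.Ey L)) (V.q _) ((V.ψG L).comp (V.q L)) V.q_ψF =
      triHom (ψ := V.ψG _) (ψ' := V.ψG _) (BTensor.lTensor A[X] V.Ey (V.q L)) (V.q L)
        (fun _ => rfl) := by
  rw [sIso_hom, triHom_comp]
  refine V.triHom_congr _ _ _ (fun n => ?_) (fun n => ?_)
  · rw [LinearMap.comp_apply, q_sQ]
  · rw [LinearMap.comp_apply, LinearMap.comp_apply, LinearMap.id_apply, LinearMap.id_apply]

/-- Every map from a complex in degrees `0`, `1` to `E' E' (L; 0)` is a combination of two fixed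
maps from `E' (E L; 0)`, provided that `x - y` acts injectively on `E L` and `E E_y L`. -/
theorem exists_topCpx_factor (hL : Function.Injective (V.mu L))
    (hL' : Function.Injective (V.mu (BTensor A[X] V.Ey L))) :
    ∃ β₁ β₂ : V.topCpx (BTensor A E L) ⟶ V.E'.obj (V.topCpx L), ∀ (K : V.Cpx)
      (hX : ∀ n : ℤ, n ≠ 0 → n ≠ 1 → Limits.IsZero (K.X n)) (φ : K ⟶ V.E'.obj (V.topCpx L)),
        ∃ g₁ g₂ : K ⟶ V.topCpx (BTensor A E L), φ = g₁ ≫ β₁ + g₂ ≫ β₂ := by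
  -- The criterion is stated for `F S` placed in degree `0`; `topIso` identifies `F S` with `(E L;
  -- 0)`.
  let i : V.topCpx (BTensor A E L) ≅
      V.E'.obj ((CochainComplex.singleFunctor _ 0).obj (V.F0.obj (V.topObj L))) :=
    V.E'.mapIso ((CochainComplex.singleFunctor _ 0).mapIso (V.topIso L).symm)
  obtain ⟨β₁, β₂, hβ⟩ := CoconeFunctor.exists_factor_of_iso V.dNat
    (CoconeFunctor.twoTermSingle V.dNat (V.topObj L))
    (CoconeFunctor.twoTermSingle V.dNat (V.F0.obj (V.topObj L)))
    (V.eFF L) (V.eGF L) (V.eFG L) (V.eGG L) _ _ _ _ (V.F0_map_dNat L) (V.F1_map_dNat L)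
    -- The bottom entry of `F F S` is zero, so `a`, `τ` and `μ₀` are given by their action on `E E
    -- L`. On `F G S` both entries matter, and `μ₁` is `x - y` on each.
    (V.dNat_F0 L) (V.dNat_F1 L) (V.endFF L (V.aT L)) (V.endFF L (V.τT L))
    (V.endFF L (V.mu (BTensor A E L)))
    (triHom (V.mu (BTensor A[X] V.Ey L)) (V.mu L) (V.mu_ψF L)) (V.sIso L)
    (by
      rw [sIso_hom, triHom_comp, triHom_comp]
      exact V.triHom_congr _ _ _ (fun n => V.lTensorX_q_aT n)
        (fun n => by rw [Subsingleton.elim n 0, map_zero, map_zero]))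
    (by
      rw [triHom_comp]
      exact V.triHom_congr _ _ _ (fun n => V.q_aT n)
        (fun n => by rw [Subsingleton.elim n 0, map_zero, map_zero]))
    (V.sIso_hom_comp L)
    (by ext t; exact Prod.ext (V.aT_apply t.1) (Subsingleton.elim _ _))
    (by
      rw [triHom_comp]
      exact V.triHom_congr _ _ _ (fun n => V.aT_τT n) (fun n => rfl))
    (by
      rw [triHom_comp, triHom_comp]
      exact V.triHom_congr _ _ _ (fun n => (V.mu_naturality (V.q L) n).symm)
        (fun n => by rw [Subsingleton.elim n 0, map_zero, map_zero]))
    (by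
      rw [triHom_comp]
      exact V.triHom_eq_zero _ _ (fun n => V.q_mu _ n)
        (fun n => by rw [Subsingleton.elim n 0, map_zero]))
    (by
      rw [triHom_comp]
      exact V.triHom_eq_zero _ _ (fun n => V.q_mu _ n) (fun n => V.q_mu L n))
    (mono_triHom _ hL' hL) (fun {W} r hr => by
      have := mono_triHom (V.mu_ψF L) hL' hL
      refine ModuleCat.exists_factor_of_mono _ r (fun w => ?_)
      have hw := ConcreteCategory.congr_hom hr w
      -- Both entries of `r w` are killed by the respective projection `q`, hence lie in the image
      -- of `mu`.
      obtain ⟨a, ha⟩ := V.exists_mu_eq (r w).1 (congrArg Prod.fst hw)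
      obtain ⟨b, hb⟩ := V.exists_mu_eq (r w).2 (congrArg Prod.snd hw)
      refine ⟨(Tri.mk (V.ψF (V.ψG L)) a b : Tri (V.ψF (V.ψG L))), ?_⟩
      exact Prod.ext ha hb)
  have hi : ∀ {K : V.Cpx} (g : K ⟶ _) (β : _ ⟶ V.E'.obj (V.topCpx L)),
      g ≫ β = (g ≫ i.inv) ≫ i.hom ≫ β := fun g β => by
    rw [Category.assoc, Iso.inv_hom_id_assoc]
  refine ⟨i.hom ≫ β₁, i.hom ≫ β₂, fun K hK φ => ?_⟩
  obtain ⟨g₁, g₂, h⟩ := hβ K hK φ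
  exact ⟨g₁ ≫ i.inv, g₂ ≫ i.inv, h.trans (congrArg₂ (· + ·) (hi g₁ β₁) (hi g₂ β₂))⟩

end TwoRep
end

/-! ### The modules `M[y]` and injectivity of `x - y`. -/

noncomputable section

/-- The `A[y]`-module `M[y]` of a left `A`-module `M`. -/
def LPoly (M : Type*) [AddCommGroup M] : Type _ := ℕ →₀ M

namespace LPoly
variable {A M : Type*} [Ring A] [AddCommGroup M] [Module A M]

instance : AddCommGroup (LPoly M) := inferInstanceAs (AddCommGroup (ℕ →₀ M))

instance : Module A (LPoly M) := inferInstanceAs (Module A (ℕ →₀ M))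

/-- The element `m yⁿ`. -/
def monomial (n : ℕ) : M →+ LPoly M := Finsupp.singleAddHom n

theorem hom_eq {P : Type*} [AddCommGroup P] (f g : LPoly M →+ P)
    (h : ∀ n m, f (monomial n m) = g (monomial n m)) (p : LPoly M) : f p = g p :=
  DFunLike.congr_fun (Finsupp.addHom_ext (M := M) (N := P) (f := f) (g := g) h) p

theorem smul_monomial (a : A) (n : ℕ) (m : M) : a • monomial n m = monomial n (a • m) :=
  Finsupp.smul_single a n m

/-- Multiplication by `y`. -/
def shift (A M : Type*) [Ring A] [AddCommGroup M] [Module A M] : LPoly M →ₗ[A] LPoly M :=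
  Finsupp.lmapDomain M A Nat.succ

instance : Module A[X] (LPoly M) := polyModule (shift A M)

instance : IsScalarTower A A[X] (LPoly M) :=
  isScalarTower_of_C_smul fun a t => polyModule_C_smul (shift A M) a t

theorem X_smul (p : LPoly M) : (X : A[X]) • p = shift A M p := polyModule_X_smul (shift A M) p

theorem X_smul_monomial (n : ℕ) (m : M) : (X : A[X]) • monomial n m = monomial (n + 1) m :=
  (X_smul _).trans Finsupp.mapDomain_single

theorem X_pow_smul_monomial (n j : ℕ) (m : M) :
    ((X : A[X]) ^ j) • monomial n m = monomial (n + j) m := by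
  induction j with
  | zero => rw [pow_zero, one_smul, add_zero]
  | succ j ih => rw [pow_succ', mul_smul, ih, X_smul_monomial, add_assoc]

/-- The additive map on `M[y]` with given values on monomials. -/
def lift {P : Type*} [AddCommGroup P] (f : ℕ → M →+ P) : LPoly M →+ P := Finsupp.liftAddHom f

@[simp]
theorem lift_monomial {P : Type*} [AddCommGroup P] (f : ℕ → M →+ P) (n : ℕ) (m : M) :
    lift f (monomial n m) = f n m := Finsupp.liftAddHom_apply_single f n m

/-- An additive map commuting with the constants is linear. -/
def liftLinear {P : Type*} [AddCommGroup P] [Module A P] (f : ℕ → M →ₗ[A] P) : LPoly M →ₗ[A] P :=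
  { lift (fun n => (f n).toAddMonoidHom) with
    map_smul' := fun a => hom_eq ((lift (fun n => (f n).toAddMonoidHom)).comp
        (DistribSMul.toAddMonoidHom (LPoly M) a))
      ((DistribSMul.toAddMonoidHom P a).comp (lift (fun n => (f n).toAddMonoidHom)))
      (fun n m => by
        simp only [AddMonoidHom.comp_apply, DistribSMul.toAddMonoidHom_apply, smul_monomial,
          lift_monomial, LinearMap.toAddMonoidHom_coe, map_smul]) }

@[simp]
theorem liftLinear_monomial {P : Type*} [AddCommGroup P] [Module A P] (f : ℕ → M →ₗ[A] P) (n : ℕ)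
    (m : M) : liftLinear f (monomial n m) = f n m :=
  lift_monomial (fun n => (f n).toAddMonoidHom) n m

/-- The monomials as linear maps. -/
def monomialₗ (A : Type*) {M : Type*} [Ring A] [AddCommGroup M] [Module A M] (n : ℕ) :
    M →ₗ[A] LPoly M := Finsupp.lsingle n

theorem monomialₗ_apply (n : ℕ) (m : M) : monomialₗ A n m = monomial n m := rfl

variable {M' : Type*} [AddCommGroup M'] [Module A M']

/-- The map `M[y] → M'[y]` induced by `f : M → M'`. -/
def map (f : M →ₗ[A] M') : LPoly M →ₗ[A[X]] LPoly M' :=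
  polyLinear (liftLinear (fun n => (monomialₗ A n).comp f)) (hom_eq
    ((liftLinear (fun n => (monomialₗ A n).comp f)).toAddMonoidHom.comp
      (DistribSMul.toAddMonoidHom (LPoly M) (X : A[X])))
    ((DistribSMul.toAddMonoidHom (LPoly M') (X : A[X])).comp
      (liftLinear (fun n => (monomialₗ A n).comp f)).toAddMonoidHom) (fun n m => by
        simp only [AddMonoidHom.comp_apply, DistribSMul.toAddMonoidHom_apply, X_smul_monomial,
          LinearMap.toAddMonoidHom_coe, liftLinear_monomial, LinearMap.comp_apply,
          monomialₗ_apply]))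

@[simp]
theorem map_monomial (f : M →ₗ[A] M') (n : ℕ) (m : M) :
    map f (monomial n m) = monomial n (f m) :=
  liftLinear_monomial (fun n => (monomialₗ A n).comp f) n m

/-- The coefficient of `yⁿ`. -/
def coeff (n : ℕ) : LPoly M →+ M := Finsupp.applyAddHom n

theorem coeff_monomial (n j : ℕ) (m : M) : coeff n (monomial j m) = if j = n then m else 0 :=
  Finsupp.single_apply

theorem coeff_map (f : M →ₗ[A] M') (n : ℕ) (p : LPoly M) : coeff n (map f p) = f (coeff n p) :=
  hom_eq ((coeff n).comp (map f).toAddMonoidHom) (f.toAddMonoidHom.comp (coeff n)) (fun j m => by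
    simp only [AddMonoidHom.comp_apply, LinearMap.toAddMonoidHom_coe, map_monomial,
      coeff_monomial]
    split_ifs
    · rfl
    · exact (map_zero f).symm) p

theorem coeff_succ_X_smul (n : ℕ) (p : LPoly M) : coeff (n + 1) ((X : A[X]) • p) = coeff n p :=
  hom_eq ((coeff (n + 1)).comp (DistribSMul.toAddMonoidHom (LPoly M) (X : A[X]))) (coeff n)
    (fun j m => by
      simp only [AddMonoidHom.comp_apply, DistribSMul.toAddMonoidHom_apply, X_smul_monomial,
        coeff_monomial, add_left_inj]) p

theorem exists_coeff_ne_zero {p : LPoly M} (hp : p ≠ 0) :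
    ∃ n, coeff n p ≠ 0 ∧ coeff (n + 1) p = 0 := by
  have hne : Finset.Nonempty (Finsupp.support (M := M) p) := Finsupp.support_nonempty_iff.2 hp
  refine ⟨Finset.max' _ hne, Finsupp.mem_support_iff.1 (Finset.max'_mem _ hne), ?_⟩
  by_contra h
  exact absurd (Finset.le_max' _ _ (Finsupp.mem_support_iff.2 h)) (by lia)

/-- If `f` acts on the coefficients of `p` as multiplication by `y`, then `p = 0`. -/
theorem eq_zero_of_map_eq_X_smul (f : M →ₗ[A] M) (p : LPoly M) (h : map f p = (X : A[X]) • p) :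
    p = 0 := by
  by_contra hp
  obtain ⟨n, hn, hn'⟩ := exists_coeff_ne_zero hp
  apply hn
  -- Compare coefficients of `yⁿ⁺¹`: multiplication by `y` gives the coefficient `n` of `p`, while
  -- `f` is applied to the coefficient `n + 1`, which is zero.
  rw [← coeff_succ_X_smul (A := A), ← h, coeff_map, hn', map_zero]

end LPoly

namespace TwoRep
open BTensor (tmul add_tmul tmul_add zero_tmul tmul_zero op_smul_tmul smul_tmul' smul_tmul_right
  assocHom twoTensor lTensorX hom_eq_assoc twoTensor_assocHom)
variable {A E : Type u} [Ring A] [AddCommGroup E] [Module A E] [Module Aᵐᵒᵖ E]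
  [SMulCommClass A Aᵐᵒᵖ E] (V : TwoRep A E)
variable {M : Type u} [AddCommGroup M] [Module A M]

/-- Two additive maps on `E ⊗_A M[y]` agree if they agree on the elements `e ⊗ m yⁿ`. -/
theorem hom_eq_polyTensor {R S N : Type*} [Ring S] [AddCommGroup N] [Module Sᵐᵒᵖ N]
    [Module S (LPoly M)] {P : Type*} [AddCommGroup P] (f g : BTensor S N (LPoly M) →+ P)
    (h : ∀ e n m, f (tmul S e (LPoly.monomial n m)) = g (tmul S e (LPoly.monomial n m)))
    (t : BTensor S N (LPoly M)) : f t = g t :=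
  BTensor.hom_eq f g (fun e p => LPoly.hom_eq (f.comp (BTensor.tmulHom S N (LPoly M) e))
    (g.comp (BTensor.tmulHom S N (LPoly M) e)) (h e) p) t

variable (A E M) in
/-- The pairing `(e, m yⁿ) ↦ (e ⊗ m) yⁿ`. -/
def polyPair : E →+ LPoly M →+ LPoly (BTensor A E M) :=
  AddMonoidHom.mk' (fun e => LPoly.lift (fun n =>
      (LPoly.monomial n).comp (BTensor.tmulHom A E M e)))
    (fun e e' => by
      ext p
      refine LPoly.hom_eq _ (LPoly.lift (fun n => (LPoly.monomial n).comp
        (BTensor.tmulHom A E M e)) + LPoly.lift (fun n => (LPoly.monomial n).comp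
          (BTensor.tmulHom A E M e'))) (fun n m => ?_) p
      rw [AddMonoidHom.add_apply, LPoly.lift_monomial, LPoly.lift_monomial, LPoly.lift_monomial]
      change LPoly.monomial n (tmul A (e + e') m) = _
      rw [add_tmul, map_add]
      rfl)

theorem polyPair_monomial (e : E) (n : ℕ) (m : M) :
    polyPair A E M e (LPoly.monomial n m) = LPoly.monomial n (tmul A e m) :=
  LPoly.lift_monomial _ n m

variable (A E M) in
/-- The map `E ⊗_A M[y] → (E ⊗_A M)[y]`. -/
def polyTensorHom : BTensor A E (LPoly M) →+ LPoly (BTensor A E M) :=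
  BTensor.lift (polyPair A E M) (fun a e p => by
    refine LPoly.hom_eq (polyPair A E M (op a • e))
      ((polyPair A E M e).comp (DistribSMul.toAddMonoidHom (LPoly M) a)) (fun n m => ?_) p
    rw [AddMonoidHom.comp_apply, DistribSMul.toAddMonoidHom_apply, LPoly.smul_monomial,
      polyPair_monomial, polyPair_monomial, op_smul_tmul])

theorem polyTensorHom_tmul (e : E) (n : ℕ) (m : M) :
    polyTensorHom A E M (tmul A e (LPoly.monomial n m)) = LPoly.monomial n (tmul A e m) :=
  polyPair_monomial e n m

variable (A E M) in
/-- The isomorphism `E ⊗_A M[y] ≅ (E ⊗_A M)[y]`. -/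
def polyTensor : BTensor A E (LPoly M) ≃ₗ[A[X]] LPoly (BTensor A E M) where
  toLinearMap := polyLinear
    { polyTensorHom A E M with
      map_smul' := fun a => hom_eq_polyTensor (R := A) ((polyTensorHom A E M).comp
          (DistribSMul.toAddMonoidHom _ a))
        ((DistribSMul.toAddMonoidHom (LPoly (BTensor A E M)) a).comp (polyTensorHom A E M))
        (fun e n m => by
          simp only [AddMonoidHom.comp_apply, DistribSMul.toAddMonoidHom_apply, smul_tmul',
            polyTensorHom_tmul, LPoly.smul_monomial]) }
    (hom_eq_polyTensor (R := A) ((polyTensorHom A E M).comp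
        (DistribSMul.toAddMonoidHom _ (X : A[X])))
      ((DistribSMul.toAddMonoidHom (LPoly (BTensor A E M)) (X : A[X])).comp (polyTensorHom A E M))
      (fun e n m => by
        simp only [AddMonoidHom.comp_apply, DistribSMul.toAddMonoidHom_apply, BTensor.X_smul_tmul,
          polyTensorHom_tmul, LPoly.X_smul_monomial]))
  invFun := LPoly.liftLinear (fun n => BTensor.lTensor A E (LPoly.monomialₗ A n))
  left_inv := hom_eq_polyTensor (R := A) ((LPoly.liftLinear (fun n =>
        BTensor.lTensor A E (LPoly.monomialₗ A n))).toAddMonoidHom.comp (polyTensorHom A E M))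
      (AddMonoidHom.id _) (fun e n m => by
        simp only [AddMonoidHom.comp_apply, LinearMap.toAddMonoidHom_coe, polyTensorHom_tmul,
          LPoly.liftLinear_monomial, BTensor.lTensor_tmul, LPoly.monomialₗ_apply]
        rfl)
  right_inv := LPoly.hom_eq ((polyTensorHom A E M).comp (LPoly.liftLinear (fun n =>
        BTensor.lTensor A E (LPoly.monomialₗ A n))).toAddMonoidHom) (AddMonoidHom.id _)
      (fun n => BTensor.hom_eq (((polyTensorHom A E M).comp (LPoly.liftLinear (fun n =>
        BTensor.lTensor A E (LPoly.monomialₗ A n))).toAddMonoidHom).comp (LPoly.monomial n))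
        (LPoly.monomial n) (fun e m => by
          simp only [AddMonoidHom.comp_apply, LinearMap.toAddMonoidHom_coe,
            LPoly.liftLinear_monomial, BTensor.lTensor_tmul, LPoly.monomialₗ_apply,
            polyTensorHom_tmul]))

theorem polyTensor_tmul (e : E) (n : ℕ) (m : M) :
    polyTensor A E M (tmul A e (LPoly.monomial n m)) = LPoly.monomial n (tmul A e m) :=
  polyTensorHom_tmul e n m

/-- `x - y` acts injectively on `E ⊗_A M[y]`. -/
theorem mu_LPoly_injective (M : Type u) [AddCommGroup M] [Module A M] :
    Function.Injective (V.mu (LPoly M)) := by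
  rw [injective_iff_map_eq_zero]
  intro t ht
  apply (polyTensor A E M).injective
  rw [map_zero]
  -- In `(E ⊗_A M)[y]`, the equation `mu t = 0` says that `x`, acting on coefficients, agrees with
  -- multiplication by `y`.
  refine LPoly.eq_zero_of_map_eq_X_smul (BTensor.rTensor M V.x) _ ?_
  have h : ∀ t, polyTensor A E M (V.mu (LPoly M) t) =
      LPoly.map (BTensor.rTensor M V.x) (polyTensor A E M t) - (X : A[X]) • polyTensor A E M t :=
    hom_eq_polyTensor (R := A) ((polyTensor A E M).toLinearMap.comp (V.mu (LPoly M))).toAddMonoidHom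
      ((LPoly.map (BTensor.rTensor M V.x)).toAddMonoidHom.comp
        (polyTensor A E M).toLinearMap.toAddMonoidHom -
        (DistribSMul.toAddMonoidHom _ (X : A[X])).comp
          (polyTensor A E M).toLinearMap.toAddMonoidHom) (fun e n m => by
        change polyTensor A E M (V.mu (LPoly M) (tmul A e (LPoly.monomial n m))) =
          LPoly.map (BTensor.rTensor M V.x) (polyTensor A E M (tmul A e (LPoly.monomial n m))) -
            (X : A[X]) • polyTensor A E M (tmul A e (LPoly.monomial n m))
        rw [mu_tmul, map_sub, LPoly.X_smul_monomial, polyTensor_tmul, polyTensor_tmul,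
          polyTensor_tmul, LPoly.X_smul_monomial, LPoly.map_monomial, BTensor.rTensor_tmul])
  have := h t
  rw [ht, map_zero] at this
  exact sub_eq_zero.1 this.symm

variable (M) in
/-- The pairing `(e, m yⁿ) ↦ xⁿ(e) ⊗ m`. -/
def evalPair : V.Ey →+ LPoly M →+ BTensor A E M :=
  AddMonoidHom.mk' (fun e => LPoly.lift (fun n =>
      BTensor.tmulHom A E M ((V.x.left ^ n) (V.toEy.symm e))))
    (fun e e' => by
      ext p
      refine LPoly.hom_eq _ (LPoly.lift (fun n =>
        BTensor.tmulHom A E M ((V.x.left ^ n) (V.toEy.symm e))) + LPoly.lift (fun n =>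
          BTensor.tmulHom A E M ((V.x.left ^ n) (V.toEy.symm e')))) (fun n m => ?_) p
      rw [AddMonoidHom.add_apply, LPoly.lift_monomial, LPoly.lift_monomial, LPoly.lift_monomial,
        map_add, map_add, map_add]
      rfl)

theorem evalPair_monomial (e : E) (n : ℕ) (m : M) :
    V.evalPair M (V.toEy e) (LPoly.monomial n m) = tmul A ((V.x.left ^ n) e) m :=
  LPoly.lift_monomial _ n m

variable (M) in
/-- The map `E_y ⊗_{A[y]} M[y] → E ⊗_A M`, `e ⊗ m yⁿ ↦ xⁿ(e) ⊗ m`. -/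
def evalHom : BTensor A[X] V.Ey (LPoly M) →+ BTensor A E M :=
  BTensor.lift (V.evalPair M) (balanced_of_C_X _ (fun a e p => by
      obtain ⟨e, rfl⟩ := V.toEy.surjective e
      refine LPoly.hom_eq (V.evalPair M (op (Polynomial.C a) • V.toEy e))
        ((V.evalPair M (V.toEy e)).comp
          (DistribSMul.toAddMonoidHom (LPoly M) (Polynomial.C a : A[X]))) (fun n m => ?_) p
      rw [AddMonoidHom.comp_apply, DistribSMul.toAddMonoidHom_apply, C_smul_eq (A := A),
        LPoly.smul_monomial, YMod.op_C_smul, evalPair_monomial, evalPair_monomial, V.pow_op,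
        op_smul_tmul]) (fun e p => by
      obtain ⟨e, rfl⟩ := V.toEy.surjective e
      refine LPoly.hom_eq (V.evalPair M (op X • V.toEy e)) ((V.evalPair M (V.toEy e)).comp
        (DistribSMul.toAddMonoidHom (LPoly M) (X : A[X]))) (fun n m => ?_) p
      rw [AddMonoidHom.comp_apply, DistribSMul.toAddMonoidHom_apply, LPoly.X_smul_monomial,
        YMod.op_X_smul, evalPair_monomial, evalPair_monomial, pow_succ]
      rfl))

theorem evalHom_tmul (e : E) (n : ℕ) (m : M) :
    V.evalHom M (tmul A[X] (V.toEy e) (LPoly.monomial n m)) = tmul A ((V.x.left ^ n) e) m :=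
  V.evalPair_monomial e n m

variable (M) in
/-- `evalHom` as an `A`-linear map. -/
def eval : BTensor A[X] V.Ey (LPoly M) →ₗ[A] BTensor A E M :=
  { V.evalHom M with
    map_smul' := fun a => hom_eq_polyTensor (R := A) ((V.evalHom M).comp
        (DistribSMul.toAddMonoidHom (BTensor A[X] V.Ey (LPoly M)) a))
      ((DistribSMul.toAddMonoidHom _ a).comp (V.evalHom M)) (fun e n m => by
        obtain ⟨e, rfl⟩ := V.toEy.surjective e
        change V.evalHom M (tmul A[X] (V.toEy (a • e)) (LPoly.monomial n m)) =
          a • V.evalHom M (tmul A[X] (V.toEy e) (LPoly.monomial n m))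
        rw [evalHom_tmul, evalHom_tmul, map_smul, smul_tmul']) }

theorem eval_X_smul (t : BTensor A[X] V.Ey (LPoly M)) :
    V.eval M ((X : A[X]) • t) = BTensor.rTensor M V.x (V.eval M t) :=
  hom_eq_polyTensor (R := A) ((V.evalHom M).comp (DistribSMul.toAddMonoidHom _ (X : A[X])))
    ((BTensor.rTensor M V.x).toAddMonoidHom.comp (V.evalHom M)) (fun e n m => by
      obtain ⟨e, rfl⟩ := V.toEy.surjective e
      change V.evalHom M (tmul A[X] ((X : A[X]) • V.toEy e) (LPoly.monomial n m)) =
        BTensor.rTensor M V.x (V.evalHom M (tmul A[X] (V.toEy e) (LPoly.monomial n m)))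
      rw [YMod.X_smul, evalHom_tmul, evalHom_tmul, BTensor.rTensor_tmul,
        ← Module.End.mul_apply, ← pow_succ, pow_succ', Module.End.mul_apply]) t

/-- Over `A[y]` the tensor `e ⊗ m yⁿ` equals `xⁿ(e) ⊗ m`, so `eval` has an `A`-linear left inverse.
Unlike bare injectivity, this survives `E ⊗_A -`. -/
theorem q_lTensor_eval (t : BTensor A[X] V.Ey (LPoly M)) :
    V.q (LPoly M) (BTensor.lTensor A E (LPoly.monomialₗ A 0) (V.eval M t)) = t :=
  hom_eq_polyTensor (R := A) ((V.q (LPoly M)).toAddMonoidHom.comp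
    ((BTensor.lTensor A E (LPoly.monomialₗ A 0)).toAddMonoidHom.comp (V.evalHom M)))
    (AddMonoidHom.id _) (fun e n m => by
      obtain ⟨e, rfl⟩ := V.toEy.surjective e
      change V.q (LPoly M) (BTensor.lTensor A E (LPoly.monomialₗ A 0) (V.evalHom M
        (tmul A[X] (V.toEy e) (LPoly.monomial n m)))) = tmul A[X] (V.toEy e) (LPoly.monomial n m)
      rw [evalHom_tmul, BTensor.lTensor_tmul, q_tmul, LPoly.monomialₗ_apply]
      have h := LPoly.X_pow_smul_monomial (A := A) 0 n m
      rw [zero_add] at h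
      rw [← h, ← op_smul_tmul]
      congr 1
      clear h
      induction n generalizing e with
      | zero => rw [pow_zero, pow_zero, op_one, one_smul]; rfl
      | succ n ih =>
        rw [pow_succ, Module.End.mul_apply, ih, ← YMod.op_X_smul, ← mul_smul, ← op_mul,
          ← pow_succ']) t

/-- `x - y` acts injectively on `E ⊗_A (E_y ⊗_{A[y]} M[y])` if `x₂ - x₁` does on
`E ⊗_A (E ⊗_A M)`. -/
theorem mu_Ey_LPoly_injective (h : ∀ t : BTensor A E (BTensor A E M),
      BTensor.rTensor (BTensor A E M) V.x t = BTensor.lTensor A E (BTensor.rTensor M V.x) t →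
        t = 0) :
    Function.Injective (V.mu (BTensor A[X] V.Ey (LPoly M))) := by
  rw [injective_iff_map_eq_zero]
  intro t ht
  -- Under `eval`, the action of `y` on `E_y ⊗ M[y]` becomes `x` on `E ⊗_A M`, so `mu t = 0` becomes
  -- the agreement of the two copies of `x` on `E ⊗_A (E ⊗_A M)`.
  have h0 : BTensor.lTensor A E (V.eval M) t = 0 := by
    apply h
    have hc : ∀ t, BTensor.lTensor A E (V.eval M) (V.mu _ t) =
        BTensor.rTensor (BTensor A E M) V.x (BTensor.lTensor A E (V.eval M) t) -
          BTensor.lTensor A E (BTensor.rTensor M V.x) (BTensor.lTensor A E (V.eval M) t) :=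
      BTensor.hom_eq ((BTensor.lTensor A E (V.eval M)).toAddMonoidHom.comp
          (V.mu (BTensor A[X] V.Ey (LPoly M))).toAddMonoidHom)
        ((BTensor.rTensor (BTensor A E M) V.x - BTensor.lTensor A E
          (BTensor.rTensor M V.x)).toAddMonoidHom.comp
            (BTensor.lTensor A E (V.eval M)).toAddMonoidHom) (fun e n => by
          change BTensor.lTensor A E (V.eval M) (V.mu _ (tmul A e n)) =
            tmul A (V.x.left e) (V.eval M n) - tmul A e (BTensor.rTensor M V.x (V.eval M n))
          rw [mu_tmul, map_sub, BTensor.lTensor_tmul, BTensor.lTensor_tmul, eval_X_smul])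
    have := hc t
    rw [ht, map_zero] at this
    exact sub_eq_zero.1 this.symm
  have h1 : BTensor.lTensor A E ((V.q (LPoly M)).restrictC.comp
      (BTensor.lTensor A E (LPoly.monomialₗ A 0))) (BTensor.lTensor A E (V.eval M) t) = t :=
    BTensor.hom_eq ((BTensor.lTensor A E ((V.q (LPoly M)).restrictC.comp
      (BTensor.lTensor A E (LPoly.monomialₗ A 0)))).toAddMonoidHom.comp
        (BTensor.lTensor A E (V.eval M)).toAddMonoidHom) (AddMonoidHom.id _) (fun e n => by
      change tmul A e (V.q (LPoly M) (BTensor.lTensor A E (LPoly.monomialₗ A 0) (V.eval M n))) =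
        tmul A e n
      rw [q_lTensor_eval]) t
  rw [← h1, h0, map_zero]

theorem xEnd_last (n : ℕ) :
    V.xEnd (n + 1) (Fin.last n) = BTensor.rTensor (tensorPow A E n) V.x :=
  Fin.lastCases_last

theorem xEnd_castSucc (n : ℕ) (i : Fin n) :
    V.xEnd (n + 1) i.castSucc = BTensor.lTensor A E (V.xEnd n i) :=
  Fin.lastCases_castSucc i

/-- A free module over the domain `Pₙ` is torsion-free, and `xᵢ - xⱼ` is nonzero for `i ≠ j`. -/
theorem PowFree.eq_zero {k : Type*} [Field k] [Algebra k A] {n : ℕ} (h : V.PowFree k n)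
    {i j : Fin n} (hij : i ≠ j) (t : tensorPow A E n) (ht : V.xEnd n i t = V.xEnd n j t) :
    t = 0 := by
  obtain ⟨_, _, hX, _⟩ := h
  rw [← hX, ← hX, ← sub_eq_zero, ← sub_smul] at ht
  refine (smul_eq_zero.1 ht).resolve_left (fun h0 => hij ?_)
  exact MvPolynomial.X_injective (sub_eq_zero.1 h0)

/-- For `M = Eⁿ`, the two copies of `x` act on the two leftmost factors of `Eⁿ⁺²`: they are `xₙ₊₂`
and `xₙ₊₁`, here with the indices `Fin.last (n + 1)` and `(Fin.last n).castSucc`. -/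
theorem mu_tensorPow_injective {k : Type*} [Field k] [Algebra k A] (n : ℕ)
    (h : V.PowFree k (n + 2)) :
    Function.Injective (V.mu (BTensor A[X] V.Ey (LPoly (tensorPow A E n)))) := by
  refine V.mu_Ey_LPoly_injective (fun t ht => ?_)
  refine PowFree.eq_zero V h (i := Fin.last (n + 1)) (j := (Fin.last n).castSucc)
    (Fin.castSucc_lt_last _).ne' t ?_
  rw [xEnd_last, xEnd_castSucc, xEnd_last]
  exact ht

end TwoRep
end

/-! ### Summands of finite sums of copies, and `Ẽ ⊗_C Hom(X, Y)`. -/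

noncomputable section

section InAdd
universe v v' w w'
variable {𝒞 : Type w} [Category.{v} 𝒞] [Preadditive 𝒞] {𝒟 : Type w'} [Category.{v'} 𝒟]
  [Preadditive 𝒟]

/-- The object `Y` is a direct summand of a finite direct sum of copies of `Z`. -/
def InAdd (Y Z : 𝒞) : Prop :=
  ∃ (ι : Type) (_ : Fintype ι) (f : ι → (Y ⟶ Z)) (g : ι → (Z ⟶ Y)), ∑ i, f i ≫ g i = 𝟙 Y

theorem InAdd.of_retract {Y Z : 𝒞} (f : Y ⟶ Z) (g : Z ⟶ Y) (h : f ≫ g = 𝟙 Y) : InAdd Y Z :=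
  ⟨Unit, inferInstance, fun _ => f, fun _ => g, by simpa using h⟩

theorem InAdd.map {Y Z : 𝒞} (h : InAdd Y Z) (F : 𝒞 ⥤ 𝒟) [F.Additive] :
    InAdd (F.obj Y) (F.obj Z) := by
  obtain ⟨ι, _, f, g, h⟩ := h
  refine ⟨ι, inferInstance, fun i => F.map (f i), fun i => F.map (g i), ?_⟩
  simp only [← F.map_comp]
  rw [← F.map_sum, h, F.map_id]

theorem InAdd.trans {Y Z W : 𝒞} (h : InAdd Y Z) (h' : InAdd Z W) : InAdd Y W := by
  obtain ⟨ι, _, f, g, h⟩ := h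
  obtain ⟨κ, _, f', g', h'⟩ := h'
  refine ⟨ι × κ, inferInstance, fun i => f i.1 ≫ f' i.2, fun i => g' i.2 ≫ g i.1, ?_⟩
  rw [Fintype.sum_prod_type, ← h]
  refine Finset.sum_congr rfl fun i _ => ?_
  calc ∑ j, (f i ≫ f' j) ≫ g' j ≫ g i = f i ≫ (∑ j, f' j ≫ g' j) ≫ g i := by
        rw [Preadditive.sum_comp, Preadditive.comp_sum]
        simp only [Category.assoc]
    _ = f i ≫ g i := by rw [h', Category.id_comp]

end InAdd

section modules
variable {A : Type u} [Ring A]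

/-- The coordinates of a retraction of a finite free module onto `E`. -/
theorem inAdd_of_finite_projective (E : Type u) [AddCommGroup E] [Module A E] [Module.Finite A E]
    [Module.Projective A E] : InAdd (ModuleCat.of A E) (ModuleCat.of A A) := by
  obtain ⟨n, f, g, -, -, h⟩ := Module.Finite.exists_comp_eq_id_of_projective A E
  refine ⟨Fin n, inferInstance, fun i => ModuleCat.ofHom ((LinearMap.proj i).comp g),
    fun i => ModuleCat.ofHom (f.comp (LinearMap.single A (fun _ => A) i)), ?_⟩
  ext e
  have := LinearMap.congr_fun h e
  refine Eq.trans ?_ this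
  rw [ModuleCat.hom_sum, LinearMap.sum_apply]
  change ∑ i, f (Pi.single i (g e i)) = f (g e)
  rw [← map_sum, Finset.univ_sum_single]

variable {E : Type u} [AddCommGroup E] [Module A E] [Module Aᵐᵒᵖ E] [SMulCommClass A Aᵐᵒᵖ E]

variable (A E) in
/-- The map `E ⊗_A A → E` as an additive map. -/
def tensorRidHom : BTensor A E A →+ E :=
  BTensor.lift (AddMonoidHom.mk' (fun e => AddMonoidHom.mk' (fun a => op a • e)
      (fun a b => by rw [MulOpposite.op_add, add_smul]))
    (fun e e' => by ext a; exact smul_add _ _ _)) (fun a e b => by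
      change op b • op a • e = op (a * b) • e
      rw [op_mul, mul_smul])

variable (A E) in
/-- The map `E ⊗_A A → E`. -/
def tensorRid : BTensor A E A →ₗ[A] E :=
  { tensorRidHom A E with
    map_smul' := fun a => BTensor.hom_eq
      ((tensorRidHom A E).comp (DistribSMul.toAddMonoidHom _ a))
      ((DistribSMul.toAddMonoidHom E a).comp (tensorRidHom A E))
      (fun e b => (smul_comm a (op b) e).symm) }

/-- `E ⊗_A -` carries a summand of `Aʳ` to a summand of `(E ⊗_A A)ʳ`; moreover `E ⊗_A A` is a
retract of `E`, and `E` is a summand of a finite free module. -/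
theorem inAdd_tensorPow [Module.Finite A E] [Module.Projective A E] (n : ℕ) :
    InAdd (tensorPow A E n) (ModuleCat.of A A) := by
  induction n with
  | zero => exact InAdd.of_retract (𝟙 _) (𝟙 _) (Category.id_comp _)
  | succ n ih =>
    refine (ih.map (BTensor.functor A A E)).trans (InAdd.trans ?_ (inAdd_of_finite_projective E))
    refine InAdd.of_retract (ModuleCat.ofHom (tensorRid A E)) (ModuleCat.ofHom
      { toFun := fun e => BTensor.tmul A e (1 : A)
        map_add' := fun e e' => BTensor.add_tmul e e' _
        map_smul' := fun a e => rfl }) ?_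
    ext t
    refine BTensor.hom_eq (AddMonoidHom.comp (AddMonoidHom.mk' (fun e => BTensor.tmul A e (1 : A))
      (fun e e' => BTensor.add_tmul e e' _)) (tensorRidHom A E))
        (AddMonoidHom.id (BTensor A E A)) (fun e a => ?_) t
    change BTensor.tmul A (op a • e) (1 : A) = BTensor.tmul A e a
    rw [BTensor.op_smul_tmul, smul_eq_mul, mul_one]

theorem JointlySurjective.comp {ι : Type*} {M M' : ModuleCat.{u} A} {N : ι → ModuleCat.{u} A}
    {f : ∀ i, N i ⟶ M} (h : JointlySurjective f) (p : M ⟶ M') (hp : Function.Surjective p.hom) :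
    JointlySurjective (fun i => f i ≫ p) := by
  refine eq_top_iff.2 fun m hm => ?_
  clear hm
  obtain ⟨m, rfl⟩ := hp m
  have hm : m ∈ AddSubgroup.closure (⋃ i, Set.range (f i).hom) := by rw [h]; trivial
  induction hm using AddSubgroup.closure_induction with
  | mem m hm =>
    obtain ⟨i, n, rfl⟩ := Set.mem_iUnion.1 hm
    exact AddSubgroup.subset_closure (Set.mem_iUnion.2 ⟨i, n, rfl⟩)
  | zero => rw [map_zero]; exact zero_mem _
  | add a b _ _ ha hb => rw [map_add]; exact add_mem ha hb
  | neg a _ ha => rw [map_neg]; exact neg_mem ha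

theorem jointlySurjective_of_surjective {M N : ModuleCat.{u} A} (p : N ⟶ M)
    (hp : Function.Surjective p.hom) : JointlySurjective (fun _ : Unit => p) :=
  eq_top_iff.2 fun m _ => by
    obtain ⟨n, rfl⟩ := hp m
    exact AddSubgroup.subset_closure (Set.mem_iUnion.2 ⟨(), n, rfl⟩)

end modules

namespace TwoRep
variable {A E : Type u} [Ring A] [AddCommGroup E] [Module A E] [Module Aᵐᵒᵖ E]
  [SMulCommClass A Aᵐᵒᵖ E] (V : TwoRep A E)

/-- The `C`-module `Hom(X, Y)`. -/
def HomX (Y : V.K) : Type u := V.XX ⟶ Y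

instance (Y : V.K) : AddCommGroup (V.HomX Y) := inferInstanceAs (AddCommGroup (V.XX ⟶ Y))

instance (Y : V.K) : Module V.C (V.HomX Y) where
  smul c f := c.hom ≫ (f : V.XX ⟶ Y)
  one_smul f := Category.id_comp (f : V.XX ⟶ Y)
  mul_smul b c f := Category.assoc b.hom c.hom (f : V.XX ⟶ Y)
  smul_zero _ := Limits.comp_zero
  smul_add c f g := Preadditive.comp_add _ _ _ c.hom (f : V.XX ⟶ Y) g
  add_smul b c f := Preadditive.add_comp _ _ _ b.hom c.hom (f : V.XX ⟶ Y)
  zero_smul _ := Limits.zero_comp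

/-- `Hom(X, Y)` as an object. -/
abbrev homX (Y : V.K) : ModuleCat.{u} V.C := ModuleCat.of V.C (V.HomX Y)

variable {V} in
/-- Composition with a morphism. -/
def homXMap {Y Z : V.K} (g : Y ⟶ Z) : V.homX Y ⟶ V.homX Z := ModuleCat.ofHom
  { toFun := fun f => (f : V.XX ⟶ Y) ≫ g
    map_add' := fun f f' => Preadditive.add_comp _ _ _ (f : V.XX ⟶ Y) f' g
    map_smul' := fun c f => Category.assoc c.hom (f : V.XX ⟶ Y) g }

/-- Write the identity of `Y` as a sum of composites `fᵢ ≫ gᵢ` through `X`, and send `k` to the sum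
of the `(k ≫ E'(fᵢ)) ⊗ gᵢ`. Then `a ≫ E'(b)` goes to `a ⊗ b`: each `b ≫ fᵢ` is an element of `C`, it
moves across the tensor sign, and the `(b ≫ fᵢ) ≫ gᵢ` add up to `b`. -/
theorem exists_surjective_tensor {Y : V.K} (hY : InAdd Y V.XX) :
    ∃ p : V.homX (V.E'K.obj Y) ⟶ (BTensor.functor V.C V.C V.Etilde).obj (V.homX Y),
      Function.Surjective p.hom := by
  obtain ⟨ι, _, f, g, h⟩ := hY
  let p : V.HomX (V.E'K.obj Y) →ₗ[V.C] BTensor V.C V.Etilde (V.HomX Y) :=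
    { toFun := fun k => ∑ i, BTensor.tmul V.C
        (show V.Etilde from (k : V.XX ⟶ V.E'K.obj Y) ≫ V.E'K.map (f i)) (show V.HomX Y from g i)
      map_add' := fun k k' => by
        rw [← Finset.sum_add_distrib]
        refine Finset.sum_congr rfl fun i _ => ?_
        rw [← BTensor.add_tmul]
        exact congrArg (fun z => BTensor.tmul V.C z (show V.HomX Y from g i))
          (Preadditive.add_comp _ _ _ (k : V.XX ⟶ V.E'K.obj Y) k' _)
      map_smul' := fun c k => by
        rw [Finset.smul_sum]
        refine Finset.sum_congr rfl fun i _ => ?_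
        rw [RingHom.id_apply, BTensor.smul_tmul']
        exact congrArg (fun z => BTensor.tmul V.C z (show V.HomX Y from g i))
          (Category.assoc c.hom (k : V.XX ⟶ V.E'K.obj Y) _) }
  refine ⟨ModuleCat.ofHom p, fun t => BTensor.addSubgroup_eq_top p.toAddMonoidHom.range
    (fun a b => ⟨(show V.XX ⟶ V.E'K.obj V.XX from a) ≫ V.E'K.map (show V.XX ⟶ Y from b), ?_⟩) t⟩
  let c : ι → V.C := fun i => MulOpposite.op (α := End V.XX) ((show V.XX ⟶ Y from b) ≫ f i)
  have h1 : ∀ i, (show V.Etilde from ((show V.XX ⟶ V.E'K.obj V.XX from a) ≫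
      V.E'K.map (show V.XX ⟶ Y from b)) ≫ V.E'K.map (f i)) = op (c i) • a := fun i =>
    (Category.assoc _ _ _).trans (congrArg _ (V.E'K.map_comp _ _).symm)
  change ∑ i, BTensor.tmul V.C (show V.Etilde from ((show V.XX ⟶ V.E'K.obj V.XX from a) ≫
      V.E'K.map (show V.XX ⟶ Y from b)) ≫ V.E'K.map (f i)) (show V.HomX Y from g i) =
    BTensor.tmul V.C a b
  have h2 : ∑ i, (c i • (show V.HomX Y from g i)) = b := by
    refine Eq.trans ?_ (Category.comp_id (show V.XX ⟶ Y from b))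
    rw [← h, Preadditive.comp_sum]
    exact Finset.sum_congr rfl fun i _ => Category.assoc _ _ _
  refine (Finset.sum_congr rfl fun i _ => (congrArg (fun z => BTensor.tmul V.C z
    (show V.HomX Y from g i)) (h1 i)).trans (BTensor.op_smul_tmul (c i) a _)).trans ?_
  refine Eq.trans ?_ (congrArg (BTensor.tmul V.C a) h2)
  exact (map_sum (BTensor.tmulHom V.C V.Etilde (V.HomX Y) a)
    (fun i => c i • (show V.HomX Y from g i)) Finset.univ).symm

end TwoRep
end

/-! ### The functor `T` and the induction on powers of `Ẽ`. -/

noncomputable section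

namespace LPoly
variable {A M N P : Type*} [Ring A] [AddCommGroup M] [Module A M] [AddCommGroup N] [Module A N]
  [AddCommGroup P] [Module A P]

theorem map_id (p : LPoly M) : map (LinearMap.id : M →ₗ[A] M) p = p :=
  hom_eq (map (LinearMap.id : M →ₗ[A] M)).toAddMonoidHom (AddMonoidHom.id _)
    (fun n m => map_monomial _ n m) p

theorem map_comp (f : M →ₗ[A] N) (g : N →ₗ[A] P) (p : LPoly M) :
    map (g.comp f) p = map g (map f p) :=
  hom_eq (map (g.comp f)).toAddMonoidHom ((map g).toAddMonoidHom.comp (map f).toAddMonoidHom)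
    (fun n m => by
      simp only [AddMonoidHom.comp_apply, LinearMap.toAddMonoidHom_coe, map_monomial,
        LinearMap.comp_apply]) p

theorem map_add (f g : M →ₗ[A] N) (p : LPoly M) : map (f + g) p = map f p + map g p :=
  hom_eq (map (f + g)).toAddMonoidHom ((map f).toAddMonoidHom + (map g).toAddMonoidHom)
    (fun n m => by
      simp only [AddMonoidHom.add_apply, LinearMap.toAddMonoidHom_coe, map_monomial,
        LinearMap.add_apply, _root_.map_add]) p

theorem coeff_smul_monomial_one (p : A[X]) (n : ℕ) :
    coeff n (p • (monomial 0 (1 : A) : LPoly A)) = p.coeff n := by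
  induction p using Polynomial.induction_on' with
  | add p q hp hq => rw [add_smul, _root_.map_add, hp, hq, coeff_add]
  | monomial j a =>
    rw [← C_mul_X_pow_eq_monomial, mul_smul, X_pow_smul_monomial, C_smul_eq (A := A),
      smul_monomial, coeff_monomial, C_mul_X_pow_eq_monomial, Polynomial.coeff_monomial, zero_add,
      smul_eq_mul, mul_one]

theorem exists_smul_monomial_one (p : LPoly A) :
    ∃ q : A[X], q • (monomial 0 (1 : A) : LPoly A) = p := by
  let f : A[X] →+ LPoly A := (AddMonoidHom.flip (smulAddHom A[X] (LPoly A))) (monomial 0 1)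
  have h : AddMonoidHom.comp f (lift (fun n => (Polynomial.monomial n).toAddMonoidHom)) =
      AddMonoidHom.id (LPoly A) := by
    ext p
    refine hom_eq _ (AddMonoidHom.id (LPoly A)) (fun n a => ?_) p
    rw [AddMonoidHom.comp_apply, lift_monomial]
    change (Polynomial.monomial n a : A[X]) • (monomial 0 (1 : A) : LPoly A) = monomial n a
    rw [← C_mul_X_pow_eq_monomial, mul_smul, X_pow_smul_monomial, C_smul_eq (A := A),
      smul_monomial, zero_add, smul_eq_mul, mul_one]
  exact ⟨_, DFunLike.congr_fun h p⟩

end LPoly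

namespace TwoRep
open BTensor (tmul add_tmul tmul_add zero_tmul tmul_zero op_smul_tmul smul_tmul' smul_tmul_right
  assocHom twoTensor lTensorX hom_eq_assoc twoTensor_assocHom)
variable {A E : Type u} [Ring A] [AddCommGroup E] [Module A E] [Module Aᵐᵒᵖ E]
  [SMulCommClass A Aᵐᵒᵖ E] (V : TwoRep A E)

/-- The functor `M ↦ (M[y]; 0)`. -/
def polyTop : ModuleCat.{u} A ⥤ ModuleCat.{u} V.B where
  obj M := V.topObj (LPoly M)
  map f := triHom (LPoly.map f.hom) LinearMap.id (fun t => map_zero _)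
  map_id M := by
    ext t
    exact Prod.ext (LPoly.map_id _) rfl
  map_comp f g := by
    ext t
    exact Prod.ext (LPoly.map_comp f.hom g.hom _) rfl

instance : V.polyTop.Additive where
  map_add {M N f g} := by
    ext t
    exact Prod.ext (LPoly.map_add f.hom g.hom _) (Subsingleton.elim (α := PUnit) _ _)

/-- The quotient functor to the homotopy category. -/
abbrev Q : V.Cpx ⥤ V.K := HomotopyCategory.quotient _ _

/-- The functor `M ↦ E' ⊗_B (M[y]; 0)`. -/
abbrev TK : ModuleCat.{u} A ⥤ V.K :=
  V.polyTop ⋙ CochainComplex.singleFunctor (ModuleCat.{u} V.B) 0 ⋙ V.E' ⋙ V.Q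

theorem smul_e₁ (b : V.B) : b • V.e₁ = (show V.B from (b.1, 0, 0)) := by
  refine B_ext V (mul_one b.1) ?_ (mul_zero b.2.2)
  change b.1 • (0 : V.Ey) + op (0 : A[X]) • b.2.1 = 0
  rw [smul_zero, op_zero, zero_smul, add_zero]

/-- The isomorphism `B e₁ ≅ (A[y]; 0)`. -/
def spanIso : ModuleCat.of V.B (Submodule.span V.B {V.e₁}) ≅ V.polyTop.obj (ModuleCat.of A A) :=
  (LinearEquiv.ofBijective ((LinearMap.toSpanSingleton V.B (Tri (V.zeroTo (LPoly A)))
      (Tri.mk (V.zeroTo (LPoly A)) (LPoly.monomial 0 (1 : A)) 0)).comp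
        (Submodule.subtype (Submodule.span V.B {V.e₁}))) (by
    have hs : ∀ b : V.B, (b • Tri.mk (V.zeroTo (LPoly A)) (LPoly.monomial 0 (1 : A)) 0).1 =
        b.1 • (LPoly.monomial 0 (1 : A) : LPoly A) := fun b => by
      change b.1 • (LPoly.monomial 0 (1 : A) : LPoly A) + 0 = _
      rw [add_zero]
    constructor
    · rw [injective_iff_map_eq_zero]
      rintro ⟨b, hb⟩ h
      obtain ⟨c, rfl⟩ := Submodule.mem_span_singleton.1 hb
      apply Subtype.ext
      change c • V.e₁ = 0
      have h1 := (hs (c • V.e₁)).symm.trans (congrArg Prod.fst h)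
      rw [smul_e₁] at h1 ⊢
      have h2 : c.1 = 0 := by
        ext n
        rw [← LPoly.coeff_smul_monomial_one]
        exact (congrArg (LPoly.coeff n) h1).trans (map_zero (LPoly.coeff n))
      exact B_ext V h2 rfl rfl
    · intro p
      obtain ⟨q, hq⟩ := LPoly.exists_smul_monomial_one p.1
      let b : V.B := (q, 0, 0)
      refine ⟨⟨b • V.e₁, Submodule.smul_mem _ _ (Submodule.mem_span_singleton_self _)⟩, ?_⟩
      refine Prod.ext ((hs (b • V.e₁)).trans ?_) (Subsingleton.elim (α := PUnit) _ _)
      rw [smul_e₁]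
      exact hq)).toModuleIso

/-- The isomorphism `X₁ ≅ (A[y]; 0)`. -/
def X₁Iso : V.X₁ ≅
    (CochainComplex.singleFunctor (ModuleCat.{u} V.B) 0).obj (V.polyTop.obj (ModuleCat.of A A)) :=
  (CochainComplex.singleFunctor (ModuleCat.{u} V.B) 0).mapIso V.spanIso

/-- The isomorphism of `X₂` with the value of `TK` at `A`. -/
def X₂Iso : V.Q.obj V.X₂ ≅ V.TK.obj (ModuleCat.of A A) :=
  V.Q.mapIso (V.E'.mapIso V.X₁Iso)

/-- The isomorphism `E ⊗_A M[y] ≅ (E ⊗_A M)[y]` for the associated `B`-modules. -/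
def polyTopIso (M : ModuleCat.{u} A) : V.topObj (BTensor A E (LPoly M)) ≅
    V.polyTop.obj ((BTensor.functor A A E).obj M) :=
  triIso (polyTensor A E M) (LinearEquiv.refl _ _) (fun t => map_zero _)

theorem inAdd_X₁ : InAdd (V.Q.obj V.X₁) V.XX :=
  InAdd.of_retract (V.Q.map Limits.biprod.inl) (V.Q.map Limits.biprod.fst) 
    ((V.Q.map_comp _ _).symm.trans ((congrArg V.Q.map Limits.biprod.inl_fst).trans
      (V.Q.map_id _)))

theorem inAdd_X₂ : InAdd (V.Q.obj V.X₂) V.XX :=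
  InAdd.of_retract (V.Q.map Limits.biprod.inr) (V.Q.map Limits.biprod.snd) 
    ((V.Q.map_comp _ _).symm.trans ((congrArg V.Q.map Limits.biprod.inr_snd).trans
      (V.Q.map_id _)))

theorem inAdd_TK {M : ModuleCat.{u} A} (h : InAdd M (ModuleCat.of A A)) :
    InAdd (V.TK.obj M) V.XX :=
  ((h.map V.TK).trans (InAdd.of_retract V.X₂Iso.inv V.X₂Iso.hom V.X₂Iso.inv_hom_id)).trans
    V.inAdd_X₂

/-- What allows the factorization of maps out of complexes in degrees `0` and `1` to be applied to
`X`. -/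
theorem isZero_biprod_X (n : ℤ) (h0 : n ≠ 0) (h1 : n ≠ 1) :
    Limits.IsZero ((V.X₁ ⊞ V.X₂ : V.Cpx).X n) := by
  have hz : ∀ m : ℤ, m ≠ 0 → Limits.IsZero (V.X₁.X m) := fun m hm =>
    HomologicalComplex.isZero_single_obj_X (ComplexShape.up ℤ) 0 _ m hm
  have hz' : Limits.IsZero (V.X₂.X n) := (CoconeFunctor.twoTermSingle V.dNat _).zero n h0 h1
  have h := congrArg (fun f => HomologicalComplex.Hom.f f n)
    (Limits.biprod.total (X := V.X₁) (Y := V.X₂))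
  rw [Limits.IsZero.iff_id_eq_zero]
  refine h.symm.trans ?_
  change (Limits.biprod.fst (X := V.X₁) (Y := V.X₂)).f n ≫
      (Limits.biprod.inl (X := V.X₁) (Y := V.X₂)).f n +
    (Limits.biprod.snd (X := V.X₁) (Y := V.X₂)).f n ≫
      (Limits.biprod.inr (X := V.X₁) (Y := V.X₂)).f n = 0
  rw [(hz n h0).eq_of_tgt ((Limits.biprod.fst (X := V.X₁) (Y := V.X₂)).f n) 0,
    hz'.eq_of_tgt ((Limits.biprod.snd (X := V.X₁) (Y := V.X₂)).f n) 0, Limits.zero_comp,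
    Limits.zero_comp, add_zero]

/-- `Hom(X, E' T M)` is generated by the images of two maps from `Hom(X, T (E ⊗_A M))`. -/
theorem exists_jointlySurjective (M : ModuleCat.{u} A)
    (hM : Function.Injective (V.mu (BTensor A[X] V.Ey (LPoly M)))) :
    ∃ f : Bool → (V.homX (V.TK.obj ((BTensor.functor A A E).obj M)) ⟶
      V.homX (V.E'K.obj (V.TK.obj M))), JointlySurjective f := by
  obtain ⟨β₁, β₂, h⟩ := V.exists_topCpx_factor (LPoly M) (V.mu_LPoly_injective M) hM
  let i : V.topCpx (BTensor A E (LPoly M)) ≅ V.E'.obj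
      ((CochainComplex.singleFunctor (ModuleCat.{u} V.B) 0).obj
        (V.polyTop.obj ((BTensor.functor A A E).obj M))) :=
    V.E'.mapIso ((CochainComplex.singleFunctor (ModuleCat.{u} V.B) 0).mapIso (V.polyTopIso M))
  refine ⟨fun b => homXMap (V.Q.map (i.inv ≫ if b then β₁ else β₂)),
    eq_top_iff.2 fun φ hφ => ?_⟩
  clear hφ
  -- The quotient functor is full, so a morphism in the homotopy category can be factored through a
  -- representing chain map.
  obtain ⟨φ, rfl⟩ := V.Q.map_surjective (X := V.X₁ ⊞ V.X₂) (Y := V.E'.obj (V.topCpx (LPoly M))) φ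
  obtain ⟨g₁, g₂, hφ⟩ := h _ V.isZero_biprod_X φ
  have hi : ∀ (g : (V.X₁ ⊞ V.X₂ : V.Cpx) ⟶ V.topCpx (BTensor A E (LPoly M)))
      (β : V.topCpx (BTensor A E (LPoly M)) ⟶ V.E'.obj (V.topCpx (LPoly M))),
      V.Q.map (g ≫ β) = V.Q.map (g ≫ i.hom) ≫ V.Q.map (i.inv ≫ β) := fun g β => by
    rw [← V.Q.map_comp, Category.assoc, Iso.hom_inv_id_assoc]
  have h0 : V.Q.map φ = V.Q.map (g₁ ≫ i.hom) ≫ V.Q.map (i.inv ≫ β₁) +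
      V.Q.map (g₂ ≫ i.hom) ≫ V.Q.map (i.inv ≫ β₂) :=
    (congrArg V.Q.map hφ).trans (V.Q.map_add.trans (congrArg₂ (· + ·) (hi g₁ β₁) (hi g₂ β₂)))
  have h1 : (show V.HomX _ from V.Q.map (g₁ ≫ i.hom) ≫ V.Q.map (i.inv ≫ β₁)) ∈
      AddSubgroup.closure (⋃ b : Bool, Set.range
        (homXMap (V := V) (V.Q.map (i.inv ≫ if b then β₁ else β₂))).hom) :=
    AddSubgroup.subset_closure (Set.mem_iUnion.2 ⟨true, V.Q.map (g₁ ≫ i.hom), rfl⟩)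
  have h2 : (show V.HomX _ from V.Q.map (g₂ ≫ i.hom) ≫ V.Q.map (i.inv ≫ β₂)) ∈
      AddSubgroup.closure (⋃ b : Bool, Set.range
        (homXMap (V := V) (V.Q.map (i.inv ≫ if b then β₁ else β₂))).hom) :=
    AddSubgroup.subset_closure (Set.mem_iUnion.2 ⟨false, V.Q.map (g₂ ≫ i.hom), rfl⟩)
  exact (congrArg (fun z : V.HomX _ => z ∈ AddSubgroup.closure (⋃ b : Bool, Set.range
        (homXMap (V := V) (V.Q.map (i.inv ≫ if b then β₁ else β₂))).hom)) h0).mpr (add_mem h1 h2)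

variable {k : Type*} [Field k] [Algebra k A]

theorem subsingleton_homX_TK {M : ModuleCat.{u} A} [Subsingleton M] :
    Subsingleton (V.homX (V.TK.obj M)) := by
  have hM : Limits.IsZero (V.TK.obj M) := V.TK.map_isZero (ModuleCat.isZero_of_subsingleton M)
  exact ⟨fun f g => hM.eq_of_tgt (show V.XX ⟶ V.TK.obj M from f) g⟩

/-- The module `Ẽ ⊗_C Hom(X, T Eᵐ)` is a quotient of `Hom(X, E' T Eᵐ)`, which is generated by two
images of `Hom(X, T Eᵐ⁺¹)`. Each step lowers `n` and raises `m` by one, so that `Eᵐ⁺ⁿ` is unchanged;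
at `n = 0` the complex `T Eᵐ` is itself zero. -/
theorem subsingleton_tensorIter_TK [Module.Finite A E] [Module.Projective A E]
    (hfree : ∀ n : ℕ, V.PowFree k n) (n m : ℕ) (h : Subsingleton (tensorPow A E (m + n))) :
    Subsingleton (tensorIter V.C V.Etilde (V.homX (V.TK.obj (tensorPow A E m))) n) := by
  induction n generalizing m with
  | zero => exact V.subsingleton_homX_TK
  | succ n ih =>
    obtain ⟨f, hf⟩ := V.exists_jointlySurjective (tensorPow A E m)
      (V.mu_tensorPow_injective m (hfree (m + 2)))
    obtain ⟨p, hp⟩ := V.exists_surjective_tensor (V.inAdd_TK (inAdd_tensorPow (E := E) m))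
    rw [tensorIter_succ_eq]
    refine ((hf.comp p hp).tensorIter n).subsingleton (fun b => ih (m + 1) ?_)
    rwa [Nat.add_right_comm]

/-- If `Eⁿ = 0`, the part of `C` coming from `X₂ ≅ T A` is killed by `Ẽⁿ` and the part coming from
`X₁` by `Ẽⁿ⁺¹`. -/
theorem tensorNilpotent_Etilde [Module.Finite A E] [Module.Projective A E]
    (hfree : ∀ n : ℕ, V.PowFree k n) (h : TensorNilpotent A E) :
    TensorNilpotent V.C V.Etilde := by
  obtain ⟨n, hn⟩ := h
  have h2 : Subsingleton (tensorIter V.C V.Etilde (V.homX (V.Q.obj V.X₂)) n) := by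
    have hs : Function.Surjective (homXMap (V := V) V.X₂Iso.inv).hom := fun f =>
      ⟨(show V.XX ⟶ _ from f) ≫ V.X₂Iso.hom, (Category.assoc _ _ _).trans
        ((congrArg _ V.X₂Iso.hom_inv_id).trans (Category.comp_id _))⟩
    refine ((jointlySurjective_of_surjective _ hs).tensorIter n).subsingleton (fun _ => ?_)
    -- Here `m = 0`, as `E⁰ = A` and `X₂ ≅ T A`.
    exact V.subsingleton_tensorIter_TK hfree n 0 (by rwa [zero_add])
  have h2' : Subsingleton (tensorIter V.C V.Etilde (V.homX (V.Q.obj V.X₂)) (n + 1)) :=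
    BTensor.subsingleton_right
  have h1 : Subsingleton (tensorIter V.C V.Etilde (V.homX (V.Q.obj V.X₁)) (n + 1)) := by
    -- Since `E' X₁` is `X₂`, one factor `Ẽ` replaces `Hom(X, X₁)` by a quotient of `Hom(X, X₂)`;
    -- this accounts for the exponent `n + 1`.
    obtain ⟨p, hp⟩ := V.exists_surjective_tensor V.inAdd_X₁
    rw [tensorIter_succ_eq]
    exact ((jointlySurjective_of_surjective p hp).tensorIter n).subsingleton (fun _ => h2)
  let toC : V.homX V.XX ⟶ ModuleCat.of V.C V.C := ModuleCat.ofHom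
    { toFun := fun f => MulOpposite.op (α := End V.XX) (show V.XX ⟶ V.XX from f)
      map_add' := fun _ _ => rfl
      map_smul' := fun _ _ => rfl }
  let j₁ : V.Q.obj V.X₁ ⟶ V.XX := V.Q.map Limits.biprod.inl
  let j₂ : V.Q.obj V.X₂ ⟶ V.XX := V.Q.map Limits.biprod.inr
  let p₁ : V.XX ⟶ V.Q.obj V.X₁ := V.Q.map Limits.biprod.fst
  let p₂ : V.XX ⟶ V.Q.obj V.X₂ := V.Q.map Limits.biprod.snd
  have ht : p₁ ≫ j₁ + p₂ ≫ j₂ = 𝟙 V.XX :=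
    (congrArg₂ (· + ·) (V.Q.map_comp _ _).symm (V.Q.map_comp _ _).symm).trans
      (V.Q.map_add.symm.trans ((congrArg V.Q.map Limits.biprod.total).trans (V.Q.map_id _)))
  let N : Bool → ModuleCat.{u} V.C := fun b =>
    bif b then V.homX (V.Q.obj V.X₁) else V.homX (V.Q.obj V.X₂)
  let f : ∀ b, N b ⟶ ModuleCat.of V.C V.C := fun b => match b with
    | true => homXMap j₁ ≫ toC
    | false => homXMap j₂ ≫ toC
  have hf : JointlySurjective f := eq_top_iff.2 fun c hc => by
    clear hc
    -- Decomposing the target of an endomorphism of `X = X₁ ⊕ X₂` writes it as a sum of two maps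
    -- factoring through `X₁` and `X₂`.
    have hc : c = (homXMap j₁ ≫ toC).hom (show V.HomX _ from c.hom ≫ p₁) +
        (homXMap j₂ ≫ toC).hom (show V.HomX _ from c.hom ≫ p₂) := by
      refine congrArg (MulOpposite.op (α := End V.XX)) (?_ : c.hom = (c.hom ≫ p₁) ≫ j₁ +
        (c.hom ≫ p₂) ≫ j₂)
      rw [Category.assoc, Category.assoc, ← Preadditive.comp_add, ht, Category.comp_id]
    rw [hc]
    exact add_mem (AddSubgroup.subset_closure (Set.mem_iUnion.2 ⟨true, _, rfl⟩))
      (AddSubgroup.subset_closure (Set.mem_iUnion.2 ⟨false, _, rfl⟩))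
  exact ⟨n + 1, (hf.tensorIter (n + 1)).subsingleton (fun b => match b with
    | true => h1
    | false => h2')⟩

end TwoRep
end

theorem mainTheorem3 {k : Type*} {A E : Type u} [Field k] [Ring A] [Algebra k A]
    [AddCommGroup E] [Module k E] [Module A E] [Module Aᵐᵒᵖ E] [SMulCommClass A Aᵐᵒᵖ E]
    [IsScalarTower k A E] [IsScalarTower k Aᵐᵒᵖ E] (V : TwoRep A E)
    (hfg : Module.Finite A E) (hproj : Module.Projective A E) (hfree : ∀ n : ℕ, V.PowFree k n) :
    (LocallyNilpotent A E ↔ TensorNilpotent A E) ∧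
      (LocallyNilpotent A E →
        LocallyNilpotent V.C V.Etilde ∧ TensorNilpotent V.C V.Etilde) :=
  ⟨locallyNilpotent_iff, fun h => by
    have h' := V.tensorNilpotent_Etilde hfree (locallyNilpotent_iff.1 h)
    exact ⟨locallyNilpotent_iff.2 h', h'⟩⟩
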